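/- Setting. Let $E\subset\mathbb R^n$ be closed, let $d(x,E)$ be the distance from $x$ to $E$, and fix $m>0$, $\alpha,\beta\in(0,1]$ and $K_1,K_2>0$. Let $S:(\mathbb R^n\setminus E)\times E\to\mathbb C$ be such that $S(\cdot,y)$ is Lebesgue measurable for every $y\in E$ and $$|S(x,y)|\le \frac{K_1}{|x-y|^{m+\alpha}},\qquad |S(x,y)-S(x,y')|\le K_2\frac{|y-y'|^\beta}{|x-y|^{m+\alpha+\beta}}\ \text{ whenever } |y-y'|\le \tfrac12|x-y| .$$ A non-negative Borel measure $\mu$ on $\mathbb R^n$ is of order $m$ in $E$, with constant $C_0>0$, if $\operatorname{supp}\mu\subset E$ and $\mu(B(y,r))\le C_0r^m$ for all $y\in E$, $r>0$. Let $\mathcal M(E)$ be the set of complex Borel measures on $\mathbb R^n$ with support in $E$, and $|\nu|$ the total variation of $\nu$. Put $d\sigma(x)=d(x,E)^{-n}\,dx$ on $\mathbb R^n\setminus E$, $\Gamma(y)=\{x\in\mathbb R^n\setminus E:|x-y|<2d(x,E)\}$, and, for $\nu\in\mathcal M(E)$ and $f\in L^p(\mu)$, $$\mathcal C\nu(y)=\Big(\int_{\Gamma(y)}\Big|\int_E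 S(x,z)\,d\nu(z)\Big|^2d(x,E)^{2\alpha}\,d\sigma(x)\Big)^{1/2},\qquad \mathcal C_\mu f(y)=\Big(\int_{\Gamma(y)}\Big|\int_E S(x,z)f(z)\,d\mu(z)\Big|^2d(x,E)^{2\alpha}\,d\sigma(x)\Big)^{1/2}.$$ Let $\bar B(y,r)$ be the closed ball in $\mathbb R^n$. A closed ball in $E$ is a set $B=\bar B(y,r)\cap E$ with given centre $y\in E$ and radius $r>0$. It is $(10,b)$-doubling if $\mu(\bar B(y,10r))\le b\,\mu(\bar B(y,r))$, and it has $\kappa$-small boundary if $$\mu(\{x: r(1-s)<|x-y|<r(1+s)\})\le\kappa s\,\mu(\bar B(y,3r))\quad\text{for all } s\in[0,1].$$ Theorem. There are constants $b_0,\kappa_0$ depending only on $n$ such that the following holds for all $b\ge b_0$ and $\kappa\ge\kappa_0$. Let $\mu$ be of order $m$ in $E$ with constant $C_0$, let $\theta\in(0,1)$ and $A>0$, and suppose that each closed $(10,b)$-doubling ball $B$ in $E$ with $\kappa$-small boundary contains a Borel set $G_B\subset B$ with $\mu(G_B)\ge\theta\mu(B)$ such that $\mathcal C:\mathcal M(E)\to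 L^{1,\infty}(\mu\lfloor G_B)$ is bounded with constant $A$, that is, $$\mu(\{y\in G_B:\mathcal C\nu(y)>\lambda\})\le\frac A\lambda|\nu|(E)\quad\text{for all }\nu\in\mathcal M(E),\ \lambda>0 .$$ Then for every $p\in(1,\infty)$ the operator $\mathcal C_\mu$ is bounded on $L^p(\mu)$: for every $f\in L^p(\mu)$ the function $\mathcal C_\mu f$ belongs to $L^p(\mu)$ and $\|\mathcal C_\mu f\|_{L^p(\mu)}\le K\|f\|_{L^p(\mu)}$, where $K$ depends only on $n,b,\kappa,m,\alpha,\beta,K_1,K_2,C_0,\theta,A,p$. The same conclusion holds if, instead of the weak-type bound, $\mathcal C_\mu$ is bounded on $L^2(\mu\lfloor G_B)$ with constant $A$ for each such $B$, that is, $\|1_{G_B}\mathcal C_\mu f\|_{L^2(\mu)}\le A\|f\|_{L^2(\mu)}$ for all $f\in L^2(\mu)$ vanishing outside $G_B$. -/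

import Mathlib

open MeasureTheory Set Metric
open scoped ENNReal NNReal

namespace ConicalSquare

/-- Euclidean space `ℝⁿ`. -/
abbrev Rn (n : ℕ) : Type := EuclideanSpace ℝ (Fin n)

/-- Square function kernels `S : (ℝⁿ \ E) × E → ℂ`, represented by total functions whose values
outside `(ℝⁿ \ E) × E` play no role: Lebesgue measurability in the first variable, the size
estimate, and the Hölder estimate in the second variable. -/
structure IsKernel {n : ℕ} (E : Set (Rn n)) (m α β K₁ K₂ : ℝ) (S : Rn n → Rn n → ℂ) : Prop where
  aemeasurable : ∀ y ∈ E, AEMeasurable (fun x => S x y) (volume.restrict Eᶜ)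
  size : ∀ x ∉ E, ∀ y ∈ E, ‖S x y‖ ≤ K₁ * (1 / dist x y ^ (m + α))
  holder : ∀ x ∉ E, ∀ y ∈ E, ∀ y' ∈ E, dist y y' ≤ dist x y / 2 →
    ‖S x y - S x y'‖ ≤ K₂ * (dist y y' ^ β / dist x y ^ (m + α + β))

/-- The measure `μ` is of order `m` in the closed set `E`, with constant `C₀`. (In `ℝⁿ`, the
condition `μ Eᶜ = 0` says exactly that the support of `μ` is contained in the closed set `E`.) -/
def IsOfOrder {n : ℕ} (E : Set (Rn n)) (m C₀ : ℝ) (μ : Measure (Rn n)) : Prop :=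
  μ Eᶜ = 0 ∧ ∀ y ∈ E, ∀ r : ℝ, 0 < r → μ (ball y r) ≤ ENNReal.ofReal (C₀ * r ^ m)

/-- The measure `σ` given by `dσ(x) = d(x, E)⁻ⁿ dx` on `ℝⁿ \ E`. -/
noncomputable def sigma {n : ℕ} (E : Set (Rn n)) : Measure (Rn n) :=
  (volume.restrict Eᶜ).withDensity (fun x => ENNReal.ofReal ((infDist x E ^ n)⁻¹))

/-- The cone `Γ(y) = {x ∈ ℝⁿ \ E : |x - y| < 2 d(x, E)}`. -/
def cone {n : ℕ} (E : Set (Rn n)) (y : Rn n) : Set (Rn n) :=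
  {x | x ∉ E ∧ dist x y < 2 * infDist x E}

/-- `T_μ f(x) = ∫_E S(x, z) f(z) dμ(z)`. -/
noncomputable def integralOp {n : ℕ} (E : Set (Rn n)) (S : Rn n → Rn n → ℂ) (μ : Measure (Rn n))
    (f : Rn n → ℂ) (x : Rn n) : ℂ :=
  ∫ z in E, S x z * f z ∂μ

/-- `T ν(x) = ∫_E S(x, z) dν(z)` for a complex measure `ν`. -/
noncomputable def integralOpMeasure {n : ℕ} (E : Set (Rn n)) (S : Rn n → Rn n → ℂ)
    (ν : ComplexMeasure (Rn n)) (x : Rn n) : ℂ :=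
  ∫ᵛ z in E, S x z ∂[ContinuousLinearMap.mul ℝ ℂ; ν]

/-- `(∫_{Γ(y)} |u(x)|² d(x, E)^{2α} dσ(x))^{1/2}`, with values in `[0, ∞]`. -/
noncomputable def coneIntegral {n : ℕ} (E : Set (Rn n)) (α : ℝ) (u : Rn n → ℂ) (y : Rn n) : ℝ≥0∞ :=
  (∫⁻ x in cone E y, ‖u x‖ₑ ^ 2 * ENNReal.ofReal (infDist x E ^ (2 * α)) ∂(sigma E)) ^ (1 / 2 : ℝ)

/-- The conical square function `C_μ f`. -/
noncomputable def squareFun {n : ℕ} (E : Set (Rn n)) (α : ℝ) (S : Rn n → Rn n → ℂ)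
    (μ : Measure (Rn n)) (f : Rn n → ℂ) : Rn n → ℝ≥0∞ :=
  coneIntegral E α (integralOp E S μ f)

/-- The conical square function `C ν` of a complex measure. -/
noncomputable def squareFunMeasure {n : ℕ} (E : Set (Rn n)) (α : ℝ) (S : Rn n → Rn n → ℂ)
    (ν : ComplexMeasure (Rn n)) : Rn n → ℝ≥0∞ :=
  coneIntegral E α (integralOpMeasure E S ν)

/-- The closed ball with centre `y` and radius `r` is `(a, b)`-doubling with respect to `μ`. -/
def IsDoublingBall {n : ℕ} (μ : Measure (Rn n)) (a b : ℝ) (y : Rn n) (r : ℝ) : Prop :=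
  μ (closedBall y (a * r)) ≤ ENNReal.ofReal b * μ (closedBall y r)

/-- The closed ball with centre `y` and radius `r` has `κ`-small boundary with respect to `μ`. -/
def HasSmallBoundary {n : ℕ} (μ : Measure (Rn n)) (κ : ℝ) (y : Rn n) (r : ℝ) : Prop :=
  ∀ s ∈ Icc (0 : ℝ) 1, μ {x | r * (1 - s) < dist x y ∧ dist x y < r * (1 + s)} ≤
    ENNReal.ofReal (κ * s) * μ (closedBall y (3 * r))

/-- `C : M(E) → L^{1,∞}(μ⌊G)` is bounded with constant `A`, where `M(E)` consists of the complex
measures whose total variation is supported in `E`. -/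
def IsWeakBoundedOn {n : ℕ} (E : Set (Rn n)) (α : ℝ) (S : Rn n → Rn n → ℂ) (μ : Measure (Rn n))
    (A : ℝ) (G : Set (Rn n)) : Prop :=
  ∀ ν : ComplexMeasure (Rn n), ν.variation Eᶜ = 0 → ∀ t : ℝ, 0 < t →
    μ {y ∈ G | ENNReal.ofReal t < squareFunMeasure E α S ν y} ≤
      ENNReal.ofReal (A / t) * ν.variation E

/-- `C_μ : L²(μ⌊G) → L²(μ⌊G)` is bounded with constant `A`; elements of `L²(μ⌊G)` are identified
with the functions in `L²(μ)` that vanish outside `G`. -/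
def IsL2BoundedOn {n : ℕ} (E : Set (Rn n)) (α : ℝ) (S : Rn n → Rn n → ℂ) (μ : Measure (Rn n))
    (A : ℝ) (G : Set (Rn n)) : Prop :=
  ∀ f : Rn n → ℂ, MemLp f 2 μ → (∀ y ∉ G, f y = 0) →
    eLpNorm (squareFun E α S μ f) 2 (μ.restrict G) ≤ ENNReal.ofReal A * eLpNorm f 2 μ

/-- Every closed `(10, b)`-doubling ball `B` in `E` with `κ`-small boundary contains a Borel set
`G` such that `μ(G) ≥ θ μ(B)` and `P G`. -/
def HasBigPieces {n : ℕ} (E : Set (Rn n)) (μ : Measure (Rn n)) (b κ θ : ℝ)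
    (P : Set (Rn n) → Prop) : Prop :=
  ∀ y ∈ E, ∀ r : ℝ, 0 < r → IsDoublingBall μ 10 b y r → HasSmallBoundary μ κ y r →
    ∃ G : Set (Rn n), MeasurableSet G ∧ G ⊆ closedBall y r ∩ E ∧
      ENNReal.ofReal θ * μ (closedBall y r ∩ E) ≤ μ G ∧ P G

/-- `C_μ` is bounded on `L^p(μ)` with constant `K`. -/
def IsLpBounded {n : ℕ} (E : Set (Rn n)) (α : ℝ) (S : Rn n → Rn n → ℂ) (μ : Measure (Rn n))
    (p : ℝ≥0∞) (K : ℝ≥0) : Prop :=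
  ∀ f : Rn n → ℂ, MemLp f p μ →
    MemLp (squareFun E α S μ f) p μ ∧ eLpNorm (squareFun E α S μ f) p μ ≤ K * eLpNorm f p μ

end ConicalSquare

open ConicalSquare

/-! ### Geometry: the difference of two cones with nearby vertices. -/

namespace ConicalSquare

variable {n : ℕ}

/-! The proof is a good-λ argument for a non-doubling measure. Let `u` be the square function of
`f`, let `M` be the maximal function in which averages are normalised by the measure of the five
times larger ball (so that it is bounded on every `L^p(μ)`, `p > 1`, without doubling), and let `U =
{u > t}`, which is open. Around almost every point `y` of `U ∩ E` there is a doubling ball `B(y, ρ)`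
with small boundary, contained in `U` up to points outside `E`, such that a point `w` of it with
`u(w) > (1 + η)t` and `M f(w) ≤ γt` must already have square function of `f 1_{B(y, 2ρ)}` larger
than `ηt/2` (`exists_good_ball`). On the big piece `G` of this ball the weak type bound makes such
points rare, so the exceptional set misses a fixed proportion of the ball. A Vitali covering turns
this into the good-λ inequality `exists_goodLambda`, and integration in `t` gives the `L^p` bound.

The localisation splits `f` at radii `2ρ` and `L`, where `10L` is the distance from `y` to `E \ U`.
For the part outside `B(y, L)` (`exists_far_le`) the vertex `w` is compared with a point `x₀` where
`u ≤ t`. The integrand is the same for both vertices and only the cones differ; at height `t` the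
difference of cones with vertices at distance `h` occupies a fraction of order `h/t` of the layer
(`exists_volume_cone_diff_le`), and this gain makes the sum over dyadic heights converge. For the
part in between (`exists_ring_le`) no intermediate ball is doubling, so the mass of `B(y, L/100^i)`
decays faster than its radius to the power `m`, and the potential of `|f|μ` sums geometrically.
Almost every point has arbitrarily small doubling balls because `b ≥ 100^(n+1)` beats the volume
growth.

Only finite sums of point masses and their limits are ever tested in the weak type bound. Hence the
`L²` hypothesis reduces to the first one by a non-homogeneous Calderón–Zygmund decomposition of
finite sums of point masses relative to `μ⌊G` (`exists_calderonZygmund`,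
`exists_isDiscreteWeakBoundedOn`). There the clusters of masses are compensated by densities spread
over doubling balls, and the Hölder condition in the second variable provides decay far from a
cluster.

All finiteness needed along the way is obtained by restricting the cones to `{d(x, E) > ε}` and `f`
to bounded functions with bounded support. The constants do not depend on these truncations, which
are removed by Fatou's lemma. -/

theorem exists_finite_direction_net (n : ℕ) :
    ∃ N : Finset (Rn n), (∀ v ∈ N, ‖v‖ = 1) ∧ ∀ u : Rn n, ‖u‖ = 1 → ∃ v ∈ N, ‖u - v‖ ≤ 1 / 8 := by
  obtain ⟨t, hts, htf, hcov⟩ := (isCompact_sphere (0 : Rn n) 1).finite_cover_balls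
    (e := 1 / 8) (by norm_num)
  refine ⟨htf.toFinset, fun v hv => by simpa using hts (htf.mem_toFinset.1 hv), fun u hu => ?_⟩
  have := hcov (show u ∈ sphere (0 : Rn n) 1 by simpa using hu)
  simp only [mem_iUnion, exists_prop] at this
  obtain ⟨v, hv, huv⟩ := this
  exact ⟨v, htf.mem_toFinset.2 hv, by rw [← dist_eq_norm]; exact (mem_ball.1 huv).le⟩

/-- Moving from `x` in a direction that nearly points to a closest point of `E` decreases the
distance to `E` at a definite rate. -/
theorem infDist_add_smul_le {E : Set (Rn n)} {x e u v : Rn n}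
    (he : e ∈ E) (hu : e - x = infDist x E • u)
    (hu1 : ‖u‖ = 1) (huv : ‖u - v‖ ≤ 1 / 8) {s : ℝ} (hs : 0 ≤ s) (hsd : s ≤ infDist x E) :
    infDist (x + s • v) E ≤ infDist x E - 7 / 8 * s := by
  have h1 : infDist (x + s • v) E ≤ dist (x + s • v) e := infDist_le_dist_of_mem he
  have h2 : x + s • v - e = -((infDist x E - s) • u) - s • (u - v) := by
    have : e = x + infDist x E • u := by rw [← hu]; abel
    rw [smul_sub, sub_smul]
    nth_rw 1 [this]
    abel
  have h3 : dist (x + s • v) e ≤ (infDist x E - s) + s * (1 / 8) := by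
    rw [dist_eq_norm, h2]
    refine (norm_sub_le _ _).trans ?_
    rw [norm_neg, norm_smul, norm_smul, hu1, Real.norm_of_nonneg (by linarith),
      Real.norm_of_nonneg hs, mul_one]
    gcongr
  linarith

/-- Packing: the translates of `Z` by `0, c, …, (J-1)c` are pairwise disjoint and all lie in `B`.
Only differences of indices matter, so disjointness has to be tested against `Z` itself only. -/
theorem volume_le_of_disjoint_translates {Z : Set (Rn n)} (hZ : MeasurableSet Z) (c : Rn n)
    (J : ℕ) {B : Set (Rn n)} (hB : ∀ j < J, ∀ x ∈ Z, x + (j : ℝ) • c ∈ B)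
    (hdisj : ∀ j : ℕ, 0 < j → j < J → ∀ x ∈ Z, x + (j : ℝ) • c ∉ Z) :
    (J : ℝ≥0∞) * volume Z ≤ volume B := by
  let T : ℕ → Set (Rn n) := fun j => (fun x => x + (-((j : ℝ) • c))) ⁻¹' Z
  have hT : ∀ j, MeasurableSet (T j) := fun j => (measurable_add_const _) hZ
  have hvol : ∀ j, volume (T j) = volume Z := fun j => measure_preimage_add_right _ _ _
  have key : ∀ i j : ℕ, i < j → j < J → Disjoint (T i) (T j) := by
    intro i j hij hj
    rw [Set.disjoint_left]
    intro x hx hx'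
    have := hdisj (j - i) (by omega) (by omega) _ hx'
    apply this
    have e : x + -((j : ℝ) • c) + ((j - i : ℕ) : ℝ) • c = x + -((i : ℝ) • c) := by
      rw [Nat.cast_sub hij.le, sub_smul]; abel
    rw [e]; exact hx
  have hpd : Set.PairwiseDisjoint (↑(Finset.range J)) T := by
    intro i hi j hj hij
    rcases lt_or_gt_of_ne hij with h | h
    · exact key i j h (by simpa using hj)
    · exact (key j i h (by simpa using hi)).symm
  calc (J : ℝ≥0∞) * volume Z = ∑ j ∈ Finset.range J, volume (T j) := by
        simp [hvol]
    _ = volume (⋃ j ∈ Finset.range J, T j) :=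
        (measure_biUnion_finset hpd fun j _ => hT j).symm
    _ ≤ volume B := by
        apply measure_mono
        intro x hx
        simp only [mem_iUnion, Finset.mem_range, exists_prop] at hx
        obtain ⟨j, hj, hx⟩ := hx
        have := hB j hj _ hx
        simpa using this

/-- The part of the difference of two cones at height `t` has small volume. -/
theorem exists_volume_cone_diff_le (n : ℕ) :
    ∃ C : ℝ≥0, ∀ (E : Set (Rn n)), IsClosed E → ∀ (w x₀ : Rn n) (h t : ℝ), 0 < h → 0 < t →
      dist w x₀ ≤ h →
      volume {x | (t ≤ infDist x E ∧ infDist x E < 2 * t) ∧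
        dist x w < 2 * infDist x E ∧ 2 * infDist x E ≤ dist x x₀} ≤
        C * ENNReal.ofReal (h / t * t ^ n) := by
  obtain ⟨N, hN1, hN2⟩ := exists_finite_direction_net n
  have hVfin : volume (closedBall (0 : Rn n) 1) ≠ ∞ := measure_closedBall_lt_top.ne
  set V : ℝ≥0 := (volume (closedBall (0 : Rn n) 1)).toNNReal with hV
  have hVc : (V : ℝ≥0∞) = volume (closedBall (0 : Rn n) 1) := ENNReal.coe_toNNReal hVfin
  have hball : ∀ (y : Rn n) (r : ℝ), 0 ≤ r →
      volume (closedBall y r) = ENNReal.ofReal (r ^ n) * V := by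
    intro y r hr
    rw [hVc, Measure.addHaar_closedBall' _ _ hr]
    simp
  refine ⟨(2 + N.card * 4) * (6 ^ n) * V, ?_⟩
  intro E hE w x₀ h t hh ht hwx
  set Z := {x | (t ≤ infDist x E ∧ infDist x E < 2 * t) ∧
        dist x w < 2 * infDist x E ∧ 2 * infDist x E ≤ dist x x₀} with hZ
  have hZball : ∀ x ∈ Z, dist x w ≤ 4 * t := by
    rintro x ⟨⟨_, h2⟩, h3, _⟩
    linarith
  -- If `t < 2h`, the factor `h / t` is at least `1/2` and the trivial bound by a ball of radius
  -- `4t` suffices.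
  rcases lt_or_ge t (2 * h) with hth | hth
  · calc volume Z ≤ volume (closedBall w (4 * t)) := measure_mono fun x hx => hZball x hx
      _ = ENNReal.ofReal ((4 * t) ^ n) * V := hball _ _ (by positivity)
      _ ≤ ENNReal.ofReal (2 * 6 ^ n * (h / t * t ^ n)) * V := by
          gcongr
          rw [mul_pow]
          have : (1:ℝ) ≤ 2 * (h / t) := by
            rw [← mul_div_assoc, le_div_iff₀ ht]; linarith
          have h46 : (4:ℝ) ^ n ≤ 6 ^ n := by gcongr; norm_num
          calc (4:ℝ) ^ n * t ^ n ≤ 1 * (6 ^ n * t ^ n) := by rw [one_mul]; gcongr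
            _ ≤ (2 * (h / t)) * (6 ^ n * t ^ n) := by gcongr
            _ = _ := by ring
      _ ≤ _ := by
          rw [ENNReal.ofReal_mul (by positivity)]
          have : ENNReal.ofReal (2 * 6 ^ n) = ((2 * 6 ^ n : ℝ≥0) : ℝ≥0∞) := by
            rw [ENNReal.ofReal, Real.toNNReal_mul (by norm_num), Real.toNNReal_pow (by norm_num)]
            simp
          rw [this, mul_right_comm, ← ENNReal.coe_mul]
          gcongr
          · simp
  · have hZv : ∀ v ∈ N, volume (Z ∩ {x | ∀ s ∈ Icc (0:ℝ) t,
        infDist (x + s • v) E ≤ infDist x E - 7 / 8 * s}) ≤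
          ENNReal.ofReal (4 * 6 ^ n * (h / t * t ^ n)) * V := by
      intro v hv
      set Zv := Z ∩ {x | ∀ s ∈ Icc (0:ℝ) t,
        infDist (x + s • v) E ≤ infDist x E - 7 / 8 * s} with hZvdef
      have hmeas : MeasurableSet Zv := by
        apply MeasurableSet.inter
        · have hc : Continuous fun x : Rn n => infDist x E := continuous_infDist_pt E
          have hm := hc.measurable
          exact ((measurableSet_le measurable_const hm).inter
            (measurableSet_lt hm measurable_const)).inter
            ((measurableSet_lt (f := fun x => dist x w) (by fun_prop) (hm.const_mul 2)).inter
              (measurableSet_le (g := fun x => dist x x₀) (hm.const_mul 2) (by fun_prop)))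
        · apply IsClosed.measurableSet
          have : {x : Rn n | ∀ s ∈ Icc (0:ℝ) t,
              infDist (x + s • v) E ≤ infDist x E - 7 / 8 * s} =
              ⋂ s ∈ Icc (0:ℝ) t, {x | infDist (x + s • v) E ≤ infDist x E - 7 / 8 * s} := by
            ext x; simp
          rw [this]
          refine isClosed_biInter fun s _ => isClosed_le ?_ ?_
          · exact (continuous_infDist_pt E).comp (by fun_prop)
          · exact (continuous_infDist_pt E).sub continuous_const
      -- About `t / (2h)` translates with step `2h` in the direction `v` stay within distance `t` of
      -- `Z`, so the volume of `Zv` is at most a fraction of order `h / t` of that of a ball of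
      -- radius `6t`.
      set J := ⌊t / (2 * h)⌋₊ with hJ
      have hJ1 : (J : ℝ) * (2 * h) ≤ t := by
        have := Nat.floor_le (show 0 ≤ t / (2 * h) by positivity)
        rwa [le_div_iff₀ (by positivity)] at this
      have hJ2 : t / (4 * h) ≤ J := by
        have h1 : t / (2 * h) < J + 1 := Nat.lt_floor_add_one _
        have h2 : 1 ≤ J := Nat.one_le_floor_iff _ |>.2 (by rw [le_div_iff₀ (by positivity)]; linarith)
        have h3 : (1:ℝ) ≤ J := by exact_mod_cast h2
        have : t / (2 * h) = 2 * (t / (4 * h)) := by field_simp; ring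
        linarith
      have hmain : (J : ℝ≥0∞) * volume Zv ≤ volume (closedBall w (6 * t)) := by
        apply volume_le_of_disjoint_translates hmeas ((2 * h) • v)
        · intro j hj x hx
          have h1 := hZball x hx.1
          have h2 : (j : ℝ) ≤ J := by exact_mod_cast hj.le
          rw [mem_closedBall, dist_eq_norm, add_sub_right_comm]
          refine (norm_add_le _ _).trans ?_
          rw [← dist_eq_norm, smul_smul, norm_smul, hN1 v hv, Real.norm_of_nonneg (by positivity)]
          have : (j : ℝ) * (2 * h) ≤ J * (2 * h) := by gcongr
          linarith
        -- If both `x` and `x + s v` were in `Z`, then `2d(x) ≤ |x - x₀| < s + 2d(x + s v) + h ≤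
        -- 2d(x) - 3s/4 + h`, which forces `3s/4 < h` and contradicts `s ≥ 2h`.
        · intro j hj0 hj x hx hx'
          have h2 : (j : ℝ) ≤ J := by exact_mod_cast hj.le
          have h3 : (1 : ℝ) ≤ j := by exact_mod_cast hj0
          have h4 : (j : ℝ) * (2 * h) ≤ J * (2 * h) := by gcongr
          have h5 : 1 * (2 * h) ≤ (j : ℝ) * (2 * h) := by gcongr
          rw [smul_smul] at hx'
          set s := (j : ℝ) * (2 * h) with hs
          have h6 := hx.2 s ⟨by positivity, by linarith⟩
          have h7 := hx'.1.2.1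
          have h8 := hx.1.2.2
          have h9 : dist x x₀ ≤ dist x (x + s • v) + dist (x + s • v) w + dist w x₀ :=
            dist_triangle4 _ _ _ _
          have h10 : dist x (x + s • v) = s := by
            rw [dist_self_add_right, norm_smul, hN1 v hv, Real.norm_of_nonneg (by positivity),
              mul_one]
          linarith
      rw [hball _ _ (by positivity)] at hmain
      have hJpos : (0:ℝ) < J := lt_of_lt_of_le (by positivity) hJ2
      have hJ0 : (J : ℝ≥0∞) ≠ 0 := by
        exact_mod_cast (Nat.cast_pos.1 hJpos).ne'
      have hfin : volume Zv ≤ ENNReal.ofReal ((6 * t) ^ n) * V / J := by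
        rw [ENNReal.le_div_iff_mul_le (Or.inl hJ0) (Or.inl (ENNReal.natCast_ne_top _)), mul_comm]
        exact hmain
      refine hfin.trans ?_
      rw [ENNReal.mul_div_right_comm]
      gcongr
      rw [← ENNReal.ofReal_natCast, ← ENNReal.ofReal_div_of_pos hJpos]
      apply ENNReal.ofReal_le_ofReal
      rw [div_le_iff₀ hJpos]
      calc (6 * t) ^ n = 4 * 6 ^ n * (h / t * t ^ n) * (t / (4 * h)) := by
            rw [mul_pow]; field_simp
        _ ≤ _ := by gcongr
    have hcov : Z ⊆ ⋃ v ∈ N, (Z ∩ {x | ∀ s ∈ Icc (0:ℝ) t,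
        infDist (x + s • v) E ≤ infDist x E - 7 / 8 * s}) := by
      intro x hx
      have hne : E.Nonempty := by
        by_contra hcon
        rw [not_nonempty_iff_eq_empty] at hcon
        have := hx.1.1
        rw [hcon, infDist_empty] at this
        linarith
      obtain ⟨e, he, hxe⟩ := hE.exists_infDist_eq_dist hne x
      have hd : 0 < infDist x E := lt_of_lt_of_le ht hx.1.1
      set u := (infDist x E)⁻¹ • (e - x) with hu
      have hu1 : ‖u‖ = 1 := by
        rw [hu, norm_smul, Real.norm_of_nonneg (by positivity), ← dist_eq_norm, dist_comm, ← hxe,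
          inv_mul_cancel₀ hd.ne']
      obtain ⟨v, hv, huv⟩ := hN2 u hu1
      simp only [mem_iUnion, exists_prop]
      refine ⟨v, hv, hx, fun s hs => ?_⟩
      refine infDist_add_smul_le he ?_ hu1 huv hs.1 (hs.2.trans hx.1.1)
      rw [hu, smul_smul, mul_inv_cancel₀ hd.ne', one_smul]
    calc volume Z ≤ ∑ v ∈ N, volume (Z ∩ {x | ∀ s ∈ Icc (0:ℝ) t,
            infDist (x + s • v) E ≤ infDist x E - 7 / 8 * s}) :=
          (measure_mono hcov).trans (measure_biUnion_finset_le _ _)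
      _ ≤ ∑ v ∈ N, ENNReal.ofReal (4 * 6 ^ n * (h / t * t ^ n)) * V := Finset.sum_le_sum hZv
      _ = N.card * (ENNReal.ofReal (4 * 6 ^ n * (h / t * t ^ n)) * V) := by
          rw [Finset.sum_const, nsmul_eq_mul]
      _ = ((N.card * 4 * 6 ^ n * V : ℝ≥0) : ℝ≥0∞) * ENNReal.ofReal (h / t * t ^ n) := by
          rw [ENNReal.ofReal_mul (by positivity)]
          have : ENNReal.ofReal (4 * 6 ^ n) = ((4 * 6 ^ n : ℝ≥0) : ℝ≥0∞) := by
            rw [ENNReal.ofReal, Real.toNNReal_mul (by norm_num), Real.toNNReal_pow (by norm_num)]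
            simp
          rw [this]
          push_cast
          ring
      _ ≤ _ := by
          gcongr
          simp

end ConicalSquare

/-! ### Integrals over cones, by dyadic layers of the distance to `E`. -/

namespace ConicalSquare

variable {n : ℕ} {E : Set (Rn n)} {α : ℝ}

/-- The measure `d(x, E)^{2α} dσ(x)`. -/
noncomputable def coneWeight (E : Set (Rn n)) (α : ℝ) : Measure (Rn n) :=
  (volume.restrict Eᶜ).withDensity
    (fun x => ENNReal.ofReal ((infDist x E ^ n)⁻¹) * ENNReal.ofReal (infDist x E ^ (2 * α)))

/-- The conical `L²` seminorm of `u` at `y` relative to the measure `ω`. -/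
noncomputable def coneNorm (ω : Measure (Rn n)) (E : Set (Rn n)) (u : Rn n → ℂ) (y : Rn n) :
    ℝ≥0∞ :=
  (∫⁻ x in cone E y, ‖u x‖ₑ ^ 2 ∂ω) ^ (1 / 2 : ℝ)

theorem isOpen_cone (hE : IsClosed E) (y : Rn n) : IsOpen (cone E y) := by
  refine hE.isOpen_compl.inter (isOpen_lt (f := fun x => dist x y) (by fun_prop) ?_)
  exact continuous_const.mul (continuous_infDist_pt E)

theorem infDist_pos_of_mem_cone {x y : Rn n} (hx : x ∈ cone E y) : 0 < infDist x E := by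
  have := hx.2
  have h2 := dist_nonneg (x := x) (y := y)
  linarith

theorem lintegral_coneWeight {W : Set (Rn n)} (hW : MeasurableSet W)
    (hWE : W ⊆ Eᶜ) (F : Rn n → ℝ≥0∞) :
    ∫⁻ x in W, F x ∂(coneWeight E α) =
      ∫⁻ x in W, ENNReal.ofReal ((infDist x E ^ n)⁻¹) *
        ENNReal.ofReal (infDist x E ^ (2 * α)) * F x := by
  have hm : Measurable fun x : Rn n => infDist x E := measurable_infDist
  rw [coneWeight, restrict_withDensity hW, lintegral_withDensity_eq_lintegral_mul_non_measurable,
    Measure.restrict_restrict hW, inter_eq_left.2 hWE]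
  · simp only [Pi.mul_apply]
  · fun_prop
  · filter_upwards with x
    exact ENNReal.mul_lt_top ENNReal.ofReal_lt_top ENNReal.ofReal_lt_top

/-- Merging both weights into a single measure makes truncation a mere restriction of that measure;
all later estimates hold for any `ω ≤ coneWeight E α`. -/
theorem coneIntegral_eq_coneNorm (hE : IsClosed E) (u : Rn n → ℂ) (y : Rn n) :
    coneIntegral E α u y = coneNorm (coneWeight E α) E u y := by
  have hm : Measurable fun x : Rn n => infDist x E := measurable_infDist
  have hc := (isOpen_cone hE y).measurableSet
  have hcE : cone E y ⊆ Eᶜ := fun x hx => hx.1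
  rw [coneIntegral, coneNorm, lintegral_coneWeight hc hcE]
  congr 1
  rw [sigma, restrict_withDensity hc, lintegral_withDensity_eq_lintegral_mul_non_measurable,
    Measure.restrict_restrict hc, inter_eq_left.2 hcE]
  · simp only [Pi.mul_apply]
    congr 1
    ext x
    ring
  · fun_prop
  · filter_upwards with x
    exact ENNReal.ofReal_lt_top

theorem coneWeight_absolutelyContinuous : coneWeight E α ≪ volume.restrict Eᶜ :=
  withDensity_absolutelyContinuous _ _

/-- On a dyadic layer the weight is of size `t^(2α - n)`; the factor `4` bounds `2^(2α)`, since `α ≤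
1`. -/
theorem coneWeight_layer_le (hα : α ∈ Ioc (0 : ℝ) 1) {W : Set (Rn n)} {t : ℝ}
    (ht : 0 < t) (hW : MeasurableSet W)
    (hWt : ∀ x ∈ W, t ≤ infDist x E ∧ infDist x E < 2 * t) :
    coneWeight E α W ≤ ENNReal.ofReal (4 * t ^ (2 * α) * (t ^ n)⁻¹) * volume W := by
  have hWE : W ⊆ Eᶜ := fun x hx hxE => by
    have := (hWt x hx).1
    rw [infDist_zero_of_mem hxE] at this
    linarith
  have := lintegral_coneWeight (α := α) hW hWE (fun _ => 1)
  simp only [lintegral_one, Measure.restrict_apply_univ, mul_one] at this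
  rw [this]
  calc _ ≤ ∫⁻ x in W, ENNReal.ofReal (4 * t ^ (2 * α) * (t ^ n)⁻¹) := by
        refine setLIntegral_mono' hW fun x hx => ?_
        obtain ⟨h1, h2⟩ := hWt x hx
        rw [← ENNReal.ofReal_mul (inv_nonneg.2 (pow_nonneg infDist_nonneg _)), mul_comm]
        apply ENNReal.ofReal_le_ofReal
        have h3 : infDist x E ^ (2 * α) ≤ 4 * t ^ (2 * α) := by
          calc infDist x E ^ (2 * α) ≤ (2 * t) ^ (2 * α) :=
                Real.rpow_le_rpow infDist_nonneg h2.le (by linarith [hα.1])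
            _ = 2 ^ (2 * α) * t ^ (2 * α) := Real.mul_rpow (by norm_num) ht.le
            _ ≤ 2 ^ (2 : ℝ) * t ^ (2 * α) := by
                gcongr
                · norm_num
                · linarith [hα.2]
            _ = _ := by norm_num
        have h4 : (infDist x E ^ n)⁻¹ ≤ (t ^ n)⁻¹ := by gcongr
        exact mul_le_mul h3 h4 (inv_nonneg.2 (pow_nonneg infDist_nonneg _)) (by positivity)
    _ = _ := by simp

theorem coneWeight_cone_layer_le (hE : IsClosed E) (hα : α ∈ Ioc (0 : ℝ) 1) (y : Rn n) {t : ℝ}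
    (ht : 0 < t) :
    coneWeight E α (cone E y ∩ {x | t ≤ infDist x E ∧ infDist x E < 2 * t}) ≤
      ENNReal.ofReal (4 ^ (n + 1) * t ^ (2 * α)) * volume (closedBall (0 : Rn n) 1) := by
  have hm : Measurable fun x : Rn n => infDist x E := measurable_infDist
  have hmeas : MeasurableSet (cone E y ∩ {x | t ≤ infDist x E ∧ infDist x E < 2 * t}) :=
    (isOpen_cone hE y).measurableSet.inter
      ((measurableSet_le measurable_const hm).inter (measurableSet_lt hm measurable_const))
  refine (coneWeight_layer_le hα ht hmeas fun x hx => hx.2).trans ?_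
  have hsub : cone E y ∩ {x | t ≤ infDist x E ∧ infDist x E < 2 * t} ⊆ closedBall y (4 * t) := by
    rintro x ⟨hx1, hx2, hx3⟩
    have := hx1.2
    rw [mem_closedBall]
    linarith
  calc _ ≤ ENNReal.ofReal (4 * t ^ (2 * α) * (t ^ n)⁻¹) * volume (closedBall y (4 * t)) := by
        gcongr
    _ = _ := by
        rw [Measure.addHaar_closedBall' _ _ (by positivity), ← mul_assoc,
          ← ENNReal.ofReal_mul (by positivity)]
        congr 2
        simp only [finrank_euclideanSpace, Fintype.card_fin]
        rw [mul_pow]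
        field_simp
        ring

theorem setLIntegral_le_tsum_layers (ω : Measure (Rn n)) {W : Set (Rn n)}
    (hpos : ∀ x ∈ W, 0 < infDist x E) {ρ : ℝ} (hρ : 0 < ρ) (Φ : Rn n → ℝ≥0∞)
    (c : ℤ → ℝ≥0∞) (hW : MeasurableSet W)
    (hΦ : ∀ k : ℤ, ∀ x ∈ W, 2 ^ k * ρ ≤ infDist x E → infDist x E < 2 * (2 ^ k * ρ) → Φ x ≤ c k) :
    ∫⁻ x in W, Φ x ∂ω ≤ ∑' k : ℤ, c k *
      ω (W ∩ {x | 2 ^ k * ρ ≤ infDist x E ∧ infDist x E < 2 * (2 ^ k * ρ)}) := by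
  have hm : Measurable fun x : Rn n => infDist x E := measurable_infDist
  set U : ℤ → Set (Rn n) :=
    fun k => W ∩ {x | 2 ^ k * ρ ≤ infDist x E ∧ infDist x E < 2 * (2 ^ k * ρ)} with hU
  have hUm : ∀ k, MeasurableSet (U k) := fun k => hW.inter
      ((measurableSet_le measurable_const hm).inter (measurableSet_lt hm measurable_const))
  have hcov : W ⊆ ⋃ k, U k := by
    intro x hx
    obtain ⟨k, hk1, hk2⟩ := exists_mem_Ico_zpow (x := infDist x E / ρ) (y := (2:ℝ))
      (div_pos (hpos x hx) hρ) (by norm_num)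
    rw [le_div_iff₀ hρ] at hk1
    rw [div_lt_iff₀ hρ, zpow_add_one₀ (by norm_num)] at hk2
    exact mem_iUnion.2 ⟨k, hx, hk1, by linarith⟩
  calc ∫⁻ x in W, Φ x ∂ω ≤ ∫⁻ x in ⋃ k, U k, Φ x ∂ω := lintegral_mono_set hcov
    _ ≤ ∑' k, ∫⁻ x in U k, Φ x ∂ω := lintegral_iUnion_le _ _
    _ ≤ ∑' k, c k * ω (U k) := by
        refine ENNReal.tsum_le_tsum fun k => ?_
        calc ∫⁻ x in U k, Φ x ∂ω ≤ ∫⁻ x in U k, c k ∂ω :=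
              setLIntegral_mono' (hUm k) fun x hx => hΦ k x hx.1 hx.2.1 hx.2.2
          _ = _ := by simp

/-- The terms behave like `2^(-ka)` for `k ≥ 0` (high above `E`) and like `2^(kb)` for `k ≤ 0` (near
`E`), so both ends are geometric. -/
theorem summable_layer {a b : ℝ} (ha : 0 < a) (hb : 0 < b) :
    Summable fun k : ℤ => ((2 : ℝ) ^ k + 1) ^ (-(a + b)) * ((2 : ℝ) ^ k) ^ b := by
  have geo : ∀ {c : ℝ}, 0 < c → Summable fun k : ℕ => ((2 : ℝ) ^ (-c)) ^ k := fun hc =>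
    summable_geometric_of_lt_one (by positivity)
      (Real.rpow_lt_one_of_one_lt_of_neg (by norm_num) (by linarith))
  apply Summable.of_nat_of_neg
  · refine Summable.of_nonneg_of_le (fun k => by positivity) (fun k => ?_) (geo ha)
    have h2 : (0:ℝ) < 2 ^ k := by positivity
    calc ((2 : ℝ) ^ (k:ℤ) + 1) ^ (-(a + b)) * ((2 : ℝ) ^ (k:ℤ)) ^ b
        ≤ ((2 : ℝ) ^ k) ^ (-(a + b)) * ((2 : ℝ) ^ k) ^ b := by
          rw [zpow_natCast]
          exact mul_le_mul_of_nonneg_right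
            (Real.rpow_le_rpow_of_nonpos h2 (by linarith) (by linarith)) (by positivity)
      _ = ((2:ℝ) ^ k) ^ (-a) := by rw [← Real.rpow_add h2]; congr 1; ring
      _ = _ := by
          rw [← Real.rpow_natCast, ← Real.rpow_natCast, ← Real.rpow_mul (by norm_num),
            ← Real.rpow_mul (by norm_num), mul_comm]
  · refine Summable.of_nonneg_of_le (fun k => by positivity) (fun k => ?_) (geo hb)
    have h2 : (0:ℝ) < (2 : ℝ) ^ (-(k:ℤ)) := by positivity
    calc ((2 : ℝ) ^ (-(k:ℤ)) + 1) ^ (-(a + b)) * ((2 : ℝ) ^ (-(k:ℤ))) ^ b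
        ≤ 1 * ((2 : ℝ) ^ (-(k:ℤ))) ^ b := by
          gcongr
          exact Real.rpow_le_one_of_one_le_of_nonpos (by linarith) (by linarith)
      _ = _ := by
          rw [one_mul, zpow_neg, zpow_natCast, ← Real.rpow_natCast, ← Real.rpow_natCast,
            ← Real.rpow_neg (by norm_num), ← Real.rpow_mul (by norm_num),
            ← Real.rpow_mul (by norm_num)]
          congr 1; ring

/-- Integration over a cone of the square of `(d + ρ)^{-(s + α)}`. -/
theorem exists_lintegral_cone_le (n : ℕ) {α s : ℝ} (hα : α ∈ Ioc (0 : ℝ) 1) (hs : 0 < s) :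
    ∃ C : ℝ≥0, ∀ (E : Set (Rn n)), IsClosed E → ∀ (y : Rn n) (ρ : ℝ), 0 < ρ →
      ∫⁻ x in cone E y, ENNReal.ofReal ((infDist x E + ρ) ^ (-(s + α))) ^ 2 ∂(coneWeight E α) ≤
        C * ENNReal.ofReal (ρ ^ (-s)) ^ 2 := by
  have hsum := summable_layer (a := 2 * s) (b := 2 * α) (by linarith) (by linarith [hα.1])
  set q : ℤ → ℝ := fun k => ((2 : ℝ) ^ k + 1) ^ (-(2 * s + 2 * α)) * ((2 : ℝ) ^ k) ^ (2 * α) with hq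
  have hq0 : ∀ k, 0 ≤ q k := fun k => by positivity
  have hV : volume (closedBall (0 : Rn n) 1) ≠ ∞ := measure_closedBall_lt_top.ne
  refine ⟨(ENNReal.ofReal (4 ^ (n + 1)) * volume (closedBall (0 : Rn n) 1) *
    ENNReal.ofReal (∑' k, q k)).toNNReal, fun E hE y ρ hρ => ?_⟩
  rw [ENNReal.coe_toNNReal (by finiteness), ENNReal.ofReal_tsum_of_nonneg hq0 hsum,
    ← ENNReal.tsum_mul_left, ← ENNReal.tsum_mul_right]
  refine (setLIntegral_le_tsum_layers _ (fun x hx => infDist_pos_of_mem_cone hx) hρ _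
    (fun k => ENNReal.ofReal ((2 ^ k * ρ + ρ) ^ (-(s + α))) ^ 2)
    (isOpen_cone hE y).measurableSet ?_).trans ?_
  · intro k x _ h1 _
    gcongr ENNReal.ofReal ?_ ^ 2
    exact Real.rpow_le_rpow_of_nonpos (by positivity) (by linarith) (by linarith [hα.1])
  · refine ENNReal.tsum_le_tsum fun k => ?_
    have hk : (0:ℝ) < 2 ^ k := by positivity
    calc _ ≤ ENNReal.ofReal ((2 ^ k * ρ + ρ) ^ (-(s + α))) ^ 2 *
          (ENNReal.ofReal (4 ^ (n + 1) * (2 ^ k * ρ) ^ (2 * α)) *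
            volume (closedBall (0 : Rn n) 1)) := by
          gcongr
          exact coneWeight_cone_layer_le hE hα y (by positivity)
      _ = _ := by
          have e1 : ((2 ^ k * ρ + ρ) ^ (-(s + α))) ^ 2 * (4 ^ (n + 1) * (2 ^ k * ρ) ^ (2 * α)) =
              4 ^ (n + 1) * q k * (ρ ^ (-s)) ^ 2 := by
            rw [show (2:ℝ) ^ k * ρ + ρ = (2 ^ k + 1) * ρ by ring, hq]
            rw [Real.mul_rpow (by positivity) hρ.le, Real.mul_rpow (by positivity) hρ.le]
            have e2 : ((ρ:ℝ) ^ (-(s + α))) ^ 2 * ρ ^ (2 * α) = (ρ ^ (-s)) ^ 2 := by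
              rw [← Real.rpow_natCast, ← Real.rpow_natCast, ← Real.rpow_mul hρ.le,
                ← Real.rpow_mul hρ.le, ← Real.rpow_add hρ]
              congr 1; push_cast; ring
            have e3 : (((2:ℝ) ^ k + 1) ^ (-(s + α))) ^ 2 = (2 ^ k + 1) ^ (-(2 * s + 2 * α)) := by
              rw [← Real.rpow_natCast, ← Real.rpow_mul (by positivity)]
              congr 1; push_cast; ring
            rw [mul_pow, e3, ← e2]
            ring
          rw [← ENNReal.ofReal_pow (by positivity), ← mul_assoc,
            ← ENNReal.ofReal_mul (by positivity), e1, ← ENNReal.ofReal_pow (by positivity),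
            ENNReal.ofReal_mul (by positivity), ENNReal.ofReal_mul (by positivity)]
          ring

/-- Integration over the difference of two cones with nearby vertices. -/
theorem exists_lintegral_cone_diff_le (n : ℕ) {α : ℝ} (hα : α ∈ Ioc (0 : ℝ) 1) :
    ∃ C : ℝ≥0, ∀ (E : Set (Rn n)), IsClosed E → ∀ (w x₀ : Rn n) (D : ℝ), 0 < D →
      dist w x₀ ≤ 2 * D →
      ∫⁻ x in cone E w \ cone E x₀, ENNReal.ofReal ((infDist x E + D) ^ (-α)) ^ 2
        ∂(coneWeight E α) ≤ C := by
  -- The integrand has the scaling of the previous lemma with `s = 0`, where the sum over high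
  -- layers of a full cone would diverge. The exponent `a = 1` comes from the thinness `D / t` of
  -- the difference of the cones.
  have hsum := summable_layer (a := 1) (b := 2 * α) (by norm_num) (by linarith [hα.1])
  set q : ℤ → ℝ := fun k => ((2 : ℝ) ^ k + 1) ^ (-(1 + 2 * α)) * ((2 : ℝ) ^ k) ^ (2 * α) with hq
  have hq0 : ∀ k, 0 ≤ q k := fun k => by positivity
  have hV : volume (closedBall (0 : Rn n) 1) ≠ ∞ := measure_closedBall_lt_top.ne
  obtain ⟨C₁, hC₁⟩ := exists_volume_cone_diff_le n
  set M : ℝ≥0∞ := ENNReal.ofReal (4 ^ (n + 1)) * volume (closedBall (0 : Rn n) 1) +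
    ENNReal.ofReal 8 * C₁ with hM
  refine ⟨(8 * M * ENNReal.ofReal (∑' k, q k)).toNNReal, fun E hE w x₀ D hD hwx => ?_⟩
  have hm : Measurable fun x : Rn n => infDist x E := measurable_infDist
  have hWm : MeasurableSet (cone E w \ cone E x₀) :=
    (isOpen_cone hE w).measurableSet.diff (isOpen_cone hE x₀).measurableSet
  rw [ENNReal.coe_toNNReal (by finiteness), ENNReal.ofReal_tsum_of_nonneg hq0 hsum,
    ← ENNReal.tsum_mul_left]
  refine (setLIntegral_le_tsum_layers _ (fun x hx => infDist_pos_of_mem_cone hx.1) hD _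
    (fun k => ENNReal.ofReal ((2 ^ k * D + D) ^ (-α)) ^ 2) hWm ?_).trans ?_
  · intro k x _ h1 _
    gcongr ENNReal.ofReal ?_ ^ 2
    exact Real.rpow_le_rpow_of_nonpos (by positivity) (by linarith) (by linarith [hα.1])
  · refine ENNReal.tsum_le_tsum fun k => ?_
    have hk : (0:ℝ) < 2 ^ k := by positivity
    set t := (2:ℝ) ^ k * D with ht
    have ht0 : 0 < t := by positivity
    -- Here `r` is the proportion of the layer that is occupied: `r = 1` is used for `k < 0` and `r
    -- = 2^(-k)` for `k ≥ 0`.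
    have hq8 : ∀ r : ℝ, 0 ≤ r → r ≤ 1 → r ≤ 1 / 2 ^ k →
        ENNReal.ofReal ((t + D) ^ (-α)) ^ 2 * ENNReal.ofReal (t ^ (2 * α) * r) ≤
          8 * ENNReal.ofReal (q k) := by
      intro r hr0 hr1 hr2
      rw [← ENNReal.ofReal_pow (by positivity), ← ENNReal.ofReal_mul (by positivity),
        show (8 : ℝ≥0∞) = ENNReal.ofReal 8 by norm_num, ← ENNReal.ofReal_mul (by norm_num)]
      apply ENNReal.ofReal_le_ofReal
      have e1 : ((t + D) ^ (-α)) ^ 2 * (t ^ (2 * α) * r) =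
          (2 ^ k + 1) ^ (-(2 * α)) * ((2:ℝ) ^ k) ^ (2 * α) * r := by
        rw [ht, show (2:ℝ) ^ k * D + D = (2 ^ k + 1) * D by ring,
          Real.mul_rpow (by positivity) hD.le, Real.mul_rpow (by positivity) hD.le]
        have e2 : ((D:ℝ) ^ (-α)) ^ 2 * D ^ (2 * α) = 1 := by
          rw [← Real.rpow_natCast, ← Real.rpow_mul hD.le, ← Real.rpow_add hD]
          rw [show -α * ((2:ℕ):ℝ) + 2 * α = 0 by push_cast; ring, Real.rpow_zero]
        have e3 : (((2:ℝ) ^ k + 1) ^ (-α)) ^ 2 = (2 ^ k + 1) ^ (-(2 * α)) := by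
          rw [← Real.rpow_natCast, ← Real.rpow_mul (by positivity)]
          congr 1; push_cast; ring
        rw [mul_pow, e3]
        linear_combination ((2:ℝ) ^ k + 1) ^ (-(2 * α)) * ((2:ℝ) ^ k) ^ (2 * α) * r * e2
      rw [e1, hq]
      have e4 : ((2:ℝ) ^ k + 1) ^ (-(1 + 2 * α)) = (2 ^ k + 1)⁻¹ * (2 ^ k + 1) ^ (-(2 * α)) := by
        rw [← Real.rpow_neg_one, ← Real.rpow_add (by positivity)]
        congr 1; ring
      simp only [e4]
      have e5 : r ≤ 8 * (2 ^ k + 1)⁻¹ := by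
        rw [← div_eq_mul_inv, le_div_iff₀ (by positivity)]
        rw [le_div_iff₀ hk] at hr2
        linarith
      calc (2 ^ k + 1) ^ (-(2 * α)) * ((2:ℝ) ^ k) ^ (2 * α) * r ≤
            (2 ^ k + 1) ^ (-(2 * α)) * ((2:ℝ) ^ k) ^ (2 * α) * (8 * (2 ^ k + 1)⁻¹) := by
            gcongr
        _ = _ := by ring
    have hmeas : MeasurableSet ((cone E w \ cone E x₀) ∩
        {x | t ≤ infDist x E ∧ infDist x E < 2 * t}) := hWm.inter
          ((measurableSet_le measurable_const hm).inter (measurableSet_lt hm measurable_const))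
    rcases lt_or_ge k 0 with hk0 | hk0
    · calc _ ≤ ENNReal.ofReal ((t + D) ^ (-α)) ^ 2 * (ENNReal.ofReal (4 ^ (n + 1) * t ^ (2 * α)) *
            volume (closedBall (0 : Rn n) 1)) := by
            gcongr
            refine (measure_mono ?_).trans (coneWeight_cone_layer_le hE hα w ht0)
            exact inter_subset_inter_left _ sdiff_subset
        _ = ENNReal.ofReal ((t + D) ^ (-α)) ^ 2 * ENNReal.ofReal (t ^ (2 * α) * 1) *
            (ENNReal.ofReal (4 ^ (n + 1)) * volume (closedBall (0 : Rn n) 1)) := by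
            rw [ENNReal.ofReal_mul (by positivity), mul_one]
            ring
        _ ≤ 8 * ENNReal.ofReal (q k) * M := by
            refine mul_le_mul' (hq8 1 (by norm_num) le_rfl ?_) ?_
            · rw [le_div_iff₀ hk, one_mul]
              exact zpow_le_one_of_nonpos₀ (by norm_num) hk0.le
            · exact le_self_add
        _ = _ := by ring
    · calc _ ≤ ENNReal.ofReal ((t + D) ^ (-α)) ^ 2 * (ENNReal.ofReal (4 * t ^ (2 * α) * (t ^ n)⁻¹) *
            (C₁ * ENNReal.ofReal (2 * D / t * t ^ n))) := by
            gcongr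
            refine (coneWeight_layer_le hα ht0 hmeas fun x hx => hx.2).trans ?_
            gcongr
            refine (measure_mono ?_).trans (hC₁ E hE w x₀ (2 * D) t (by positivity) ht0 hwx)
            rintro x ⟨⟨hx1, hx2⟩, hx3⟩
            refine ⟨hx3, hx1.2, ?_⟩
            by_contra hcon
            exact hx2 ⟨hx1.1, not_le.1 hcon⟩
        _ = ENNReal.ofReal ((t + D) ^ (-α)) ^ 2 * ENNReal.ofReal (t ^ (2 * α) * (1 / 2 ^ k)) *
            (ENNReal.ofReal 8 * C₁) := by
            rw [mul_left_comm _ (C₁ : ℝ≥0∞), ← ENNReal.ofReal_mul (by positivity)]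
            have : 4 * t ^ (2 * α) * (t ^ n)⁻¹ * (2 * D / t * t ^ n) =
                8 * (t ^ (2 * α) * (1 / 2 ^ k)) := by
              have : D / t = 1 / 2 ^ k := by rw [ht]; field_simp
              rw [mul_div_assoc, this]
              field_simp
              ring
            rw [this, ENNReal.ofReal_mul (by norm_num)]
            ring
        _ ≤ 8 * ENNReal.ofReal (q k) * M := by
            refine mul_le_mul' (hq8 _ (by positivity) ?_ le_rfl) ?_
            · rw [div_le_iff₀ hk, one_mul]
              exact one_le_zpow₀ (by norm_num) hk0
            · exact le_add_self
        _ = _ := by ring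

end ConicalSquare

/-! ### The conical seminorm: Minkowski's inequality and bounds by potentials. -/

namespace ConicalSquare

variable {n : ℕ} {E : Set (Rn n)} {α : ℝ}

theorem coneNorm_eq_eLpNorm (ω : Measure (Rn n)) (u : Rn n → ℂ) (y : Rn n) :
    coneNorm ω E u y = eLpNorm u 2 (ω.restrict (cone E y)) := by
  rw [eLpNorm_eq_lintegral_rpow_enorm_toReal (by norm_num) (by norm_num), coneNorm]
  simp

theorem coneNorm_mono_measure {ω ω' : Measure (Rn n)} (h : ω' ≤ ω) (u : Rn n → ℂ) (y : Rn n) :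
    coneNorm ω' E u y ≤ coneNorm ω E u y := by
  rw [coneNorm, coneNorm]
  gcongr

theorem coneNorm_add_le (ω : Measure (Rn n)) {u v : Rn n → ℂ}
    (hu : AEStronglyMeasurable u ω) (hv : AEStronglyMeasurable v ω) (y : Rn n) :
    coneNorm ω E (fun x => u x + v x) y ≤ coneNorm ω E u y + coneNorm ω E v y := by
  simp only [coneNorm_eq_eLpNorm]
  exact eLpNorm_add_le hu.restrict hv.restrict (by norm_num)

theorem coneNorm_sum_le {ι : Type*} (ω : Measure (Rn n)) {u : ι → Rn n → ℂ} (s : Finset ι)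
    (hu : ∀ i ∈ s, AEStronglyMeasurable (u i) ω) (y : Rn n) :
    coneNorm ω E (fun x => ∑ i ∈ s, u i x) y ≤ ∑ i ∈ s, coneNorm ω E (u i) y := by
  simp only [coneNorm_eq_eLpNorm]
  have := eLpNorm_sum_le (μ := ω.restrict (cone E y)) (p := 2)
    (fun i hi => (hu i hi).restrict (s := cone E y)) (by norm_num)
  refine le_trans (le_of_eq ?_) this
  congr 1
  ext x
  simp

theorem coneNorm_const_mul (ω : Measure (Rn n)) (c : ℂ) (u : Rn n → ℂ) (y : Rn n) :
    coneNorm ω E (fun x => c * u x) y = ‖c‖ₑ * coneNorm ω E u y := by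
  simp only [coneNorm_eq_eLpNorm]
  exact eLpNorm_const_smul c u _ _

theorem coneNorm_le_of_lintegral_le (ω : Measure (Rn n)) (u : Rn n → ℂ) (y : Rn n) {M : ℝ≥0∞}
    (h : ∫⁻ x in cone E y, ‖u x‖ₑ ^ 2 ∂ω ≤ M ^ 2) : coneNorm ω E u y ≤ M := by
  rw [coneNorm]
  calc _ ≤ (M ^ 2) ^ (1 / 2 : ℝ) := by gcongr
    _ = M := by
      rw [← ENNReal.rpow_natCast, ← ENNReal.rpow_mul]; norm_num

/-- Lets a constant in a bound for the squared seminorm pass through the square root without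
introducing `√C`. -/
theorem nnreal_le_sq (C : ℝ≥0) : (C : ℝ≥0∞) ≤ ((C + 1 : ℝ≥0) : ℝ≥0∞) ^ 2 := by
  have : C ≤ (C + 1) ^ 2 := by nlinarith [C.2, sq_nonneg C]
  exact_mod_cast this

/-- A function bounded on the cone by `c (d + ρ)^{-(s + α)}`. -/
theorem exists_coneNorm_le_of_bound (n : ℕ) {α s : ℝ} (hα : α ∈ Ioc (0 : ℝ) 1) (hs : 0 < s) :
    ∃ C : ℝ≥0, ∀ (E : Set (Rn n)), IsClosed E → ∀ ω ≤ coneWeight E α,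
      ∀ (y : Rn n) (ρ : ℝ), 0 < ρ → ∀ (c : ℝ≥0∞) (u : Rn n → ℂ),
      (∀ x ∈ cone E y, ‖u x‖ₑ ≤ c * ENNReal.ofReal ((infDist x E + ρ) ^ (-(s + α)))) →
      coneNorm ω E u y ≤ C * c * ENNReal.ofReal (ρ ^ (-s)) := by
  obtain ⟨C, hC⟩ := exists_lintegral_cone_le n hα hs
  refine ⟨C + 1, fun E hE ω hω y ρ hρ c u hu => coneNorm_le_of_lintegral_le _ _ _ ?_⟩
  have hm : Measurable fun x : Rn n => infDist x E := measurable_infDist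
  calc ∫⁻ x in cone E y, ‖u x‖ₑ ^ 2 ∂ω ≤ ∫⁻ x in cone E y, ‖u x‖ₑ ^ 2 ∂(coneWeight E α) := by
        gcongr
    _ ≤ ∫⁻ x in cone E y, c ^ 2 * ENNReal.ofReal ((infDist x E + ρ) ^ (-(s + α))) ^ 2
          ∂(coneWeight E α) := by
        refine setLIntegral_mono' (isOpen_cone hE y).measurableSet fun x hx => ?_
        rw [← mul_pow]
        gcongr
        exact hu x hx
    _ = c ^ 2 * ∫⁻ x in cone E y, ENNReal.ofReal ((infDist x E + ρ) ^ (-(s + α))) ^ 2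
          ∂(coneWeight E α) := lintegral_const_mul _ (by fun_prop)
    _ ≤ c ^ 2 * (C * ENNReal.ofReal (ρ ^ (-s)) ^ 2) := by
        gcongr
        exact hC E hE y ρ hρ
    _ ≤ c ^ 2 * (((C + 1 : ℝ≥0) : ℝ≥0∞) ^ 2 * ENNReal.ofReal (ρ ^ (-s)) ^ 2) := by
        gcongr
        exact nnreal_le_sq C
    _ = _ := by ring

/-- A function dominated on the cone with vertex `w` by a potential of `η`. -/
theorem exists_coneNorm_le_potential (n : ℕ) {α m : ℝ} (hα : α ∈ Ioc (0 : ℝ) 1) (hm : 0 < m) :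
    ∃ C : ℝ≥0, ∀ (E : Set (Rn n)), IsClosed E → ∀ ω ≤ coneWeight E α, SFinite ω →
      ∀ (w : Rn n) (η : Measure (Rn n)), SFinite η → (∀ᵐ z ∂η, 0 < dist z w) → ∀ u : Rn n → ℂ,
      (∀ x ∈ cone E w, ‖u x‖ₑ ≤
        ∫⁻ z, ENNReal.ofReal ((infDist x E + dist z w) ^ (-(m + α))) ∂η) →
      coneNorm ω E u w ≤ C * ∫⁻ z, ENNReal.ofReal (dist z w ^ (-m)) ∂η := by
  obtain ⟨C, hC⟩ := exists_lintegral_cone_le n hα hm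
  refine ⟨C + 1, fun E hE ω hω _ w η _ hη u hu => coneNorm_le_of_lintegral_le _ _ _ ?_⟩
  have hmi : Measurable fun x : Rn n => infDist x E := measurable_infDist
  set P := ∫⁻ z, ENNReal.ofReal (dist z w ^ (-m)) ∂η with hP
  let k : Rn n → Rn n → ℝ≥0∞ := fun x z =>
    ENNReal.ofReal ((infDist x E + dist z w) ^ (-(m + α)))
  have hk : Measurable (Function.uncurry k) := by
    have : Measurable fun p : Rn n × Rn n => infDist p.1 E := hmi.comp measurable_fst
    simp only [k, Function.uncurry_def]
    fun_prop
  have hkx : ∀ x, Measurable (k x) := fun x => by fun_prop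
  -- Cauchy–Schwarz with the weights `|z - w|^(-m/2)` and `|z - w|^(m/2)`. After Fubini the cone
  -- integral of `k²` gives `|z - w|^(-2m)`, and the remaining weight restores the potential `P`; in
  -- effect this is Minkowski's integral inequality.
  have cs : ∀ x ∈ cone E w, ‖u x‖ₑ ^ 2 ≤
      P * ∫⁻ z, ENNReal.ofReal (dist z w ^ m) * k x z ^ 2 ∂η := by
    intro x hx
    have h1 : ∫⁻ z, k x z ∂η ≤ P ^ (1 / 2 : ℝ) *
        (∫⁻ z, ENNReal.ofReal (dist z w ^ m) * k x z ^ 2 ∂η) ^ (1 / 2 : ℝ) := by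
      calc ∫⁻ z, k x z ∂η = ∫⁻ z, ((fun z => ENNReal.ofReal (dist z w ^ (-m / 2))) *
            fun z => ENNReal.ofReal (dist z w ^ (m / 2)) * k x z) z ∂η := by
            refine lintegral_congr_ae ?_
            filter_upwards [hη] with z hz
            simp only [Pi.mul_apply]
            rw [← mul_assoc, ← ENNReal.ofReal_mul (by positivity), ← Real.rpow_add hz]
            rw [show -m / 2 + m / 2 = 0 by ring, Real.rpow_zero, ENNReal.ofReal_one, one_mul]
        _ ≤ _ := by
            refine (ENNReal.lintegral_mul_le_Lp_mul_Lq η Real.HolderConjugate.two_two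
              (by fun_prop) ?_).trans (le_of_eq ?_)
            · exact ((by fun_prop : Measurable fun z => ENNReal.ofReal (dist z w ^ (m / 2))).mul
                (hkx x)).aemeasurable
            · congr 2
              · refine lintegral_congr_ae ?_
                filter_upwards [hη] with z hz
                rw [ENNReal.ofReal_rpow_of_nonneg (by positivity) (by norm_num),
                  ← Real.rpow_mul dist_nonneg]
                congr 2; ring
              · refine lintegral_congr_ae ?_
                filter_upwards [hη] with z hz
                rw [ENNReal.mul_rpow_of_nonneg _ _ (by norm_num),
                  ENNReal.ofReal_rpow_of_nonneg (by positivity) (by norm_num),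
                  ← Real.rpow_mul dist_nonneg]
                rw [show m / 2 * 2 = m by ring, ENNReal.rpow_ofNat]
    calc ‖u x‖ₑ ^ 2 ≤ (∫⁻ z, k x z ∂η) ^ 2 := by gcongr; exact hu x hx
      _ ≤ (P ^ (1 / 2 : ℝ) *
        (∫⁻ z, ENNReal.ofReal (dist z w ^ m) * k x z ^ 2 ∂η) ^ (1 / 2 : ℝ)) ^ 2 := by gcongr
      _ = _ := by
        rw [mul_pow, ← ENNReal.rpow_natCast, ← ENNReal.rpow_mul, ← ENNReal.rpow_natCast,
          ← ENNReal.rpow_mul]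
        norm_num
  have hk2 : Measurable (Function.uncurry fun x z =>
      ENNReal.ofReal (dist z w ^ m) * k x z ^ 2) := by
    have h1 : Measurable fun p : Rn n × Rn n => k p.1 p.2 := hk
    simp only [Function.uncurry_def]
    fun_prop
  calc ∫⁻ x in cone E w, ‖u x‖ₑ ^ 2 ∂ω
      ≤ ∫⁻ x in cone E w, P * ∫⁻ z, ENNReal.ofReal (dist z w ^ m) * k x z ^ 2 ∂η ∂ω :=
        setLIntegral_mono' (isOpen_cone hE w).measurableSet cs
    _ = P * ∫⁻ x in cone E w, ∫⁻ z, ENNReal.ofReal (dist z w ^ m) * k x z ^ 2 ∂η ∂ω :=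
        lintegral_const_mul _ hk2.lintegral_prod_right
    _ = P * ∫⁻ z, ∫⁻ x in cone E w, ENNReal.ofReal (dist z w ^ m) * k x z ^ 2 ∂ω ∂η := by
        rw [lintegral_lintegral_swap hk2.aemeasurable]
    _ ≤ P * ∫⁻ z, C * ENNReal.ofReal (dist z w ^ (-m)) ∂η := by
        gcongr 1
        refine lintegral_mono_ae ?_
        filter_upwards [hη] with z hz
        have hkz : Measurable fun x => k x z := by fun_prop
        rw [lintegral_const_mul _ (by fun_prop)]
        calc _ ≤ ENNReal.ofReal (dist z w ^ m) * (C * ENNReal.ofReal (dist z w ^ (-m)) ^ 2) := by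
              gcongr
              exact (lintegral_mono' (Measure.restrict_mono le_rfl hω) le_rfl).trans
                (hC E hE w _ hz)
          _ = C * (ENNReal.ofReal (dist z w ^ m) * ENNReal.ofReal (dist z w ^ (-m))) *
                ENNReal.ofReal (dist z w ^ (-m)) := by ring
          _ = _ := by
              rw [← ENNReal.ofReal_mul (by positivity), ← Real.rpow_add hz, add_neg_cancel,
                Real.rpow_zero, ENNReal.ofReal_one, mul_one]
    _ = C * P ^ 2 := by
        rw [lintegral_const_mul _ (by fun_prop)]
        ring
    _ ≤ _ := by
        rw [mul_pow]
        gcongr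
        exact nnreal_le_sq C

/-- Integration of `(R + |z - w|)^{-(m + a)}` against a measure of growth `m`. -/
theorem exists_lintegral_growth_le {m a : ℝ} (hm : 0 < m) (ha : 0 < a) :
    ∃ C : ℝ≥0, ∀ (n : ℕ) (η : Measure (Rn n)) (w : Rn n) (R : ℝ) (H : ℝ≥0∞), 0 < R →
      (∀ r, R ≤ r → η (closedBall w r) ≤ H * ENNReal.ofReal (r ^ m)) →
      ∫⁻ z, ENNReal.ofReal ((R + dist z w) ^ (-(m + a))) ∂η ≤ C * H * ENNReal.ofReal (R ^ (-a)) := by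
  have hq0 : (0:ℝ) < 2 ^ (-a) := by positivity
  have hsum : Summable fun k : ℕ => ((2 : ℝ) ^ (-a)) ^ k :=
    summable_geometric_of_lt_one hq0.le
      (Real.rpow_lt_one_of_one_lt_of_neg (by norm_num) (by linarith))
  refine ⟨(ENNReal.ofReal (2 ^ m) * ENNReal.ofReal (∑' k : ℕ, ((2 : ℝ) ^ (-a)) ^ k)).toNNReal,
    fun n η w R H hR hη => ?_⟩
  rw [ENNReal.coe_toNNReal (by finiteness), ENNReal.ofReal_tsum_of_nonneg (fun k => by positivity)
    hsum, mul_assoc, mul_assoc, ← ENNReal.tsum_mul_right, ← ENNReal.tsum_mul_left]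
  set U : ℕ → Set (Rn n) := fun k => {z | 2 ^ k * R ≤ R + dist z w ∧
    R + dist z w < 2 ^ (k + 1) * R} with hU
  have hUm : ∀ k, MeasurableSet (U k) := fun k =>
    (measurableSet_le (g := fun z => R + dist z w) measurable_const (by fun_prop)).inter
      (measurableSet_lt (f := fun z => R + dist z w) (by fun_prop) measurable_const)
  have hcov : univ ⊆ ⋃ k, U k := by
    intro z _
    obtain ⟨k, hk1, hk2⟩ := exists_nat_pow_near (x := (R + dist z w) / R) (y := (2:ℝ))
      (by rw [le_div_iff₀ hR]; linarith [dist_nonneg (x := z) (y := w)]) (by norm_num)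
    rw [le_div_iff₀ hR] at hk1
    rw [div_lt_iff₀ hR] at hk2
    exact mem_iUnion.2 ⟨k, hk1, hk2⟩
  calc _ = ∫⁻ z in univ, ENNReal.ofReal ((R + dist z w) ^ (-(m + a))) ∂η := by
        rw [Measure.restrict_univ]
    _ ≤ ∫⁻ z in ⋃ k, U k, ENNReal.ofReal ((R + dist z w) ^ (-(m + a))) ∂η :=
        lintegral_mono_set hcov
    _ ≤ ∑' k, ∫⁻ z in U k, ENNReal.ofReal ((R + dist z w) ^ (-(m + a))) ∂η :=
        lintegral_iUnion_le _ _
    _ ≤ _ := by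
        refine ENNReal.tsum_le_tsum fun k => ?_
        have h2k : (1:ℝ) ≤ 2 ^ (k + 1) := one_le_pow₀ (by norm_num)
        calc _ ≤ ∫⁻ z in U k, ENNReal.ofReal ((2 ^ k * R) ^ (-(m + a))) ∂η := by
              refine setLIntegral_mono' (hUm k) fun z hz => ENNReal.ofReal_le_ofReal ?_
              exact Real.rpow_le_rpow_of_nonpos (by positivity) hz.1 (by linarith)
          _ = ENNReal.ofReal ((2 ^ k * R) ^ (-(m + a))) * η (U k) := by simp
          _ ≤ ENNReal.ofReal ((2 ^ k * R) ^ (-(m + a))) *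
                (H * ENNReal.ofReal ((2 ^ (k + 1) * R) ^ m)) := by
              gcongr
              refine (measure_mono fun z hz => ?_).trans (hη _ ?_)
              · rw [mem_closedBall]; linarith [hz.2]
              · nlinarith
          _ = _ := by
              rw [mul_left_comm, ← ENNReal.ofReal_mul (by positivity), mul_left_comm _ H,
                mul_left_comm _ H, ← ENNReal.ofReal_mul (by positivity),
                ← ENNReal.ofReal_mul (by positivity)]
              congr 2
              have e1 : ((2:ℝ) ^ (k + 1) * R) ^ m = 2 ^ m * (2 ^ k * R) ^ m := by
                rw [← Real.mul_rpow (by norm_num) (by positivity)]; congr 1; ring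
              have e2 : ((2:ℝ) ^ (-a)) ^ k = ((2:ℝ) ^ k) ^ (-a) := by
                rw [← Real.rpow_natCast, ← Real.rpow_natCast, ← Real.rpow_mul (by norm_num),
                  ← Real.rpow_mul (by norm_num), mul_comm]
              rw [e1, e2, ← Real.mul_rpow (by positivity) hR.le, mul_left_comm,
                ← Real.rpow_add (by positivity)]
              congr 2; ring

theorem lintegral_biUnion_finset_le {X ι : Type*} [MeasurableSpace X] (η : Measure X)
    (s : Finset ι) (U : ι → Set X) (f : X → ℝ≥0∞) :
    ∫⁻ z in ⋃ i ∈ s, U i, f z ∂η ≤ ∑ i ∈ s, ∫⁻ z in U i, f z ∂η := by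
  classical
  induction s using Finset.induction_on with
  | empty => simp
  | insert i s hi ih =>
    rw [Finset.set_biUnion_insert, Finset.sum_insert hi]
    exact (lintegral_union_le _ _ _).trans (by gcongr)

/-- The potential of `η` on an annulus whose inner concentric balls, of radii `L / 100 ^ i`, have
rapidly decreasing measures. -/
theorem lintegral_annuli_le {m q : ℝ} (hm : 0 < m) (hq : 0 < q) (hmq : 100 ^ m * q ≤ 1 / 2)
    (η : Measure (Rn n)) (y : Rn n) {L : ℝ} (hL : 0 < L) (k : ℕ) (H : ℝ≥0∞)
    (hη : ∀ i < k, η (closedBall y (L / 100 ^ i)) ≤ H * ENNReal.ofReal (L ^ m * q ^ i)) :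
    ∫⁻ z in {z | L / 100 ^ k < dist z y ∧ dist z y ≤ L}, ENNReal.ofReal (dist z y ^ (-m)) ∂η ≤
      ENNReal.ofReal (2 * 100 ^ m) * H := by
  set U : ℕ → Set (Rn n) := fun i => {z | L / 100 ^ (i + 1) < dist z y ∧ dist z y ≤ L / 100 ^ i}
    with hU
  have hUm : ∀ k, MeasurableSet (U k) := fun k =>
    (measurableSet_lt (g := fun z => dist z y) measurable_const (by fun_prop)).inter
      (measurableSet_le (f := fun z => dist z y) (by fun_prop) measurable_const)
  have hcov : {z : Rn n | L / 100 ^ k < dist z y ∧ dist z y ≤ L} ⊆ ⋃ i ∈ Finset.range k, U i := by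
    clear hη
    induction k with
    | zero => intro z hz; simp at hz; linarith [hz.1, hz.2]
    | succ k ih =>
      intro z hz
      rcases lt_or_ge (L / 100 ^ k) (dist z y) with h | h
      · have := ih ⟨h, hz.2⟩
        simp only [mem_iUnion, Finset.mem_range, exists_prop] at this ⊢
        obtain ⟨i, hi, hzi⟩ := this
        exact ⟨i, by omega, hzi⟩
      · simp only [mem_iUnion, Finset.mem_range, exists_prop]
        exact ⟨k, by omega, hz.1, h⟩
  -- Passing from one radius to the next costs `100^m` in the integrand and gains `q` in the
  -- measure; the product is at most `1/2`.
  have hterm : ∀ i ∈ Finset.range k, ∫⁻ z in U i, ENNReal.ofReal (dist z y ^ (-m)) ∂η ≤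
      ENNReal.ofReal (100 ^ m) * H * ENNReal.ofReal ((1 / 2) ^ i) := by
    intro i hi
    calc _ ≤ ∫⁻ z in U i, ENNReal.ofReal ((L / 100 ^ (i + 1)) ^ (-m)) ∂η := by
          refine setLIntegral_mono' (hUm i) fun z hz => ENNReal.ofReal_le_ofReal ?_
          exact Real.rpow_le_rpow_of_nonpos (by positivity) hz.1.le (by linarith)
      _ = ENNReal.ofReal ((L / 100 ^ (i + 1)) ^ (-m)) * η (U i) := by simp
      _ ≤ ENNReal.ofReal ((L / 100 ^ (i + 1)) ^ (-m)) * (H * ENNReal.ofReal (L ^ m * q ^ i)) := by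
          gcongr
          exact (measure_mono fun z hz => hz.2).trans (hη i (Finset.mem_range.1 hi))
      _ = H * ENNReal.ofReal (100 ^ m * (100 ^ m * q) ^ i) := by
          rw [mul_left_comm, ← ENNReal.ofReal_mul (by positivity)]
          congr 2
          rw [Real.div_rpow hL.le (by positivity), Real.rpow_neg (by positivity),
            Real.rpow_neg (by positivity), ← Real.rpow_natCast 100 (i + 1),
            ← Real.rpow_mul (by norm_num), mul_pow, ← Real.rpow_natCast (100 ^ m) i,
            ← Real.rpow_mul (by norm_num)]
          have : (100:ℝ) ^ (((i + 1 : ℕ) : ℝ) * m) = 100 ^ m * 100 ^ (m * (i:ℝ)) := by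
            rw [← Real.rpow_add (by norm_num)]; congr 1; push_cast; ring
          rw [this]
          field_simp
      _ ≤ H * ENNReal.ofReal (100 ^ m * (1 / 2) ^ i) := by
          gcongr
      _ = _ := by rw [ENNReal.ofReal_mul (by positivity)]; ring
  calc _ ≤ ∫⁻ z in ⋃ i ∈ Finset.range k, U i, ENNReal.ofReal (dist z y ^ (-m)) ∂η :=
        lintegral_mono_set hcov
    _ ≤ ∑ i ∈ Finset.range k, ∫⁻ z in U i, ENNReal.ofReal (dist z y ^ (-m)) ∂η :=
        lintegral_biUnion_finset_le _ _ _ _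
    _ ≤ ∑ i ∈ Finset.range k, ENNReal.ofReal (100 ^ m) * H * ENNReal.ofReal ((1 / 2) ^ i) :=
        Finset.sum_le_sum hterm
    _ = ENNReal.ofReal (100 ^ m) * H * ENNReal.ofReal (∑ i ∈ Finset.range k, (1 / 2) ^ i) := by
        rw [← Finset.mul_sum, ENNReal.ofReal_sum_of_nonneg fun _ _ => by positivity]
    _ ≤ ENNReal.ofReal (100 ^ m) * H * ENNReal.ofReal 2 := by
        gcongr
        exact sum_geometric_two_le k
    _ = _ := by rw [mul_comm 2, ENNReal.ofReal_mul (by positivity)]; ring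

end ConicalSquare

/-! ### The kernel operator: discretisation, measurability and weak type bounds. -/

namespace ConicalSquare

open Filter Topology

variable {n : ℕ} {E : Set (Rn n)} {m α β K₁ K₂ : ℝ} {S : Rn n → Rn n → ℂ} {μ : Measure (Rn n)}

/-- In the cone `|z - w| ≤ |x - z| + 2d(x)`, and `d(x) ≤ |x - z|`. This converts the size condition
into a bound in terms of the height `d(x)` and the distance of `z` from the vertex. -/
theorem infDist_add_dist_le {x w z : Rn n} (hx : x ∈ cone E w) (hz : z ∈ E) :
    infDist x E + dist z w ≤ 4 * dist x z := by
  have h1 := infDist_le_dist_of_mem (x := x) hz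
  have h2 := hx.2
  have h3 := dist_triangle z x w
  rw [dist_comm z x] at h3
  linarith

theorem infDist_pos_of_notMem (hE : IsClosed E) (hne : E.Nonempty) {x : Rn n} (hx : x ∉ E) :
    0 < infDist x E :=
  (hE.notMem_iff_infDist_pos hne).1 hx

theorem IsKernel.norm_le (hS : IsKernel E m α β K₁ K₂ S) (hE : IsClosed E) (hmα : 0 < m + α)
    (hK : 0 < K₁) {x z : Rn n} (hx : x ∉ E) (hz : z ∈ E) :
    ‖S x z‖ ≤ K₁ * infDist x E ^ (-(m + α)) := by
  have hd := infDist_pos_of_notMem hE ⟨z, hz⟩ hx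
  refine (hS.size x hx z hz).trans ?_
  rw [one_div, ← Real.rpow_neg dist_nonneg]
  gcongr 1
  exact Real.rpow_le_rpow_of_nonpos hd (infDist_le_dist_of_mem hz) (by linarith)

theorem IsKernel.enorm_le (hS : IsKernel E m α β K₁ K₂ S) (hmα : 0 < m + α) (hK : 0 < K₁)
    {x w z : Rn n} (hx : x ∈ cone E w) (hz : z ∈ E) :
    ‖S x z‖ₑ ≤ ENNReal.ofReal (K₁ * 4 ^ (m + α)) *
      ENNReal.ofReal ((infDist x E + dist z w) ^ (-(m + α))) := by
  have hd := infDist_pos_of_mem_cone hx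
  have h4 := infDist_add_dist_le hx hz
  have hp : 0 < infDist x E + dist z w := by
    have := dist_nonneg (x := z) (y := w)
    linarith
  rw [← ofReal_norm, ← ENNReal.ofReal_mul (by positivity)]
  apply ENNReal.ofReal_le_ofReal
  refine (hS.size x hx.1 z hz).trans ?_
  rw [one_div, ← Real.rpow_neg dist_nonneg, mul_assoc]
  gcongr 1
  calc dist x z ^ (-(m + α)) ≤ ((infDist x E + dist z w) / 4) ^ (-(m + α)) :=
        Real.rpow_le_rpow_of_nonpos (by positivity) (by linarith) (by linarith)
    _ = _ := by
        rw [Real.div_rpow hp.le (by norm_num), Real.rpow_neg (x := 4) (by norm_num), div_inv_eq_mul,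
          mul_comm]

theorem IsKernel.continuousOn (hS : IsKernel E m α β K₁ K₂ S) (hβ : 0 < β) {x : Rn n}
    (hx : x ∉ E) : ContinuousOn (S x) E := by
  intro y hy
  have hxy : 0 < dist x y := dist_pos.2 fun h => hx (h ▸ hy)
  rw [ContinuousWithinAt, tendsto_iff_norm_sub_tendsto_zero]
  have hlim : Tendsto (fun y' => K₂ * (dist y y' ^ β / dist x y ^ (m + α + β))) (𝓝[E] y) (𝓝 0) := by
    have h1 : Continuous fun y' : Rn n => K₂ * (dist y y' ^ β / dist x y ^ (m + α + β)) :=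
      continuous_const.mul (((continuous_const.dist continuous_id).rpow_const
        fun _ => Or.inr hβ.le).div_const _)
    have h2 := (h1.tendsto y).mono_left (nhdsWithin_le_nhds (s := E))
    simpa [Real.zero_rpow hβ.ne'] using h2
  refine squeeze_zero' (Eventually.of_forall fun _ => norm_nonneg _) ?_ hlim
  have h3 : ∀ᶠ y' in 𝓝[E] y, dist y y' ≤ dist x y / 2 := by
    have : closedBall y (dist x y / 2) ∈ 𝓝 y := closedBall_mem_nhds _ (by positivity)
    filter_upwards [nhdsWithin_le_nhds this] with y' hy'
    rw [dist_comm]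
    exact hy'
  filter_upwards [h3, self_mem_nhdsWithin] with y' h4 h5
  rw [norm_sub_rev]
  exact hS.holder x hx y hy y' h5 h4

/-- `T_μ f` is a limit of finite combinations of the functions `S(·, z)`, `z ∈ E`. -/
theorem exists_discrete_approx (hE : IsClosed E) (hS : IsKernel E m α β K₁ K₂ S)
    (hmα : 0 < m + α) (hβ : 0 < β) (hK : 0 < K₁) {f : Rn n → ℂ} (hf : Integrable f μ) :
    ∃ (s : ℕ → Finset (Rn n)) (a : ℕ → Rn n → ℂ), (∀ k, ↑(s k) ⊆ E) ∧
      (∀ k, ∑ z ∈ s k, ‖a k z‖ₑ ≤ ∫⁻ z, ‖f z‖ₑ ∂μ) ∧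
      ∀ x ∉ E, Tendsto (fun k => ∑ z ∈ s k, a k z * S x z) atTop (𝓝 (integralOp E S μ f x)) := by
  classical
  rcases E.eq_empty_or_nonempty with rfl | ⟨y₀, hy₀⟩
  · exact ⟨fun _ => ∅, fun _ _ => 0, by simp, by simp, by simp [integralOp]⟩
  -- Simple maps with values in `E` that converge to the identity on `E`: the mass `f μ` of each
  -- fibre is moved to the value of the map, and continuity of `S x` on `E` gives the limit.
  let π : ℕ → SimpleFunc (Rn n) (Rn n) := SimpleFunc.approxOn id measurable_id E y₀ hy₀
  have hπE : ∀ k x, π k x ∈ E := fun k x => SimpleFunc.approxOn_mem measurable_id hy₀ k x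
  have hπlim : ∀ x ∈ E, Tendsto (fun k => π k x) atTop (𝓝 x) := fun x hx =>
    SimpleFunc.tendsto_approxOn measurable_id hy₀ (subset_closure hx)
  refine ⟨fun k => (π k).range, fun k c => ∫ z in E ∩ π k ⁻¹' {c}, f z ∂μ, ?_, ?_, ?_⟩
  · intro k c hc
    obtain ⟨x, rfl⟩ := SimpleFunc.mem_range.1 (Finset.mem_coe.1 hc)
    exact hπE k x
  · intro k
    calc ∑ c ∈ (π k).range, ‖∫ z in E ∩ π k ⁻¹' {c}, f z ∂μ‖ₑ
        ≤ ∑ c ∈ (π k).range, ∫⁻ z in π k ⁻¹' {c}, ‖f z‖ₑ ∂μ := by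
          refine Finset.sum_le_sum fun c _ => (enorm_integral_le_lintegral_enorm _).trans ?_
          exact lintegral_mono_set inter_subset_right
      _ = ∫⁻ z in ⋃ c ∈ (π k).range, π k ⁻¹' {c}, ‖f z‖ₑ ∂μ := by
          rw [lintegral_biUnion_finset]
          · intro c _ c' _ hcc
            exact Disjoint.preimage _ (by simpa using hcc)
          · exact fun c _ => (π k).measurableSet_preimage _
      _ ≤ _ := setLIntegral_le_lintegral _ _
  · intro x hx
    have hkey : ∀ k, ∑ c ∈ (π k).range, (∫ z in E ∩ π k ⁻¹' {c}, f z ∂μ) * S x c =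
        ∫ z in E, S x (π k z) * f z ∂μ := by
      intro k
      have h1 : ∀ z, S x (π k z) * f z =
          ∑ c ∈ (π k).range, (π k ⁻¹' {c}).indicator (fun z => f z * S x c) z := by
        intro z
        rw [Finset.sum_eq_single (π k z)]
        · simp [mul_comm]
        · intro c _ hc
          rw [indicator_of_notMem]
          simpa using hc.symm
        · intro h
          exact absurd (SimpleFunc.mem_range_self (π k) z) h
      simp_rw [h1]
      rw [integral_finsetSum]
      · refine Finset.sum_congr rfl fun c _ => ?_
        rw [integral_indicator ((π k).measurableSet_preimage _),
          Measure.restrict_restrict ((π k).measurableSet_preimage _), integral_mul_const,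
          inter_comm]
      · intro c _
        exact ((hf.restrict (s := E)).mul_const _).indicator ((π k).measurableSet_preimage _)
    simp_rw [hkey]
    have hb : ∀ z ∈ E, ‖S x z‖ ≤ K₁ * infDist x E ^ (-(m + α)) := fun z hz =>
      hS.norm_le hE hmα hK hx hz
    refine tendsto_integral_of_dominated_convergence
      (fun z => K₁ * infDist x E ^ (-(m + α)) * ‖f z‖) (fun k => ?_) ?_ (fun k => ?_) ?_
    · have : AEStronglyMeasurable (fun z => S x (π k z)) (μ.restrict E) :=
        (((π k).map (S x)).stronglyMeasurable).aestronglyMeasurable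
      exact this.mul hf.1.restrict
    · exact (hf.restrict.norm).const_mul _
    · filter_upwards with z
      rw [norm_mul]
      gcongr
      exact hb _ (hπE k z)
    · filter_upwards [ae_restrict_mem hE.measurableSet] with z hz
      refine Tendsto.mul_const _ ?_
      refine ((hS.continuousOn hβ hx) z hz).tendsto.comp ?_
      exact tendsto_nhdsWithin_iff.2 ⟨hπlim z hz, Eventually.of_forall fun k => hπE k z⟩

theorem IsKernel.aestronglyMeasurable_sum (hS : IsKernel E m α β K₁ K₂ S) (s : Finset (Rn n))
    (hs : ↑s ⊆ E) (a : Rn n → ℂ) {ω : Measure (Rn n)} (hω : ω ≪ volume.restrict Eᶜ) :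
    AEStronglyMeasurable (fun x => ∑ z ∈ s, a z * S x z) ω := by
  have : AEMeasurable (fun x => ∑ z ∈ s, a z * S x z) ω :=
    Finset.aemeasurable_fun_sum s fun z hz => ((hS.aemeasurable z (hs hz)).mono_ac hω).const_mul _
  exact this.aestronglyMeasurable

theorem ae_notMem_of_ac (hE : IsClosed E) {ω : Measure (Rn n)} (hω : ω ≪ volume.restrict Eᶜ) :
    ∀ᵐ x ∂ω, x ∉ E :=
  hω.ae_le (ae_restrict_mem hE.isOpen_compl.measurableSet)

/-- The kernel is measurable in `x` for each fixed `y` only. Measurability of `T_μ f` therefore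
comes from its discrete approximations rather than from joint measurability. -/
theorem aestronglyMeasurable_integralOp (hE : IsClosed E) (hS : IsKernel E m α β K₁ K₂ S)
    (hmα : 0 < m + α) (hβ : 0 < β) (hK : 0 < K₁) {f : Rn n → ℂ} (hf : Integrable f μ)
    {ω : Measure (Rn n)} (hω : ω ≪ volume.restrict Eᶜ) :
    AEStronglyMeasurable (integralOp E S μ f) ω := by
  obtain ⟨s, a, hs, -, hlim⟩ := exists_discrete_approx hE hS hmα hβ hK hf
  refine aestronglyMeasurable_of_tendsto_ae atTop
    (fun k => hS.aestronglyMeasurable_sum (s k) (hs k) (a k) hω) ?_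
  filter_upwards [ae_notMem_of_ac hE hω] with x hx
  exact hlim x hx

theorem integralOp_add (hE : IsClosed E) (hS : IsKernel E m α β K₁ K₂ S)
    (hmα : 0 < m + α) (hβ : 0 < β) (hK : 0 < K₁) {f g : Rn n → ℂ} (hf : Integrable f μ)
    (hg : Integrable g μ) {x : Rn n} (hx : x ∉ E) :
    integralOp E S μ (fun z => f z + g z) x = integralOp E S μ f x + integralOp E S μ g x := by
  have hb : ∀ {f : Rn n → ℂ}, Integrable f μ → Integrable (fun z => S x z * f z) (μ.restrict E) := by
    intro f hf
    refine (hf.restrict).bdd_mul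
      ((hS.continuousOn hβ hx).aestronglyMeasurable hE.measurableSet)
      (c := K₁ * infDist x E ^ (-(m + α))) ?_
    filter_upwards [ae_restrict_mem hE.measurableSet] with z hz
    exact hS.norm_le hE hmα hK hx hz
  simp only [integralOp, mul_add]
  exact integral_add (hb hf) (hb hg)

/-- The measure `|f| μ`. -/
noncomputable def absMeasure (μ : Measure (Rn n)) (f : Rn n → ℂ) : Measure (Rn n) :=
  μ.withDensity fun z => ‖f z‖ₑ

theorem enorm_integralOp_le (hE : IsClosed E) (hS : IsKernel E m α β K₁ K₂ S)
    (hmα : 0 < m + α) (hK : 0 < K₁) {f : Rn n → ℂ} (hf : AEStronglyMeasurable f μ)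
    {x w : Rn n} (hx : x ∈ cone E w) :
    ‖integralOp E S μ f x‖ₑ ≤ ENNReal.ofReal (K₁ * 4 ^ (m + α)) *
      ∫⁻ z, ENNReal.ofReal ((infDist x E + dist z w) ^ (-(m + α))) ∂(absMeasure μ f) := by
  rw [absMeasure, lintegral_withDensity_eq_lintegral_mul₀ hf.enorm (by fun_prop),
    ← lintegral_const_mul' _ _ (by finiteness)]
  refine (enorm_integral_le_lintegral_enorm _).trans ?_
  refine le_trans ?_ (setLIntegral_le_lintegral E _)
  refine setLIntegral_mono' hE.measurableSet fun z hz => ?_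
  rw [enorm_mul, Pi.mul_apply, mul_left_comm, mul_comm]
  gcongr
  exact hS.enorm_le hmα hK hx hz

/-- The cone at `y` is exhausted by sets `W N` that remain inside the cone at every `y'` with `|y -
y'| < 1 / (N + 1)`. This makes the level sets `{u > t}` open, whatever the function inside the cone
integral. -/
theorem lowerSemicontinuous_coneNorm (ω : Measure (Rn n)) (u : Rn n → ℂ) :
    LowerSemicontinuous (coneNorm ω E u) := by
  have key : LowerSemicontinuous fun y => ∫⁻ x in cone E y, ‖u x‖ₑ ^ 2 ∂ω := by
    intro y t ht
    let W : ℕ → Set (Rn n) := fun N => {x | x ∉ E ∧ dist x y + 1 / ((N : ℝ) + 1) < 2 * infDist x E}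
    have hWmono : Monotone W := by
      intro N N' h x hx
      refine ⟨hx.1, lt_of_le_of_lt ?_ hx.2⟩
      gcongr
    have hcov : cone E y = ⋃ N, W N := by
      ext x
      simp only [mem_iUnion]
      constructor
      · rintro ⟨h1, h2⟩
        obtain ⟨N, hN⟩ := exists_nat_one_div_lt (sub_pos.2 h2)
        exact ⟨N, h1, by linarith⟩
      · rintro ⟨N, h1, h2⟩
        have : 0 < 1 / ((N : ℝ) + 1) := by positivity
        exact ⟨h1, by linarith⟩
    beta_reduce at ht
    rw [hcov, gt_iff_lt, setLIntegral_iUnion_of_directed _ hWmono.directed_le] at ht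
    obtain ⟨N, hN⟩ := lt_iSup_iff.1 ht
    filter_upwards [ball_mem_nhds y (show 0 < 1 / ((N : ℝ) + 1) by positivity)] with y' hy'
    refine hN.trans_le (lintegral_mono_set fun x hx => ⟨hx.1, ?_⟩)
    have h1 := dist_triangle x y y'
    have h2 := hx.2
    rw [mem_ball, dist_comm] at hy'
    linarith
  exact (ENNReal.continuous_rpow_const).comp_lowerSemicontinuous key
    (ENNReal.monotone_rpow_of_nonneg (by norm_num))

theorem measurable_coneNorm (ω : Measure (Rn n)) (u : Rn n → ℂ) :
    Measurable (coneNorm ω E u) :=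
  (lowerSemicontinuous_coneNorm ω u).measurable

theorem coneNorm_le_liminf {ω : Measure (Rn n)} {u : ℕ → Rn n → ℂ}
    (hu : ∀ k, AEStronglyMeasurable (u k) ω) {v : Rn n → ℂ}
    (hlim : ∀ᵐ x ∂ω, Tendsto (fun k => u k x) atTop (𝓝 (v x))) (y : Rn n) :
    coneNorm ω E v y ≤ liminf (fun k => coneNorm ω E (u k) y) atTop := by
  simp only [coneNorm_eq_eLpNorm]
  exact Lp.eLpNorm_lim_le_liminf_eLpNorm (fun k => (hu k).restrict) v (ae_restrict_of_ae hlim)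

/-- Fatou's lemma for distribution functions; it carries weak type bounds from discrete measures to
their limits. -/
theorem measure_lt_liminf_le {G : Set (Rn n)} {F : ℕ → Rn n → ℝ≥0∞} {t c : ℝ≥0∞}
    (h : ∀ k, μ {y ∈ G | t < F k y} ≤ c) :
    μ {y ∈ G | t < liminf (fun k => F k y) atTop} ≤ c := by
  let A : ℕ → Set (Rn n) := fun N => {y ∈ G | ∀ k ≥ N, t < F k y}
  have hA : Monotone A := fun N N' hN y hy => ⟨hy.1, fun k hk => hy.2 k (hN.trans hk)⟩
  calc μ {y ∈ G | t < liminf (fun k => F k y) atTop} ≤ μ (⋃ N, A N) := by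
        refine measure_mono fun y hy => ?_
        obtain ⟨N, hN⟩ := eventually_atTop.1 (eventually_lt_of_lt_liminf hy.2)
        exact mem_iUnion.2 ⟨N, hy.1, hN⟩
    _ = ⨆ N, μ (A N) := hA.measure_iUnion
    _ ≤ c := iSup_le fun N =>
        (measure_mono (t := {y ∈ G | t < F N y}) fun y hy => ⟨hy.1, hy.2 N le_rfl⟩).trans (h N)

/-- The weak type bound for finite combinations of point masses in `E`. -/
def IsDiscreteWeakBoundedOn {n : ℕ} (E : Set (Rn n)) (α : ℝ) (S : Rn n → Rn n → ℂ)
    (μ : Measure (Rn n)) (A : ℝ) (G : Set (Rn n)) : Prop :=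
  ∀ (s : Finset (Rn n)) (a : Rn n → ℂ), ↑s ⊆ E → ∀ t : ℝ, 0 < t →
    μ {y ∈ G | ENNReal.ofReal t < coneNorm (coneWeight E α) E (fun x => ∑ z ∈ s, a z * S x z) y} ≤
      ENNReal.ofReal (A / t) * ∑ z ∈ s, ‖a z‖ₑ

theorem IsDiscreteWeakBoundedOn.mono {A A' : ℝ} {G : Set (Rn n)} (hA : A ≤ A')
    (h : IsDiscreteWeakBoundedOn E α S μ A G) : IsDiscreteWeakBoundedOn E α S μ A' G := by
  intro s a hs t ht
  refine (h s a hs t ht).trans ?_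
  gcongr

/-- Tests the hypothesis on finite sums of Dirac masses. This is the only use of general complex
measures; the rest of the proof works with the discrete condition, which the `L²` hypothesis also
implies. -/
theorem IsWeakBoundedOn.isDiscreteWeakBoundedOn (hE : IsClosed E) {A : ℝ} {G : Set (Rn n)}
    (h : IsWeakBoundedOn E α S μ A G) : IsDiscreteWeakBoundedOn E α S μ A G := by
  classical
  intro s a hs t ht
  set ν : ComplexMeasure (Rn n) := ∑ z ∈ s, VectorMeasure.dirac z (a z) with hν
  have hvar : ν.variation ≤ ∑ z ∈ s, ‖a z‖ₑ • Measure.dirac z := by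
    refine (VectorMeasure.variation_finsetSum_le _ _).trans (le_of_eq ?_)
    exact Finset.sum_congr rfl fun z _ => VectorMeasure.variation_dirac
  have hvarE : ν.variation Eᶜ = 0 := by
    refine le_antisymm ((hvar _).trans ?_) (zero_le)
    rw [Measure.finsetSum_apply]
    refine le_of_eq (Finset.sum_eq_zero fun z hz => ?_)
    simp [hs hz, hE.isOpen_compl.measurableSet]
  have hop : integralOpMeasure E S ν = fun x => ∑ z ∈ s, a z * S x z := by
    ext x
    have hr : ν.restrict E = ∑ z ∈ s, VectorMeasure.dirac z (a z) := by
      have : ν.restrict E = VectorMeasure.restrictGm (M := ℂ) E ν := rfl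
      rw [this, hν, map_sum]
      refine Finset.sum_congr rfl fun z hz => ?_
      exact VectorMeasure.restrict_dirac_of_mem hE.measurableSet (hs hz)
    rw [integralOpMeasure, hr, VectorMeasure.integral_finsetSum_vectorMeasure]
    · refine Finset.sum_congr rfl fun z _ => ?_
      rw [VectorMeasure.integral_dirac]
      simp [mul_comm]
    · intro z _
      rw [VectorMeasure.Integrable, VectorMeasure.variation_dirac]
      exact (integrable_dirac (by simp)).smul_measure (by simp)
  have := h ν hvarE t ht
  simp only [squareFunMeasure, hop, coneIntegral_eq_coneNorm hE] at this
  refine this.trans ?_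
  gcongr
  refine (hvar E).trans ?_
  rw [Measure.finsetSum_apply]
  refine Finset.sum_le_sum fun z _ => ?_
  simp only [Measure.smul_apply, smul_eq_mul]
  exact mul_le_of_le_one_right' prob_le_one

theorem IsDiscreteWeakBoundedOn.measure_le (hE : IsClosed E) (hS : IsKernel E m α β K₁ K₂ S)
    (hmα : 0 < m + α) (hβ : 0 < β) (hK : 0 < K₁) {A : ℝ} {G : Set (Rn n)}
    (h : IsDiscreteWeakBoundedOn E α S μ A G) {f : Rn n → ℂ} (hf : Integrable f μ) {t : ℝ}
    (ht : 0 < t) :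
    μ {y ∈ G | ENNReal.ofReal t < coneNorm (coneWeight E α) E (integralOp E S μ f) y} ≤
      ENNReal.ofReal (A / t) * ∫⁻ z, ‖f z‖ₑ ∂μ := by
  obtain ⟨s, a, hs, hsum, hlim⟩ := exists_discrete_approx hE hS hmα hβ hK hf
  have hω := coneWeight_absolutelyContinuous (E := E) (α := α)
  calc _ ≤ μ {y ∈ G | ENNReal.ofReal t < liminf (fun k =>
        coneNorm (coneWeight E α) E (fun x => ∑ z ∈ s k, a k z * S x z) y) atTop} := by
        refine measure_mono fun y hy => ⟨hy.1, hy.2.trans_le ?_⟩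
        refine coneNorm_le_liminf
          (fun k => hS.aestronglyMeasurable_sum (s k) (hs k) (a k) hω) ?_ y
        filter_upwards [ae_notMem_of_ac hE hω] with x hx
        exact hlim x hx
    _ ≤ _ := measure_lt_liminf_le fun k => (h (s k) (a k) (hs k) t ht).trans (by
        gcongr
        exact hsum k)

end ConicalSquare

/-! ### Covering arguments for arbitrary locally finite measures. -/

namespace ConicalSquare

open Filter Topology

variable {n : ℕ} {E : Set (Rn n)} {m C₀ : ℝ} {μ : Measure (Rn n)}

/-! ### A maximal function -/

/-- The uncentred maximal function with averages over balls normalised by the measure of the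
five times larger ball. -/
noncomputable def maximal (μ : Measure (Rn n)) (g : Rn n → ℝ≥0∞) (w : Rn n) : ℝ≥0∞ :=
  ⨆ (z : Rn n) (r : ℝ) (_ : w ∈ ball z r),
    (∫⁻ x in closedBall z r, g x ∂μ) / μ (closedBall z (5 * r))

theorem lt_maximal_iff {g : Rn n → ℝ≥0∞} {w : Rn n} {t : ℝ≥0∞} :
    t < maximal μ g w ↔ ∃ (z : Rn n) (r : ℝ), w ∈ ball z r ∧
      t < (∫⁻ x in closedBall z r, g x ∂μ) / μ (closedBall z (5 * r)) := by
  simp only [maximal, lt_iSup_iff, exists_prop]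

theorem lowerSemicontinuous_maximal (μ : Measure (Rn n)) (g : Rn n → ℝ≥0∞) :
    LowerSemicontinuous (maximal μ g) := by
  intro w t ht
  obtain ⟨z, r, hw, h⟩ := lt_maximal_iff.1 ht
  filter_upwards [isOpen_ball.mem_nhds hw] with w' hw'
  exact lt_maximal_iff.2 ⟨z, r, hw', h⟩

theorem measurable_maximal (μ : Measure (Rn n)) (g : Rn n → ℝ≥0∞) : Measurable (maximal μ g) :=
  (lowerSemicontinuous_maximal μ g).measurable

theorem lintegral_closedBall_le_maximal [IsLocallyFiniteMeasure μ] (g : Rn n → ℝ≥0∞) {w z : Rn n}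
    {r : ℝ} (hw : w ∈ ball z r) :
    ∫⁻ x in closedBall z r, g x ∂μ ≤ maximal μ g w * μ (closedBall z (5 * r)) := by
  have hr : 0 < r := dist_nonneg.trans_lt hw
  have hfin : μ (closedBall z (5 * r)) ≠ ∞ := measure_closedBall_lt_top.ne
  rcases eq_or_ne (μ (closedBall z (5 * r))) 0 with h0 | h0
  · have : μ (closedBall z r) = 0 :=
      measure_mono_null (closedBall_subset_closedBall (by linarith)) h0
    rw [setLIntegral_measure_zero _ _ this]
    exact zero_le
  · rw [← ENNReal.div_le_iff h0 hfin]
    exact le_iSup_of_le z (le_iSup_of_le r (le_iSup_of_le hw le_rfl))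

theorem maximal_le_of_le [IsLocallyFiniteMeasure μ] {g : Rn n → ℝ≥0∞} {c : ℝ≥0∞}
    (h : ∀ (z : Rn n) (r : ℝ), ∫⁻ x in closedBall z r, g x ∂μ ≤ c * μ (closedBall z (5 * r)))
    (w : Rn n) : maximal μ g w ≤ c :=
  iSup_le fun z => iSup_le fun r => iSup_le fun _ => ENNReal.div_le_of_le_mul (h z r)

/-- Vitali's covering lemma enlarges balls by the factor `5`, exactly the factor in the
normalisation; hence the weak type bound holds with constant `1` and without doubling. -/
theorem maximal_weak_type [IsLocallyFiniteMeasure μ] (g : Rn n → ℝ≥0∞) (t : ℝ≥0∞) :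
    t * μ {w | t < maximal μ g w} ≤ ∫⁻ x, g x ∂μ := by
  have hopen : IsOpen {w | t < maximal μ g w} :=
    (lowerSemicontinuous_maximal μ g).isOpen_preimage t
  -- Compact subsets of the level set are covered by finitely many of the balls, so the radii are
  -- bounded as the covering lemma requires.
  rw [hopen.measure_eq_iSup_isCompact, ENNReal.mul_iSup]
  refine iSup_le fun K => ?_
  rw [ENNReal.mul_iSup]
  refine iSup_le fun hK => ?_
  rw [ENNReal.mul_iSup]
  refine iSup_le fun hKc => ?_
  choose! z r hw hzr using fun w (hw : w ∈ K) => lt_maximal_iff.1 (hK hw)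
  obtain ⟨T, hcov⟩ := hKc.elim_nhds_subcover' (fun w _ => ball (z w) (r w))
    (fun w hwK => isOpen_ball.mem_nhds (hw w hwK))
  classical
  obtain ⟨R, hR⟩ : ∃ R, ∀ w ∈ (T : Set K), r w ≤ R := by
    obtain ⟨R, hR⟩ := (T.image fun w : K => r w).bddAbove
    exact ⟨R, fun w hw => hR (Finset.mem_coe.2 (Finset.mem_image_of_mem _ hw))⟩
  obtain ⟨u, huT, hdisj, hu⟩ := Vitali.exists_disjoint_subfamily_covering_enlargement_closedBall
    (T : Set K) (fun w => z w) (fun w => r w) R hR 5 (by norm_num)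
  have hufin : u.Finite := T.finite_toSet.subset huT
  have hKu : K ⊆ ⋃ w ∈ hufin.toFinset, closedBall (z w) (5 * r w) := by
    intro x hx
    have := hcov hx
    simp only [mem_iUnion, exists_prop] at this
    obtain ⟨w, hwT, hxw⟩ := this
    obtain ⟨w', hw', hsub⟩ := hu w hwT
    simp only [mem_iUnion, Finite.mem_toFinset, exists_prop]
    exact ⟨w', hw', hsub (ball_subset_closedBall hxw)⟩
  calc t * μ K ≤ t * ∑ w ∈ hufin.toFinset, μ (closedBall (z w) (5 * r w)) := by
        gcongr
        exact (measure_mono hKu).trans (measure_biUnion_finset_le _ _)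
    _ = ∑ w ∈ hufin.toFinset, t * μ (closedBall (z w) (5 * r w)) := Finset.mul_sum _ _ _
    _ ≤ ∑ w ∈ hufin.toFinset, ∫⁻ x in closedBall (z w) (r w), g x ∂μ :=
        Finset.sum_le_sum fun w _ => ENNReal.mul_le_of_le_div (hzr w w.2).le
    _ = ∫⁻ x in ⋃ w ∈ hufin.toFinset, closedBall (z w) (r w), g x ∂μ := by
        rw [lintegral_biUnion_finset]
        · simpa using hdisj
        · exact fun _ _ => measurableSet_closedBall
    _ ≤ _ := setLIntegral_le_lintegral _ _

theorem maximal_le_indicator_add [IsLocallyFiniteMeasure μ] {g : Rn n → ℝ≥0∞} (hg : Measurable g)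
    (t : ℝ≥0∞) (w : Rn n) :
    maximal μ g w ≤ maximal μ ({x | t < g x}.indicator g) w + t := by
  refine iSup_le fun z => iSup_le fun r => iSup_le fun hw => ENNReal.div_le_of_le_mul ?_
  have hm : MeasurableSet {x | t < g x} := measurableSet_lt measurable_const hg
  calc ∫⁻ x in closedBall z r, g x ∂μ
      ≤ ∫⁻ x in closedBall z r, ({x | t < g x}.indicator g x + t) ∂μ := by
        refine lintegral_mono fun x => ?_
        by_cases hx : t < g x
        · rw [indicator_of_mem (show x ∈ {x | t < g x} from hx)]
          exact le_self_add
        · rw [indicator_of_notMem (show x ∉ {x | t < g x} from hx), zero_add]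
          exact not_lt.1 hx
    _ = ∫⁻ x in closedBall z r, {x | t < g x}.indicator g x ∂μ + t * μ (closedBall z r) := by
        rw [lintegral_add_left (hg.indicator hm)]
        simp
    _ ≤ maximal μ ({x | t < g x}.indicator g) w * μ (closedBall z (5 * r)) +
          t * μ (closedBall z (5 * r)) := by
        have hr : 0 < r := dist_nonneg.trans_lt hw
        gcongr
        · exact lintegral_closedBall_le_maximal _ hw
        · linarith
    _ = _ := by ring

theorem lintegral_Ioo_rpow_le {p G : ℝ} (hp : 1 < p) (hG : 0 ≤ G) :
    ∫⁻ t in Ioo 0 G, ENNReal.ofReal (t ^ (p - 2)) ≤ ENNReal.ofReal (G ^ (p - 1) / (p - 1)) := by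
  have hi : IntervalIntegrable (fun t : ℝ => t ^ (p - 2)) volume 0 G :=
    intervalIntegral.intervalIntegrable_rpow' (by linarith)
  rw [restrict_Ioo_eq_restrict_Ioc]
  rw [← ofReal_integral_eq_lintegral_ofReal]
  · apply ENNReal.ofReal_le_ofReal
    rw [← intervalIntegral.integral_of_le hG, integral_rpow (Or.inl (by linarith)),
      Real.zero_rpow (by linarith), sub_zero, show p - 2 + 1 = p - 1 by ring]
  · exact (intervalIntegrable_iff_integrableOn_Ioc_of_le hG).1 hi
  · filter_upwards [ae_restrict_mem measurableSet_Ioc] with t ht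
    exact Real.rpow_nonneg ht.1.le _

/-- Marcinkiewicz interpolation between the weak `L¹` bound and the trivial `L^∞` bound. Boundedness
of `g` only ensures that the maximal function is finite; the constant does not depend on `B`. -/
theorem exists_maximal_strong_type {p : ℝ} (hp : 1 < p) :
    ∃ C : ℝ≥0, ∀ (n : ℕ) (μ : Measure (Rn n)), IsLocallyFiniteMeasure μ → ∀ (g : Rn n → ℝ) (B : ℝ),
      Measurable g → (∀ x, 0 ≤ g x) → (∀ x, g x ≤ B) →
      ∫⁻ w, maximal μ (fun x => ENNReal.ofReal (g x)) w ^ p ∂μ ≤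
        C * ∫⁻ x, ENNReal.ofReal (g x) ^ p ∂μ := by
  refine ⟨(ENNReal.ofReal p * (2 * ENNReal.ofReal (2 ^ (p - 1) / (p - 1)))).toNNReal,
    fun n μ _ g B hg hg0 hgB => ?_⟩
  rw [ENNReal.coe_toNNReal (by finiteness)]
  set h : Rn n → ℝ≥0∞ := fun x => ENNReal.ofReal (g x) with hh
  have hhm : Measurable h := by fun_prop
  have hMB : ∀ w, maximal μ h w ≤ ENNReal.ofReal B := fun w => by
    refine maximal_le_of_le (fun z r => ?_) w
    calc ∫⁻ x in closedBall z r, h x ∂μ ≤ ∫⁻ x in closedBall z r, ENNReal.ofReal B ∂μ :=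
          lintegral_mono fun x => ENNReal.ofReal_le_ofReal (hgB x)
      _ = ENNReal.ofReal B * μ (closedBall z r) := by simp
      _ ≤ _ := by
        rcases le_or_gt 0 r with hr | hr
        · gcongr
          linarith
        · simp [closedBall_eq_empty.2 hr]
  have hfin : ∀ w, maximal μ h w ≠ ∞ := fun w => ne_top_of_le_ne_top ENNReal.ofReal_ne_top (hMB w)
  have hMm := measurable_maximal μ h
  have hlayer := lintegral_rpow_eq_lintegral_meas_lt_mul μ (f := fun w => (maximal μ h w).toReal)
    (Eventually.of_forall fun w => ENNReal.toReal_nonneg) hMm.ennreal_toReal.aemeasurable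
    (p := p) (by linarith)
  have e1 : ∀ w, ENNReal.ofReal ((maximal μ h w).toReal ^ p) = maximal μ h w ^ p := fun w => by
    rw [← ENNReal.ofReal_rpow_of_nonneg ENNReal.toReal_nonneg (by linarith),
      ENNReal.ofReal_toReal (hfin w)]
  simp only [e1] at hlayer
  rw [hlayer, mul_assoc]
  gcongr
  have hweak : ∀ t ∈ Ioi (0:ℝ), μ {w | t < (maximal μ h w).toReal} * ENNReal.ofReal (t ^ (p - 1)) ≤
      ∫⁻ x, (Ioo 0 (2 * g x)).indicator (fun t => ENNReal.ofReal (t ^ (p - 2))) t * (2 * h x) ∂μ := by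
    intro t ht
    have ht0 : (0:ℝ) < t := ht
    -- The part of `g` below `t / 2` contributes at most `t / 2`, so the weak type bound is applied,
    -- at height `t / 2`, to the part above.
    set T := ENNReal.ofReal (t / 2) with hT
    have hsub : {w | t < (maximal μ h w).toReal} ⊆
        {w | T < maximal μ ({x | T < h x}.indicator h) w} := by
      intro w hw
      have h1 : ENNReal.ofReal t < maximal μ h w := (ENNReal.ofReal_lt_iff_lt_toReal ht0.le (hfin w)).2 hw
      have h2 := maximal_le_indicator_add (μ := μ) hhm T w
      by_contra hcon
      have h3 : maximal μ ({x | T < h x}.indicator h) w ≤ T := not_lt.1 hcon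
      have h4 : T + T = ENNReal.ofReal t := by
        rw [hT, ← ENNReal.ofReal_add (by positivity) (by positivity), add_halves]
      exact absurd (h1.trans_le (h2.trans (add_le_add_left h3 T))) (by rw [h4]; exact lt_irrefl _)
    have hw := maximal_weak_type (μ := μ) ({x | T < h x}.indicator h) T
    have hset : ∀ x, T < h x ↔ t < 2 * g x := fun x => by
      rw [hT, hh, ENNReal.ofReal_lt_ofReal_iff_of_nonneg (by positivity)]
      constructor <;> intro h <;> linarith
    have e2 : ENNReal.ofReal (t ^ (p - 1)) = 2 * ENNReal.ofReal (t ^ (p - 2)) * T := by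
      rw [hT, show (2 : ℝ≥0∞) = ENNReal.ofReal 2 by norm_num, ← ENNReal.ofReal_mul (by norm_num),
        ← ENNReal.ofReal_mul (by positivity)]
      congr 1
      rw [show p - 1 = (p - 2) + 1 by ring, Real.rpow_add_one ht0.ne']
      ring
    calc _ ≤ μ {w | T < maximal μ ({x | T < h x}.indicator h) w} * ENNReal.ofReal (t ^ (p - 1)) := by
          gcongr
      _ = 2 * ENNReal.ofReal (t ^ (p - 2)) *
            (T * μ {w | T < maximal μ ({x | T < h x}.indicator h) w}) := by rw [e2]; ring
      _ ≤ 2 * ENNReal.ofReal (t ^ (p - 2)) * ∫⁻ x, {x | T < h x}.indicator h x ∂μ := by gcongr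
      _ = ∫⁻ x, 2 * ENNReal.ofReal (t ^ (p - 2)) * {x | T < h x}.indicator h x ∂μ := by
          rw [lintegral_const_mul _ (hhm.indicator (measurableSet_lt measurable_const hhm))]
      _ = _ := by
          refine lintegral_congr fun x => ?_
          by_cases hx : t < 2 * g x
          · rw [indicator_of_mem (show x ∈ {x | T < h x} from (hset x).2 hx),
              indicator_of_mem (show t ∈ Ioo 0 (2 * g x) from ⟨ht0, hx⟩)]
            ring
          · rw [indicator_of_notMem (show x ∉ {x | T < h x} from fun hc => hx ((hset x).1 hc)),
              indicator_of_notMem (show t ∉ Ioo 0 (2 * g x) from fun hc => hx hc.2)]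
            ring
  calc _ ≤ ∫⁻ t in Ioi (0:ℝ), (∫⁻ x, (Ioo 0 (2 * g x)).indicator
          (fun t => ENNReal.ofReal (t ^ (p - 2))) t * (2 * h x) ∂μ) :=
        setLIntegral_mono' measurableSet_Ioi hweak
    _ = ∫⁻ x, (∫⁻ t in Ioi (0:ℝ), (Ioo 0 (2 * g x)).indicator
          (fun t => ENNReal.ofReal (t ^ (p - 2))) t * (2 * h x)) ∂μ := by
        rw [lintegral_lintegral_swap]
        apply Measurable.aemeasurable
        simp only [Function.uncurry_def]
        apply Measurable.mul _ (by fun_prop)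
        have : (fun a : ℝ × Rn n => (Ioo 0 (2 * g a.2)).indicator
            (fun t => ENNReal.ofReal (t ^ (p - 2))) a.1) =
            {a : ℝ × Rn n | 0 < a.1 ∧ a.1 < 2 * g a.2}.indicator
              fun a => ENNReal.ofReal (a.1 ^ (p - 2)) := by
          ext a
          simp only [indicator, mem_Ioo, mem_ofPred_eq]
        rw [this]
        apply Measurable.indicator (by fun_prop)
        exact (measurableSet_lt measurable_const measurable_fst).inter
          (measurableSet_lt measurable_fst (by fun_prop))
    _ ≤ ∫⁻ x, 2 * ENNReal.ofReal (2 ^ (p - 1) / (p - 1)) * h x ^ p ∂μ := by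
        refine lintegral_mono fun x => ?_
        have hp1 : 0 < p - 1 := by linarith
        rw [lintegral_mul_const _ (Measurable.indicator (by fun_prop) measurableSet_Ioo)]
        calc _ ≤ ENNReal.ofReal ((2 * g x) ^ (p - 1) / (p - 1)) * (2 * h x) := by
              gcongr
              rw [lintegral_indicator measurableSet_Ioo]
              refine le_trans ?_ (lintegral_Ioo_rpow_le hp (by linarith [hg0 x]))
              exact lintegral_mono' (Measure.restrict_mono le_rfl Measure.restrict_le_self) le_rfl
          _ = _ := by
              rw [Real.mul_rpow (by norm_num) (hg0 x), mul_div_right_comm,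
                ENNReal.ofReal_mul (by positivity)]
              have : h x ^ p = ENNReal.ofReal (g x ^ (p - 1)) * h x := by
                rw [hh, ENNReal.ofReal_rpow_of_nonneg (hg0 x) (by linarith),
                  ← ENNReal.ofReal_mul (Real.rpow_nonneg (hg0 x) _)]
                congr 1
                rcases (hg0 x).eq_or_lt with h0 | h0
                · rw [← h0, Real.zero_rpow (by linarith), mul_zero]
                · rw [← Real.rpow_add_one h0.ne']; congr 1; ring
              rw [this]
              ring
    _ = _ := by rw [lintegral_const_mul _ (by fun_prop)]

/-! ### Doubling balls -/

/-- Differentiation of volume with respect to `μ`: a set where the lower density of `μ` relative to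
volume vanishes is `μ`-null. Since `μ` need not be doubling, the Besicovitch Vitali family is used.
-/
theorem measure_eq_zero_of_frequently_le [IsLocallyFiniteMeasure μ] {Z : Set (Rn n)}
    (h : ∀ y ∈ Z, ∀ ε : ℝ, 0 < ε → ∃ᶠ r in 𝓝[>] (0:ℝ),
      μ (closedBall y r) ≤ ENNReal.ofReal ε * volume (closedBall y r)) : μ Z = 0 := by
  have hN : ∀ N : ℕ, μ (Z ∩ closedBall 0 N) = 0 := by
    intro N
    have hV : volume (closedBall (0 : Rn n) N) ≠ ∞ := measure_closedBall_lt_top.ne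
    have hle : ∀ ε : ℝ, 0 < ε → μ (Z ∩ closedBall 0 N) ≤
        ENNReal.ofReal ε * volume (closedBall (0 : Rn n) N) := by
      intro ε hε
      have : IsLocallyFiniteMeasure (ENNReal.ofReal ε • (volume : Measure (Rn n))) :=
        inferInstanceAs (IsLocallyFiniteMeasure (ε.toNNReal • (volume : Measure (Rn n))))
      refine ((Besicovitch.vitaliFamily μ).measure_le_of_frequently_le
        (ENNReal.ofReal ε • (volume : Measure (Rn n))) Measure.AbsolutelyContinuous.rfl _ ?_).trans
        (?_ : (ENNReal.ofReal ε • (volume : Measure (Rn n))) (Z ∩ closedBall 0 N) ≤ _)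
      · intro y hy
        exact (Besicovitch.tendsto_filterAt μ y).frequently (h y hy.1 ε hε)
      · simp only [Measure.smul_apply, smul_eq_mul]
        gcongr
        exact inter_subset_right
    refine le_antisymm (ENNReal.le_of_forall_pos_le_add fun ε hε _ => ?_) zero_le
    rw [zero_add]
    refine (hle (ε / ((volume (closedBall (0 : Rn n) N)).toReal + 1)) (by positivity)).trans ?_
    rw [← ENNReal.ofReal_toReal hV, ← ENNReal.ofReal_mul (by positivity), ← ENNReal.ofReal_coe_nnreal]
    apply ENNReal.ofReal_le_ofReal
    rw [ENNReal.toReal_ofReal ENNReal.toReal_nonneg, div_mul_eq_mul_div,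
      div_le_iff₀ (by positivity)]
    have : (0:ℝ) ≤ ε := ε.2
    nlinarith [ENNReal.toReal_nonneg (a := volume (closedBall (0 : Rn n) N))]
  have : Z ⊆ ⋃ N : ℕ, Z ∩ closedBall 0 N := by
    intro y hy
    obtain ⟨N, hN⟩ := exists_nat_ge (dist y 0)
    exact mem_iUnion.2 ⟨N, hy, hN⟩
  exact measure_mono_null this (measure_iUnion_null hN)

theorem IsOfOrder.measure_closedBall_le (hμ : IsOfOrder E m C₀ μ) {y : Rn n} (hy : y ∈ E) {r : ℝ}
    (hr : 0 < r) : μ (closedBall y r) ≤ ENNReal.ofReal (C₀ * 2 ^ m * r ^ m) := by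
  refine (measure_mono (closedBall_subset_ball (show r < 2 * r by linarith))).trans
    ((hμ.2 y hy (2 * r) (by linarith)).trans (le_of_eq ?_))
  rw [Real.mul_rpow (by norm_num) hr.le, mul_assoc]

theorem IsOfOrder.isLocallyFiniteMeasure (hE : IsClosed E) (hμ : IsOfOrder E m C₀ μ) :
    IsLocallyFiniteMeasure μ := by
  refine ⟨fun x => ?_⟩
  by_cases hx : x ∈ E
  · exact ⟨ball x 1, ball_mem_nhds x one_pos,
      (hμ.2 x hx 1 one_pos).trans_lt ENNReal.ofReal_lt_top⟩
  · exact ⟨Eᶜ, hE.isOpen_compl.mem_nhds hx, by rw [hμ.1]; exact ENNReal.zero_lt_top⟩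

theorem volume_closedBall_eq (y : Rn n) {r : ℝ} (hr : 0 ≤ r) :
    volume (closedBall y r) =
      ENNReal.ofReal (r ^ n * (volume (closedBall (0 : Rn n) 1)).toReal) := by
  rw [Measure.addHaar_closedBall' _ _ hr, ENNReal.ofReal_mul (by positivity),
    ENNReal.ofReal_toReal measure_closedBall_lt_top.ne]
  simp

theorem toReal_volume_closedBall_pos (n : ℕ) :
    0 < (volume (closedBall (0 : Rn n) 1)).toReal :=
  ENNReal.toReal_pos (measure_closedBall_pos _ _ one_pos).ne' measure_closedBall_lt_top.ne

/-- For `m > n` the density of `μ` with respect to volume is `O(r^(m-n))`, hence zero. This reduces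
the theorem to `m ≤ n`. -/
theorem IsOfOrder.eq_zero_of_lt (hE : IsClosed E) (hμ : IsOfOrder E m C₀ μ) (hmn : (n : ℝ) < m) :
    μ = 0 := by
  have := hμ.isLocallyFiniteMeasure hE
  have hV := toReal_volume_closedBall_pos n
  set V := (volume (closedBall (0 : Rn n) 1)).toReal
  have hE0 : μ E = 0 := by
    refine measure_eq_zero_of_frequently_le fun y hy ε hε => ?_
    apply Eventually.frequently
    have hlim : Tendsto (fun r : ℝ => C₀ * 2 ^ m * r ^ (m - n)) (𝓝[>] 0) (𝓝 0) := by
      have h1 : Continuous fun r : ℝ => C₀ * 2 ^ m * r ^ (m - n) :=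
        continuous_const.mul (continuous_id.rpow_const fun _ => Or.inr (by linarith))
      have h2 := (h1.tendsto 0).mono_left (nhdsWithin_le_nhds (s := Ioi 0))
      simpa [Real.zero_rpow (sub_pos.2 hmn).ne'] using h2
    filter_upwards [self_mem_nhdsWithin, hlim.eventually_le_const (show 0 < ε * V by positivity)]
      with r hr hr2
    have hr0 : 0 < r := hr
    refine (hμ.measure_closedBall_le hy hr).trans ?_
    rw [volume_closedBall_eq y hr0.le, ← ENNReal.ofReal_mul hε.le]
    apply ENNReal.ofReal_le_ofReal
    calc C₀ * 2 ^ m * r ^ m = C₀ * 2 ^ m * r ^ (m - n) * r ^ n := by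
          rw [mul_assoc (C₀ * 2 ^ m), ← Real.rpow_natCast, ← Real.rpow_add hr0]
          congr 2; ring
      _ ≤ ε * V * r ^ n := by gcongr
      _ = _ := by ring
  rw [← Measure.measure_univ_eq_zero, ← union_compl_self E]
  exact measure_union_null hE0 hμ.1

theorem measure_closedBall_div_le_of_not_doubling {y : Rn n} {D b : ℝ} (hb : 0 < b) {k : ℕ}
    (h : ∀ i : ℕ, 1 ≤ i → i ≤ k → ENNReal.ofReal b * μ (closedBall y (D / 100 ^ i)) ≤
      μ (closedBall y (100 * (D / 100 ^ i)))) :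
    μ (closedBall y (D / 100 ^ k)) ≤ ENNReal.ofReal (b⁻¹ ^ k) * μ (closedBall y D) := by
  induction k with
  | zero => simp
  | succ k ih =>
    have h1 := h (k + 1) (by omega) le_rfl
    have e : 100 * (D / 100 ^ (k + 1)) = D / 100 ^ k := by field_simp; ring
    rw [e] at h1
    have h2 := ih fun i hi hik => h i hi (by omega)
    have hbinv : ENNReal.ofReal b⁻¹ * ENNReal.ofReal b = 1 := by
      rw [← ENNReal.ofReal_mul (by positivity), inv_mul_cancel₀ hb.ne', ENNReal.ofReal_one]
    calc μ (closedBall y (D / 100 ^ (k + 1)))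
        = ENNReal.ofReal b⁻¹ * (ENNReal.ofReal b * μ (closedBall y (D / 100 ^ (k + 1)))) := by
          rw [← mul_assoc, hbinv, one_mul]
      _ ≤ ENNReal.ofReal b⁻¹ * (ENNReal.ofReal (b⁻¹ ^ k) * μ (closedBall y D)) := by
          exact mul_le_mul' le_rfl (h1.trans h2)
      _ = _ := by
          rw [← mul_assoc, ← ENNReal.ofReal_mul (by positivity)]
          congr 2
          ring

/-- Almost every point is the centre of small doubling balls. -/
theorem ae_exists_doubling [IsLocallyFiniteMeasure μ] {b : ℝ} (hb : 100 ^ (n + 1) ≤ b) :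
    ∀ᵐ y ∂μ, ∀ D : ℝ, 0 < D → ∃ k : ℕ, 1 ≤ k ∧
      μ (closedBall y (100 * (D / 100 ^ k))) ≤
        ENNReal.ofReal b * μ (closedBall y (D / 100 ^ k)) := by
  have hb0 : 0 < b := lt_of_lt_of_le (by positivity) hb
  have hV := toReal_volume_closedBall_pos n
  rw [ae_iff]
  -- If no scale `D / 100^k` is doubling, the measure of that ball is `O(b^(-k))`, at most
  -- `O(100^(-k(n+1)))`, while its volume is of order `100^(-kn)`; so the density tends to zero
  -- along these radii.
  refine measure_eq_zero_of_frequently_le fun y hy ε hε => ?_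
  simp only [mem_ofPred_eq, not_forall, not_exists, not_and, not_le] at hy
  obtain ⟨D, hD, hk⟩ := hy
  have hlim : Tendsto (fun k : ℕ => D / 100 ^ k) atTop (𝓝[>] 0) := by
    refine tendsto_nhdsWithin_iff.2 ⟨?_, Eventually.of_forall fun k => ?_⟩
    · have := (tendsto_pow_atTop_nhds_zero_of_lt_one (r := (1 / 100 : ℝ)) (by norm_num)
        (by norm_num)).const_mul D
      simpa [div_eq_mul_inv] using this
    · exact show 0 < D / 100 ^ k by positivity
  refine hlim.frequently (Eventually.frequently ?_)
  set M := (μ (closedBall y D)).toReal with hM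
  have hMc : μ (closedBall y D) = ENNReal.ofReal M :=
    (ENNReal.ofReal_toReal measure_closedBall_lt_top.ne).symm
  set V := (volume (closedBall (0 : Rn n) 1)).toReal
  have hlim2 : Tendsto (fun k : ℕ => (1 / 100 : ℝ) ^ k * M) atTop (𝓝 0) := by
    simpa using (tendsto_pow_atTop_nhds_zero_of_lt_one (r := (1 / 100 : ℝ)) (by norm_num)
        (by norm_num)).mul_const M
  filter_upwards [hlim2.eventually_le_const (show 0 < ε * (D ^ n * V) by positivity)] with k hk2
  refine (measure_closedBall_div_le_of_not_doubling hb0 fun i hi _ => (hk i hi).le).trans ?_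
  rw [hMc, volume_closedBall_eq y (by positivity), ← ENNReal.ofReal_mul (by positivity),
    ← ENNReal.ofReal_mul hε.le]
  apply ENNReal.ofReal_le_ofReal
  have hM0 : 0 ≤ M := ENNReal.toReal_nonneg
  calc b⁻¹ ^ k * M ≤ ((100:ℝ) ^ (n + 1))⁻¹ ^ k * M := by gcongr
    _ = (1 / 100 ^ k) ^ n * ((1 / 100 : ℝ) ^ k * M) := by
        rw [← mul_assoc]
        congr 1
        rw [inv_pow, ← pow_mul, one_div, inv_pow, ← pow_mul, one_div, inv_pow, ← mul_inv, ← pow_add]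
        congr 2
        ring
    _ ≤ (1 / 100 ^ k) ^ n * (ε * (D ^ n * V)) := by gcongr
    _ = _ := by rw [div_pow, div_pow]; ring

/-- Small boundaries. -/
theorem exists_hasSmallBoundary [IsLocallyFiniteMeasure μ] {κ : ℝ} (hκ : 21 ≤ κ) (y : Rn n) {r : ℝ}
    (hr : 0 < r) : ∃ t ∈ Icc r (2 * r), HasSmallBoundary μ κ y t := by
  by_contra hcon
  push Not at hcon
  simp only [HasSmallBoundary, not_forall, not_le, exists_prop] at hcon
  choose! s hs hbad using hcon
  set F := μ (closedBall y (3 * r)) with hF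
  have hFfin : F ≠ ∞ := measure_closedBall_lt_top.ne
  -- For `κ s ≥ 1` the small boundary condition is trivial, because the annulus lies in `B(y, 3t)`.
  -- So every bad width is below `1 / 21`, and the bad annuli stay inside `B(y, 3r)`.
  have hsκ : ∀ t ∈ Icc r (2 * r), κ * s t < 1 := by
    intro t ht
    by_contra h
    have h1 : 1 ≤ κ * s t := not_lt.1 h
    refine absurd (hbad t ht) (not_lt.2 ?_)
    calc μ {x | t * (1 - s t) < dist x y ∧ dist x y < t * (1 + s t)} ≤ μ (closedBall y (3 * t)) := by
          refine measure_mono fun x hx => ?_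
          rw [mem_closedBall]
          have := (hs t ht).2
          nlinarith [hx.2, ht.1]
      _ ≤ _ := le_mul_of_one_le_left zero_le (ENNReal.one_le_ofReal.2 h1)
  have hs0 : ∀ t ∈ Icc r (2 * r), 0 < s t := by
    intro t ht
    refine lt_of_le_of_ne (hs t ht).1 fun h => ?_
    have := hbad t ht
    rw [← h] at this
    have he : {x : Rn n | t * (1 - 0) < dist x y ∧ dist x y < t * (1 + 0)} = ∅ := by
      ext x
      simp
      intro h
      exact h.le
    rw [he] at this
    simp at this
  have hs1 : ∀ t ∈ Icc r (2 * r), s t ≤ 1 / 21 := by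
    intro t ht
    rw [le_div_iff₀ (by norm_num)]
    nlinarith [hsκ t ht, hs0 t ht]
  -- Vitali's lemma on the line, for the intervals of radii of the bad annuli. Disjoint intervals
  -- give disjoint annuli in `B(y, 3r)`, whence `Σ κ s ≤ 1`; the fivefold intervals cover `[r, 2r]`,
  -- whence `r ≤ (20r / κ) Σ κ s ≤ 20r / κ`. This contradicts `κ ≥ 21`.
  obtain ⟨u, huT, hdisj, hu⟩ := Vitali.exists_disjoint_subfamily_covering_enlargement_closedBall
    (Icc r (2 * r)) (fun t => t) (fun t => t * s t) (2 * r) (fun t ht => by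
      nlinarith [ht.1, ht.2, hs0 t ht, (hs t ht).2]) 5 (by norm_num)
  have hts : ∀ t ∈ Icc r (2 * r), 0 < t * s t := fun t ht =>
    mul_pos (hr.trans_le ht.1) (hs0 t ht)
  have hcount : u.Countable := by
    refine hdisj.countable_of_nonempty_interior fun t ht => ?_
    refine ⟨t, ball_subset_interior_closedBall (mem_ball_self (hts t (huT ht)))⟩
  let U : ℝ → Set (Rn n) := fun t => {x | t * (1 - s t) < dist x y ∧ dist x y < t * (1 + s t)}
  have hUm : ∀ t, MeasurableSet (U t) := fun t =>
    (measurableSet_lt (g := fun x => dist x y) measurable_const (by fun_prop)).inter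
      (measurableSet_lt (f := fun x => dist x y) (by fun_prop) measurable_const)
  have hUd : u.PairwiseDisjoint U := by
    intro t ht t' ht' htt
    refine Set.disjoint_left.2 fun x hx hx' => ?_
    refine (Set.disjoint_left.1 (hdisj ht ht' htt))
      (show dist x y ∈ closedBall t (t * s t) from ?_) ?_
    · rw [mem_closedBall, Real.dist_eq, abs_le]
      constructor <;> nlinarith [hx.1, hx.2]
    · rw [mem_closedBall, Real.dist_eq, abs_le]
      constructor <;> nlinarith [hx'.1, hx'.2]
  have hsum1 : ∑' t : u, ENNReal.ofReal (κ * s t) * F ≤ F := by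
    calc ∑' t : u, ENNReal.ofReal (κ * s t) * F ≤ ∑' t : u, μ (U t) := by
          refine ENNReal.tsum_le_tsum fun t => ?_
          refine le_trans ?_ (hbad t (huT t.2)).le
          refine mul_le_mul' le_rfl (measure_mono (closedBall_subset_closedBall ?_))
          linarith [(huT t.2).1]
      _ = μ (⋃ t ∈ u, U t) := (measure_biUnion hcount hUd fun t _ => hUm t).symm
      _ ≤ F := by
          refine measure_mono fun x hx => ?_
          simp only [mem_iUnion, exists_prop] at hx
          obtain ⟨t, ht, hx⟩ := hx
          rw [mem_closedBall]
          have := hs1 t (huT ht)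
          nlinarith [hx.2, (huT ht).1, (huT ht).2]
  have hF0 : F ≠ 0 := by
    intro h0
    have hrI : r ∈ Icc r (2 * r) := ⟨le_rfl, by linarith⟩
    have h1 : μ (U r) ≤ F := by
      refine measure_mono fun x hx => ?_
      rw [mem_closedBall]
      have := hs1 r hrI
      nlinarith [hx.2]
    rw [h0] at h1
    exact absurd ((hbad r hrI).trans_le h1) (by simp)
  have hsum2 : ∑' t : u, ENNReal.ofReal (κ * s t) ≤ 1 := by
    rw [ENNReal.tsum_mul_right] at hsum1
    rwa [← ENNReal.mul_le_mul_iff_left hF0 hFfin, one_mul]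
  have hvol : ENNReal.ofReal r ≤ ENNReal.ofReal (20 * r / κ) := by
    calc ENNReal.ofReal r = volume (Icc r (2 * r)) := by rw [Real.volume_Icc]; congr 1; ring
      _ ≤ volume (⋃ t ∈ u, closedBall t (5 * (t * s t))) := by
          refine measure_mono fun t ht => ?_
          obtain ⟨t', ht', hsub⟩ := hu t ht
          simp only [mem_iUnion, exists_prop]
          exact ⟨t', ht', hsub (mem_closedBall_self (hts t ht).le)⟩
      _ ≤ ∑' t : u, volume (closedBall (t : ℝ) (5 * (t * s t))) := measure_biUnion_le _ hcount _
      _ ≤ ∑' t : u, ENNReal.ofReal (20 * r / κ) * ENNReal.ofReal (κ * s t) := by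
          refine ENNReal.tsum_le_tsum fun t => ?_
          rw [Real.volume_closedBall, ← ENNReal.ofReal_mul (by positivity)]
          apply ENNReal.ofReal_le_ofReal
          have h1 := hs0 t (huT t.2)
          have h2 := (huT t.2).2
          calc 2 * (5 * (t * s t)) ≤ 2 * (5 * (2 * r * s t)) := by gcongr
            _ = 20 * r / κ * (κ * s t) := by field_simp; ring
      _ ≤ _ := by
          rw [ENNReal.tsum_mul_left]
          exact mul_le_of_le_one_right' hsum2
  rw [ENNReal.ofReal_le_ofReal_iff (by positivity), le_div_iff₀ (by linarith)] at hvol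
  nlinarith

end ConicalSquare

/-! ### The far part and the intermediate part of the function. -/

namespace ConicalSquare

open Filter Topology

variable {n : ℕ} {E : Set (Rn n)} {m α β K₁ K₂ C₀ b : ℝ} {S : Rn n → Rn n → ℂ}
  {μ : Measure (Rn n)}

theorem absMeasure_apply (f : Rn n → ℂ) {s : Set (Rn n)} (hs : MeasurableSet s) :
    absMeasure μ f s = ∫⁻ z in s, ‖f z‖ₑ ∂μ := withDensity_apply _ hs

theorem absMeasure_indicator (f : Rn n → ℂ) {s : Set (Rn n)} (hs : MeasurableSet s) :
    absMeasure μ (s.indicator f) = (absMeasure μ f).restrict s := by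
  ext A hA
  rw [absMeasure_apply _ hA, Measure.restrict_apply hA, absMeasure_apply _ (hA.inter hs)]
  simp_rw [enorm_indicator_eq_indicator_enorm]
  rw [setLIntegral_indicator hs, inter_comm]

theorem absMeasure_closedBall_le (hE : IsClosed E) (hμ : IsOfOrder E m C₀ μ) (f : Rn n → ℂ)
    {w z : Rn n} {r : ℝ} (hz : z ∈ E) (hw : w ∈ ball z r) :
    absMeasure μ f (closedBall z r) ≤ maximal μ (fun x => ‖f x‖ₑ) w *
      ENNReal.ofReal (C₀ * 10 ^ m * r ^ m) := by
  have := hμ.isLocallyFiniteMeasure hE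
  have hr : 0 < r := dist_nonneg.trans_lt hw
  rw [absMeasure_apply _ measurableSet_closedBall]
  refine (lintegral_closedBall_le_maximal _ hw).trans ?_
  gcongr
  refine (hμ.measure_closedBall_le hz (by positivity)).trans (le_of_eq ?_)
  congr 1
  rw [mul_assoc, mul_assoc, ← Real.mul_rpow (by norm_num) (by positivity),
    ← Real.mul_rpow (by norm_num) hr.le]
  congr 2; ring

theorem coneNorm_le_add_diff (ω : Measure (Rn n)) (u : Rn n → ℂ) (w x₀ : Rn n) :
    coneNorm ω E u w ≤ coneNorm ω E u x₀ +
      (∫⁻ x in cone E w \ cone E x₀, ‖u x‖ₑ ^ 2 ∂ω) ^ (1 / 2 : ℝ) := by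
  rw [coneNorm, coneNorm]
  refine le_trans ?_ (ENNReal.rpow_add_le_add_rpow _ _ (by norm_num) (by norm_num))
  gcongr
  refine le_trans (lintegral_mono_set ?_) (lintegral_union_le _ (cone E x₀) (cone E w \ cone E x₀))
  intro x hx
  by_cases h : x ∈ cone E x₀
  · exact Or.inl h
  · exact Or.inr ⟨hx, h⟩

/-- Estimate of the square function of the part of `f` living away from `y`. -/
theorem exists_far_le (n : ℕ) (hm : 0 < m) (hα : α ∈ Ioc (0 : ℝ) 1) (hβ : 0 < β) (hK : 0 < K₁)
    (hC₀ : 0 < C₀) :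
    ∃ C : ℝ≥0, ∀ (E : Set (Rn n)) (S : Rn n → Rn n → ℂ) (μ : Measure (Rn n)), IsClosed E →
      IsKernel E m α β K₁ K₂ S → IsOfOrder E m C₀ μ → ∀ ω ≤ coneWeight E α, ∀ f : Rn n → ℂ,
      Integrable f μ → ∀ y ∈ E, ∀ w ∈ E, ∀ x₀ ∈ E, ∀ L : ℝ, 0 < L → dist w y ≤ L / 2 →
      dist y x₀ = 10 * L →
      coneNorm ω E (integralOp E S μ ((closedBall y L)ᶜ.indicator f)) w ≤
        coneNorm ω E (integralOp E S μ f) x₀ + C * maximal μ (fun x => ‖f x‖ₑ) w := by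
  obtain ⟨C₁, hC₁⟩ := exists_lintegral_cone_diff_le n hα
  obtain ⟨C₂, hC₂⟩ := exists_lintegral_growth_le (m := m) (a := α) hm hα.1
  obtain ⟨C₃, hC₃⟩ := exists_coneNorm_le_of_bound n hα hm
  set Kc : ℝ≥0∞ := ENNReal.ofReal (K₁ * 4 ^ (m + α)) with hKc
  set Q : ℝ≥0∞ := Kc * ENNReal.ofReal (21 ^ (m + α)) * C₂ * ENNReal.ofReal (C₀ * 10 ^ m) with hQ
  set Q' : ℝ≥0∞ := C₃ * (Kc * ENNReal.ofReal (C₀ * 10 ^ m)) with hQ'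
  have hQfin : Q ≠ ∞ := by finiteness
  have hQ'fin : Q' ≠ ∞ := by finiteness
  refine ⟨(Q * (C₁ + 1) + Q').toNNReal, ?_⟩
  intro E S μ hE hS hμ ω hω f hf y hy w hw x₀ hx₀ L hL hwy hyx
  rw [ENNReal.coe_toNNReal (by finiteness)]
  have hmα : 0 < m + α := by linarith [hα.1]
  have hωac : ω ≪ volume.restrict Eᶜ :=
    (Measure.absolutelyContinuous_of_le hω).trans coneWeight_absolutelyContinuous
  set M := maximal μ (fun x => ‖f x‖ₑ) w with hM
  set g := (closedBall y L)ᶜ.indicator f with hg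
  have hgi : Integrable g μ := hf.indicator measurableSet_closedBall.compl
  have hgm : absMeasure μ g = (absMeasure μ f).restrict (closedBall y L)ᶜ :=
    absMeasure_indicator f measurableSet_closedBall.compl
  -- the part of the cone at `w` outside the cone at `x₀`
  have hpt : ∀ x ∈ cone E w, ‖integralOp E S μ g x‖ₑ ≤
      Q * M * ENNReal.ofReal ((infDist x E + 10 * L) ^ (-α)) := by
    intro x hx
    have hd := infDist_pos_of_mem_cone hx
    refine (enorm_integralOp_le hE hS hmα hK hgi.1 hx).trans ?_
    rw [hgm]
    have h1 : ∫⁻ z in (closedBall y L)ᶜ,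
        ENNReal.ofReal ((infDist x E + dist z w) ^ (-(m + α))) ∂(absMeasure μ f) ≤
        ∫⁻ z, ENNReal.ofReal (21 ^ (m + α)) *
          ENNReal.ofReal ((infDist x E + 10 * L + dist z w) ^ (-(m + α))) ∂(absMeasure μ f) := by
      refine (setLIntegral_mono' measurableSet_closedBall.compl fun z hz => ?_).trans
        (setLIntegral_le_lintegral _ _)
      rw [mem_compl_iff, mem_closedBall, not_le] at hz
      -- Hence `10L ≤ 20|z - w|` and `d + 10L + |z - w| ≤ 21(d + |z - w|)`, which is the source of
      -- the constant `21`.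
      have hzw : L / 2 ≤ dist z w := by
        have := dist_triangle z w y
        linarith
      rw [← ENNReal.ofReal_mul (by positivity)]
      apply ENNReal.ofReal_le_ofReal
      calc (infDist x E + dist z w) ^ (-(m + α))
          ≤ ((infDist x E + 10 * L + dist z w) / 21) ^ (-(m + α)) :=
            Real.rpow_le_rpow_of_nonpos (by positivity) (by linarith) (by linarith)
        _ = _ := by
            rw [Real.div_rpow (by positivity) (by norm_num), Real.rpow_neg (x := 21) (by norm_num),
              div_inv_eq_mul, mul_comm]
    have h2 := hC₂ n (absMeasure μ f) w (infDist x E + 10 * L) (M * ENNReal.ofReal (C₀ * 10 ^ m))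
      (by positivity) (fun r hr => by
        have hr0 : 0 < r := lt_of_lt_of_le (by positivity) hr
        refine (absMeasure_closedBall_le hE hμ f hw (mem_ball_self hr0)).trans (le_of_eq ?_)
        rw [ENNReal.ofReal_mul (by positivity), mul_assoc])
    rw [lintegral_const_mul _ (by fun_prop)] at h1
    calc _ ≤ Kc * (ENNReal.ofReal (21 ^ (m + α)) * (C₂ * (M * ENNReal.ofReal (C₀ * 10 ^ m)) *
          ENNReal.ofReal ((infDist x E + 10 * L) ^ (-α)))) := by
          gcongr
          refine h1.trans ?_
          gcongr
      _ = _ := by rw [hQ]; ring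
  have hdiff : (∫⁻ x in cone E w \ cone E x₀, ‖integralOp E S μ g x‖ₑ ^ 2 ∂ω) ^ (1 / 2 : ℝ) ≤
      Q * M * (C₁ + 1) := by
    have hmi : Measurable fun x : Rn n => infDist x E := measurable_infDist
    calc _ ≤ ((Q * M * (C₁ + 1)) ^ 2) ^ (1 / 2 : ℝ) := by
          gcongr
          calc _ ≤ ∫⁻ x in cone E w \ cone E x₀, ‖integralOp E S μ g x‖ₑ ^ 2 ∂(coneWeight E α) := by
                gcongr
            _ ≤ ∫⁻ x in cone E w \ cone E x₀, (Q * M) ^ 2 *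
                  ENNReal.ofReal ((infDist x E + 10 * L) ^ (-α)) ^ 2 ∂(coneWeight E α) := by
                refine setLIntegral_mono' ((isOpen_cone hE w).measurableSet.diff
                  (isOpen_cone hE x₀).measurableSet) fun x hx => ?_
                rw [← mul_pow]
                gcongr
                exact hpt x hx.1
            _ ≤ (Q * M) ^ 2 * C₁ := by
                rw [lintegral_const_mul _ (by fun_prop)]
                gcongr
                refine hC₁ E hE w x₀ (10 * L) (by positivity) ?_
                have := dist_triangle w y x₀
                linarith
            _ ≤ _ := by
                rw [mul_pow (Q * M)]
                gcongr
                simpa using nnreal_le_sq C₁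
      _ = _ := by rw [← ENNReal.rpow_natCast, ← ENNReal.rpow_mul]; norm_num
  -- the near part seen from `x₀`
  set g' := (closedBall y L).indicator (fun z => -f z) with hg'
  have hg'i : Integrable g' μ := hf.neg.indicator measurableSet_closedBall
  have hg'm : absMeasure μ g' = (absMeasure μ f).restrict (closedBall y L) := by
    rw [hg', absMeasure_indicator _ measurableSet_closedBall]
    simp [absMeasure]
  -- Points of `B(y, L)` are at distance at least `9L` from `x₀`, so the kernel is of size `(d +
  -- L)^(-(m+α))`, while the mass of `|f|μ` in this ball is at most a constant times `L^m M`.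
  have hnear : coneNorm ω E (integralOp E S μ g') x₀ ≤ Q' * M := by
    refine (hC₃ E hE ω hω x₀ L hL (Kc * absMeasure μ f (closedBall y L)) _ ?_).trans ?_
    · intro x hx
      have hd := infDist_pos_of_mem_cone hx
      refine (enorm_integralOp_le hE hS hmα hK hg'i.1 hx).trans ?_
      rw [hg'm, mul_assoc]
      gcongr
      calc _ ≤ ∫⁻ z in closedBall y L, ENNReal.ofReal ((infDist x E + L) ^ (-(m + α)))
            ∂(absMeasure μ f) := by
            refine setLIntegral_mono' measurableSet_closedBall fun z hz => ?_
            apply ENNReal.ofReal_le_ofReal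
            refine Real.rpow_le_rpow_of_nonpos (by positivity) ?_ (by linarith)
            rw [mem_closedBall] at hz
            have := dist_triangle y z x₀
            rw [dist_comm y z] at this
            linarith
        _ = _ := by rw [setLIntegral_const, mul_comm]
    · have h1 := absMeasure_closedBall_le hE hμ f hy (w := w) (r := L)
        (mem_ball.2 (by linarith))
      calc _ ≤ C₃ * (Kc * (M * ENNReal.ofReal (C₀ * 10 ^ m * L ^ m))) * ENNReal.ofReal (L ^ (-m)) := by
            gcongr
        _ = C₃ * (Kc * M) * (ENNReal.ofReal (C₀ * 10 ^ m * L ^ m) * ENNReal.ofReal (L ^ (-m))) := by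
            ring
        _ = _ := by
            rw [← ENNReal.ofReal_mul (by positivity), mul_assoc _ (L ^ m), ← Real.rpow_add hL,
              add_neg_cancel, Real.rpow_zero, mul_one, hQ']
            ring
  have hx₀' : coneNorm ω E (integralOp E S μ g) x₀ ≤
      coneNorm ω E (integralOp E S μ f) x₀ + Q' * M := by
    have hgf : g = fun z => f z + g' z := by
      ext z
      by_cases hz : z ∈ closedBall y L <;> simp [hg, hg', hz]
    have h1 : coneNorm ω E (integralOp E S μ g) x₀ =
        coneNorm ω E (fun x => integralOp E S μ f x + integralOp E S μ g' x) x₀ := by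
      rw [coneNorm, coneNorm]
      congr 1
      refine setLIntegral_congr_fun (isOpen_cone hE x₀).measurableSet fun x hx => ?_
      rw [hgf, integralOp_add hE hS hmα hβ hK hf hg'i hx.1]
    rw [h1]
    refine (coneNorm_add_le ω (aestronglyMeasurable_integralOp hE hS hmα hβ hK hf hωac)
      (aestronglyMeasurable_integralOp hE hS hmα hβ hK hg'i hωac) x₀).trans ?_
    gcongr
  calc _ ≤ _ := coneNorm_le_add_diff ω _ w x₀
    _ ≤ (coneNorm ω E (integralOp E S μ f) x₀ + Q' * M) + Q * M * (C₁ + 1) := by gcongr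
    _ = _ := by ring

/-- Estimate of the square function of the part of `f` living in the annulus between a ball
and a much larger ball, with no doubling balls in between. -/
theorem exists_ring_le (n : ℕ) (hm : 0 < m) (hα : α ∈ Ioc (0 : ℝ) 1) (hK : 0 < K₁)
    (hC₀ : 0 < C₀) (hmn : m ≤ n) (hb : 100 ^ (n + 1) ≤ b) :
    ∃ C : ℝ≥0, ∀ (E : Set (Rn n)) (S : Rn n → Rn n → ℂ) (μ : Measure (Rn n)), IsClosed E →
      IsKernel E m α β K₁ K₂ S → IsOfOrder E m C₀ μ → ∀ ω ≤ coneWeight E α, SFinite ω →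
      ∀ f : Rn n → ℂ, Integrable f μ → ∀ y ∈ E, ∀ w ∈ E, ∀ (L t : ℝ) (k : ℕ), 0 < L →
      L / 100 ^ k ≤ t → t ≤ 2 * (L / 100 ^ k) → dist w y ≤ t →
      (∀ i : ℕ, 1 ≤ i → i < k → ENNReal.ofReal b * μ (closedBall y (L / 100 ^ i)) ≤
        μ (closedBall y (100 * (L / 100 ^ i)))) →
      coneNorm ω E (integralOp E S μ ((closedBall y L \ closedBall y (2 * t)).indicator f)) w ≤
        C * maximal μ (fun x => ‖f x‖ₑ) w := by
  obtain ⟨C₁, hC₁⟩ := exists_coneNorm_le_potential n hα hm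
  set Kc : ℝ≥0∞ := ENNReal.ofReal (K₁ * 4 ^ (m + α)) with hKc
  have hb1 : 1 ≤ b := le_trans (one_le_pow₀ (by norm_num)) hb
  have hb0 : 0 < b := by linarith
  refine ⟨(C₁ * (Kc * (ENNReal.ofReal (2 ^ m) * (ENNReal.ofReal (2 * 100 ^ m) *
    ENNReal.ofReal (C₀ * 10 ^ m * b))))).toNNReal, ?_⟩
  intro E S μ hE hS hμ ω hω _ f hf y hy w hw L t k hL hrt htr hwy hdoub
  rw [ENNReal.coe_toNNReal (by finiteness)]
  have := hμ.isLocallyFiniteMeasure hE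
  have hmα : 0 < m + α := by linarith [hα.1]
  have ht : 0 < t := lt_of_lt_of_le (by positivity) hrt
  set M := maximal μ (fun x => ‖f x‖ₑ) w with hM
  set A := closedBall y L \ closedBall y (2 * t) with hA
  have hAm : MeasurableSet A := measurableSet_closedBall.diff measurableSet_closedBall
  have hgi : Integrable (A.indicator f) μ := hf.indicator hAm
  have hgm : absMeasure μ (A.indicator f) = (absMeasure μ f).restrict A :=
    absMeasure_indicator f hAm
  have hdist : ∀ z ∈ A, dist z y / 2 ≤ dist z w ∧ 2 * t < dist z y ∧ dist z y ≤ L := by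
    intro z hz
    have h1 := hz.1
    have h2 := hz.2
    rw [mem_closedBall] at h1 h2
    have := dist_triangle z w y
    exact ⟨by linarith, by linarith, h1⟩
  -- For `i ≥ 1` the average is taken over a ball whose fivefold enlargement lies in the ball of
  -- radius `L / 100^(i-1)`. Only `i - 1` non-doubling steps are then available, which accounts for
  -- the extra factor `b`.
  have hball : ∀ i < k, absMeasure μ f (closedBall y (L / 100 ^ i)) ≤
      M * ENNReal.ofReal (C₀ * 10 ^ m * b) * ENNReal.ofReal (L ^ m * b⁻¹ ^ i) := by
    intro i hi
    have hwi : w ∈ ball y (L / 100 ^ i) := by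
      rw [mem_ball]
      have h1 : L / 100 ^ k ≤ L / 100 ^ (i + 1) := by
        gcongr
        · norm_num
        · omega
      have h2 : L / 100 ^ i = 100 * (L / 100 ^ (i + 1)) := by field_simp; ring
      have h3 : 0 < L / 100 ^ (i + 1) := by positivity
      linarith
    rcases Nat.eq_zero_or_pos i with rfl | hi0
    · refine (absMeasure_closedBall_le hE hμ f hy hwi).trans ?_
      rw [mul_assoc M, ← ENNReal.ofReal_mul (by positivity)]
      refine mul_le_mul' le_rfl (ENNReal.ofReal_le_ofReal ?_)
      simp only [pow_zero, div_one, mul_one]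
      have : C₀ * 10 ^ m * L ^ m * 1 ≤ C₀ * 10 ^ m * L ^ m * b := by gcongr
      linarith
    · obtain ⟨j, rfl⟩ : ∃ j, i = j + 1 := ⟨i - 1, by omega⟩
      rw [absMeasure_apply _ measurableSet_closedBall]
      refine (lintegral_closedBall_le_maximal _ hwi).trans ?_
      rw [mul_assoc, ← ENNReal.ofReal_mul (by positivity)]
      gcongr
      have h1 := measure_closedBall_div_le_of_not_doubling (μ := μ) (y := y) (D := L) hb0 (k := j)
        fun i h1 h2 => hdoub i h1 (by omega)
      calc μ (closedBall y (5 * (L / 100 ^ (j + 1)))) ≤ μ (closedBall y (L / 100 ^ j)) := by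
            refine measure_mono (closedBall_subset_closedBall ?_)
            have : L / 100 ^ j = 100 * (L / 100 ^ (j + 1)) := by field_simp; ring
            have h3 : 0 < L / 100 ^ (j + 1) := by positivity
            linarith
        _ ≤ ENNReal.ofReal (b⁻¹ ^ j) * μ (closedBall y L) := h1
        _ ≤ ENNReal.ofReal (b⁻¹ ^ j) * ENNReal.ofReal (C₀ * 2 ^ m * L ^ m) := by
            gcongr
            exact hμ.measure_closedBall_le hy hL
        _ ≤ _ := by
            rw [← ENNReal.ofReal_mul (by positivity)]
            apply ENNReal.ofReal_le_ofReal
            have h10 : (2:ℝ) ^ m ≤ 10 ^ m := by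
              apply Real.rpow_le_rpow <;> linarith
            calc b⁻¹ ^ j * (C₀ * 2 ^ m * L ^ m) ≤ b⁻¹ ^ j * (C₀ * 10 ^ m * L ^ m) := by gcongr
              _ = _ := by rw [pow_succ]; field_simp
  -- This is where `m ≤ n` and `b ≥ 100^(n+1)` make the series over the scales geometric.
  have hq : (100:ℝ) ^ m * b⁻¹ ≤ 1 / 2 := by
    rw [← div_eq_mul_inv, div_le_iff₀ hb0]
    have h1 : (100:ℝ) ^ m ≤ 100 ^ n := by
      rw [← Real.rpow_natCast]
      exact Real.rpow_le_rpow_of_exponent_le (by norm_num) hmn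
    have h2 : (100:ℝ) ^ (n + 1) = 100 * 100 ^ n := by ring
    have h3 : (0:ℝ) < 100 ^ n := by positivity
    linarith
  have hann := lintegral_annuli_le hm (inv_pos.2 hb0) hq (absMeasure μ f) y hL k _ hball
  refine (hC₁ E hE ω hω inferInstance w (Kc • (absMeasure μ f).restrict A)
    (by unfold absMeasure; infer_instance) ?_ _ ?_).trans ?_
  · refine Measure.ae_smul_measure ?_ _
    filter_upwards [ae_restrict_mem hAm] with z hz
    have := hdist z hz
    linarith
  · intro x hx
    rw [lintegral_smul_measure, ← hgm]
    exact enorm_integralOp_le hE hS hmα hK hgi.1 hx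
  · rw [lintegral_smul_measure, smul_eq_mul]
    calc _ ≤ C₁ * (Kc * ∫⁻ z in {z | L / 100 ^ k < dist z y ∧ dist z y ≤ L},
          ENNReal.ofReal (2 ^ m) * ENNReal.ofReal (dist z y ^ (-m)) ∂(absMeasure μ f)) := by
          refine mul_le_mul' le_rfl (mul_le_mul' le_rfl (le_trans
            (setLIntegral_mono' hAm fun z hz => ?_) (lintegral_mono_set fun z hz => ?_)))
          · have := hdist z hz
            rw [← ENNReal.ofReal_mul (by positivity)]
            apply ENNReal.ofReal_le_ofReal
            have hzy : 0 < dist z y := by linarith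
            calc dist z w ^ (-m) ≤ (dist z y / 2) ^ (-m) :=
                  Real.rpow_le_rpow_of_nonpos (by positivity) this.1 (by linarith)
              _ = _ := by
                  rw [Real.div_rpow hzy.le (by norm_num), Real.rpow_neg (x := 2) (by norm_num),
                    div_inv_eq_mul, mul_comm]
          · have := hdist z hz
            exact ⟨by linarith, this.2.2⟩
      _ ≤ C₁ * (Kc * (ENNReal.ofReal (2 ^ m) * (ENNReal.ofReal (2 * 100 ^ m) *
            (M * ENNReal.ofReal (C₀ * 10 ^ m * b))))) := by
          rw [lintegral_const_mul _ (by fun_prop)]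
          gcongr
      _ = _ := by ring

end ConicalSquare

/-! ### The good `λ` inequality. -/

namespace ConicalSquare

open Filter Topology

variable {n : ℕ} {E : Set (Rn n)} {m α β K₁ K₂ C₀ b κ θ A : ℝ} {S : Rn n → Rn n → ℂ}
  {μ : Measure (Rn n)}

theorem coneNorm_integralOp_congr (hE : IsClosed E) {ω : Measure (Rn n)} {f g : Rn n → ℂ}
    {w : Rn n} (h : ∀ x ∈ cone E w, integralOp E S μ f x = g x) :
    coneNorm ω E (integralOp E S μ f) w = coneNorm ω E g w := by
  rw [coneNorm, coneNorm]
  congr 1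
  refine setLIntegral_congr_fun (isOpen_cone hE w).measurableSet fun x hx => ?_
  rw [h x hx]

theorem coneNorm_integralOp_add_le (hE : IsClosed E) (hS : IsKernel E m α β K₁ K₂ S)
    (hmα : 0 < m + α) (hβ : 0 < β) (hK : 0 < K₁) {ω : Measure (Rn n)} (hω : ω ≤ coneWeight E α)
    {f g : Rn n → ℂ} (hf : Integrable f μ) (hg : Integrable g μ) (w : Rn n) :
    coneNorm ω E (integralOp E S μ fun z => f z + g z) w ≤
      coneNorm ω E (integralOp E S μ f) w + coneNorm ω E (integralOp E S μ g) w := by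
  have hωac : ω ≪ volume.restrict Eᶜ :=
    (Measure.absolutelyContinuous_of_le hω).trans coneWeight_absolutelyContinuous
  rw [coneNorm_integralOp_congr hE fun x hx => integralOp_add hE hS hmα hβ hK hf hg hx.1]
  exact coneNorm_add_le ω (aestronglyMeasurable_integralOp hE hS hmα hβ hK hf hωac)
    (aestronglyMeasurable_integralOp hE hS hmα hβ hK hg hωac) w

/-- The exceptional set of the good `λ` inequality has small measure in a good ball. -/
theorem measure_exceptional_inter_closedBall_le (hE : IsClosed E)
    (hS : IsKernel E m α β K₁ K₂ S) (hμE : μ Eᶜ = 0) [IsLocallyFiniteMeasure μ]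
    (hmα : 0 < m + α) (hβ : 0 < β) (hK : 0 < K₁) (hA : 0 < A) (hb : 0 < b) (hθ : θ ∈ Ioo (0 : ℝ) 1)
    {f : Rn n → ℂ} (hf : Integrable f μ) {t η γ : ℝ} (ht : 0 < t) (hη : 0 < η) (hγ : 0 < γ)
    (hγs : A * b * γ * (2 / η) ≤ θ / 2) {y : Rn n} {ρ : ℝ} (hρ : 0 < ρ) {Q : Set (Rn n)}
    (hQM : ∀ w ∈ Q, maximal μ (fun x => ‖f x‖ₑ) w ≤ ENNReal.ofReal (γ * t))
    (hQ : ∀ w ∈ E ∩ closedBall y ρ, w ∈ Q → ENNReal.ofReal (η / 2 * t) <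
      coneNorm (coneWeight E α) E (integralOp E S μ ((closedBall y (2 * ρ)).indicator f)) w)
    (hdbl : μ (closedBall y (10 * ρ)) ≤ ENNReal.ofReal b * μ (closedBall y ρ)) {G : Set (Rn n)}
    (hGm : MeasurableSet G) (hG : G ⊆ closedBall y ρ ∩ E)
    (hGθ : ENNReal.ofReal θ * μ (closedBall y ρ ∩ E) ≤ μ G)
    (hGA : IsDiscreteWeakBoundedOn E α S μ A G) :
    μ (Q ∩ closedBall y ρ) + ENNReal.ofReal (θ / 2) * μ (closedBall y ρ) ≤ μ (closedBall y ρ) := by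
  have hball : μ (closedBall y ρ ∩ E) = μ (closedBall y ρ) :=
    measure_inter_conull hμE
  rw [hball] at hGθ
  -- One exceptional point `w₁` suffices to control the mass of `f` on `B(y, 2ρ)` by `γt μ(B(y,
  -- 10ρ))`, and doubling returns to `μ(B(y, ρ))`. The doubling factor `10` is twice the `5` of the
  -- maximal function.
  by_cases hex : ∃ w₁ ∈ Q, w₁ ∈ closedBall y ρ
  · obtain ⟨w₁, hw₁Q, hw₁⟩ := hex
    set f' := (closedBall y (2 * ρ)).indicator f with hf'
    have hf'i : Integrable f' μ := hf.indicator measurableSet_closedBall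
    have h1 : ∫⁻ z, ‖f' z‖ₑ ∂μ ≤ ENNReal.ofReal (γ * t * b) * μ (closedBall y ρ) := by
      have e : ∫⁻ z, ‖f' z‖ₑ ∂μ = ∫⁻ z in closedBall y (2 * ρ), ‖f z‖ₑ ∂μ := by
        rw [hf', ← lintegral_indicator measurableSet_closedBall]
        simp_rw [enorm_indicator_eq_indicator_enorm]
      rw [e]
      refine (lintegral_closedBall_le_maximal (fun z => ‖f z‖ₑ)
        (w := w₁) (mem_ball.2 ((mem_closedBall.1 hw₁).trans_lt (by linarith)))).trans ?_
      rw [ENNReal.ofReal_mul (by positivity), mul_assoc, show 5 * (2 * ρ) = 10 * ρ by ring]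
      gcongr
      exact hQM w₁ hw₁Q
    have h2 := hGA.measure_le hE hS hmα hβ hK hf'i (t := η / 2 * t) (by positivity)
    have h3 : μ {w ∈ G | ENNReal.ofReal (η / 2 * t) <
        coneNorm (coneWeight E α) E (integralOp E S μ f') w} ≤
          ENNReal.ofReal (θ / 2) * μ (closedBall y ρ) := by
      refine h2.trans ((mul_le_mul' le_rfl h1).trans ?_)
      rw [← mul_assoc, ← ENNReal.ofReal_mul (by positivity)]
      gcongr
      refine le_trans (le_of_eq ?_) hγs
      field_simp
    have h4 : Q ∩ closedBall y ρ ⊆ (Eᶜ ∪ (closedBall y ρ \ G)) ∪ {w ∈ G | ENNReal.ofReal (η / 2 * t) <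
        coneNorm (coneWeight E α) E (integralOp E S μ f') w} := by
      intro w hw
      by_cases hwE : w ∈ E
      · by_cases hwG : w ∈ G
        · exact Or.inr ⟨hwG, hQ w ⟨hwE, hw.2⟩ hw.1⟩
        · exact Or.inl (Or.inr ⟨hw.2, hwG⟩)
      · exact Or.inl (Or.inl hwE)
    have h5 : μ (Q ∩ closedBall y ρ) ≤
        μ (closedBall y ρ \ G) + ENNReal.ofReal (θ / 2) * μ (closedBall y ρ) := by
      refine (measure_mono h4).trans ((measure_union_le _ _).trans (add_le_add ?_ h3))
      refine (measure_union_le _ _).trans ?_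
      rw [hμE, zero_add]
    calc _ ≤ (μ (closedBall y ρ \ G) + ENNReal.ofReal (θ / 2) * μ (closedBall y ρ)) +
          ENNReal.ofReal (θ / 2) * μ (closedBall y ρ) := add_le_add h5 le_rfl
      _ = μ (closedBall y ρ \ G) + ENNReal.ofReal θ * μ (closedBall y ρ) := by
          rw [add_assoc, ← add_mul, ← ENNReal.ofReal_add (by linarith [hθ.1]) (by linarith [hθ.1]),
            add_halves]
      _ ≤ μ (closedBall y ρ \ G) + μ (closedBall y ρ ∩ G) := by
          gcongr
          rwa [inter_eq_right.2 (hG.trans inter_subset_left)]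
      _ = _ := by rw [add_comm, measure_inter_add_sdiff _ hGm]
  · have : Q ∩ closedBall y ρ = ∅ := by
      ext w
      simp only [mem_inter_iff, mem_empty_iff_false, iff_false, not_and]
      exact fun h1 h2 => hex ⟨w, h1, h2⟩
    rw [this, measure_empty, zero_add]
    exact mul_le_of_le_one_left' (by
      rw [ENNReal.ofReal_le_one]; linarith [hθ.2])

/-- Existence of the good balls for the good `λ` inequality. -/
theorem exists_good_ball (n : ℕ) (hm : 0 < m) (hα : α ∈ Ioc (0 : ℝ) 1) (hβ : 0 < β) (hK : 0 < K₁)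
    (hC₀ : 0 < C₀) (hmn : m ≤ n) (hb : 100 ^ (n + 1) ≤ b) (hκ : 21 ≤ κ) :
    ∃ C : ℝ≥0, ∀ (E : Set (Rn n)) (S : Rn n → Rn n → ℂ) (μ : Measure (Rn n)), IsClosed E →
      IsKernel E m α β K₁ K₂ S → IsOfOrder E m C₀ μ → ∀ ω ≤ coneWeight E α, SFinite ω →
      ∀ f : Rn n → ℂ, Integrable f μ → ∀ t η γ R' : ℝ, 0 < t → 0 < η → 0 < γ → C * γ ≤ η / 2 →
      (∀ w ∈ E, R' < dist w 0 → coneNorm ω E (integralOp E S μ f) w ≤ ENNReal.ofReal t) →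
      ∃ Rmax : ℝ, ∀ᵐ y ∂μ, y ∈ E → ENNReal.ofReal t < coneNorm ω E (integralOp E S μ f) y →
        ∃ ρ : ℝ, 0 < ρ ∧ ρ ≤ Rmax ∧ IsDoublingBall μ 10 b y ρ ∧ HasSmallBoundary μ κ y ρ ∧
          (∀ w ∈ E ∩ closedBall y ρ, ENNReal.ofReal t < coneNorm ω E (integralOp E S μ f) w) ∧
          ∀ w ∈ E ∩ closedBall y ρ, maximal μ (fun x => ‖f x‖ₑ) w ≤ ENNReal.ofReal (γ * t) →
            ENNReal.ofReal ((1 + η) * t) < coneNorm ω E (integralOp E S μ f) w →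
            ENNReal.ofReal (η / 2 * t) < coneNorm (coneWeight E α) E
              (integralOp E S μ ((closedBall y (2 * ρ)).indicator f)) w := by
  obtain ⟨C₁, hC₁⟩ := exists_far_le (K₂ := K₂) n hm hα hβ hK hC₀
  obtain ⟨C₂, hC₂⟩ := exists_ring_le (β := β) (K₂ := K₂) n hm hα hK hC₀ hmn hb
  refine ⟨C₁ + C₂, ?_⟩
  intro E S μ hE hS hμ ω hω _ f hf t η γ R' ht hη hγ hCγ hR'
  have := hμ.isLocallyFiniteMeasure hE
  have hmα : 0 < m + α := by linarith [hα.1]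
  set u := coneNorm ω E (integralOp E S μ f) with hu
  set U := {y | ENNReal.ofReal t < u y} with hU
  have hUo : IsOpen U := (lowerSemicontinuous_coneNorm ω _).isOpen_preimage _
  -- the scale attached to a point
  have hscale : ∃ Lmax : ℝ, ∀ y ∈ E, y ∈ U → ∃ L : ℝ, 0 < L ∧ L ≤ Lmax ∧
      (∀ w ∈ E ∩ closedBall y (L / 2), w ∈ U) ∧
      ∀ w ∈ E ∩ closedBall y (L / 2),
        coneNorm ω E (integralOp E S μ ((closedBall y L)ᶜ.indicator f)) w ≤
          ENNReal.ofReal t + C₁ * maximal μ (fun x => ‖f x‖ₑ) w := by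
    have hyR : ∀ y ∈ E, y ∈ U → dist y 0 ≤ R' := fun y hy hyU => by
      by_contra hcon
      exact absurd hyU (not_lt.2 (hR' y hy (not_le.1 hcon)))
    rcases (E \ U).eq_empty_or_nonempty with hEU | ⟨x₁, hx₁⟩
    -- Without a comparison point, `E` lies in the ball of radius `R'` about the origin. The radius
    -- `2R' + 1` then makes the far part vanish on `E`.
    · have hEU' : E ⊆ U := sdiff_eq_empty.1 hEU
      refine ⟨2 * R' + 1, fun y hy hyU => ⟨2 * R' + 1, ?_, le_rfl, fun w hw => hEU' hw.1, ?_⟩⟩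
      · linarith [hyR y hy hyU, dist_nonneg (x := y) (y := 0)]
      · intro w hw
        have : integralOp E S μ ((closedBall y (2 * R' + 1))ᶜ.indicator f) = fun _ => 0 := by
          ext x
          refine setIntegral_eq_zero_of_forall_eq_zero fun z hz => ?_
          rw [indicator_of_notMem, mul_zero]
          rw [notMem_compl_iff, mem_closedBall]
          have h1 := hyR z hz (hEU' hz)
          have h2 := hyR y hy hyU
          have h3 := dist_triangle_right z y 0
          linarith
        rw [this, coneNorm]
        simp
    · have hcl : IsClosed (E \ U) := hE.sdiff hUo
      refine ⟨R' + dist x₁ 0, fun y hy hyU => ?_⟩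
      obtain ⟨x₀, hx₀, hyx₀⟩ := hcl.exists_infDist_eq_dist ⟨x₁, hx₁⟩ y
      -- The ball `B(y, L/2)` is well inside the distance `10L` from `y` to `E \ U`, so its points
      -- in `E` belong to `U`, and `x₀` is a closest point where `u ≤ t`.
      set L := dist y x₀ / 10 with hL
      have hpos : 0 < dist y x₀ := dist_pos.2 fun h => hx₀.2 (h ▸ hyU)
      have hL0 : 0 < L := by positivity
      refine ⟨L, hL0, ?_, ?_, ?_⟩
      · have h1 : dist y x₀ ≤ dist y x₁ := by
          rw [← hyx₀]; exact infDist_le_dist_of_mem hx₁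
        have h2 := dist_triangle_right y x₁ 0
        have h3 := hyR y hy hyU
        linarith
      · intro w hw
        by_contra hwU
        have h1 : infDist y (E \ U) ≤ dist y w := infDist_le_dist_of_mem ⟨hw.1, hwU⟩
        have h2 := hw.2
        rw [mem_closedBall, dist_comm] at h2
        linarith
      · intro w hw
        refine (hC₁ E S μ hE hS hμ ω hω f hf y hy w hw.1 x₀ hx₀.1 L hL0 hw.2
          (by rw [hL]; ring)).trans ?_
        gcongr
        exact not_lt.1 hx₀.2
  obtain ⟨Lmax, hLmax⟩ := hscale
  refine ⟨Lmax, ?_⟩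
  filter_upwards [ae_exists_doubling (μ := μ) hb] with y hydb hy hyU
  obtain ⟨L, hL0, hLle, hLU, hLfar⟩ := hLmax y hy hyU
  have hex := hydb L hL0
  classical
  -- The largest scale `r = L / 100^k`, `k ≥ 1`, for which `B(y, 100r)` has measure at most `b
  -- μ(B(y, r))`. All earlier scales fail, as the estimate of the intermediate part requires. The
  -- factor `100` leaves room to move to `ρ ∈ [r, 2r]` with small boundary and keep `(10,
  -- b)`-doubling.
  set k := Nat.find hex with hk
  obtain ⟨hk1, hkd⟩ := Nat.find_spec hex
  rw [← hk] at hk1 hkd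
  set r := L / 100 ^ k with hr
  have hr0 : 0 < r := by positivity
  have hrL : r ≤ L / 100 := by
    rw [hr]
    gcongr
    exact le_self_pow₀ (by norm_num) (by omega)
  obtain ⟨ρ, hρ, hsb⟩ := exists_hasSmallBoundary (μ := μ) hκ y hr0
  have hρ0 : 0 < ρ := hr0.trans_le hρ.1
  have hρL : 2 * ρ ≤ L / 2 := by linarith [hρ.2]
  have hsub : closedBall y ρ ⊆ closedBall y (L / 2) := closedBall_subset_closedBall (by linarith)
  refine ⟨ρ, hρ0, by linarith, ?_, hsb, fun w hw => hLU w ⟨hw.1, hsub hw.2⟩, ?_⟩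
  · rw [IsDoublingBall]
    calc μ (closedBall y (10 * ρ)) ≤ μ (closedBall y (100 * r)) :=
          measure_mono (closedBall_subset_closedBall (by linarith [hρ.2]))
      _ ≤ ENNReal.ofReal b * μ (closedBall y r) := hkd
      _ ≤ _ := mul_le_mul' le_rfl (measure_mono (closedBall_subset_closedBall hρ.1))
  · intro w hw hwM hwu
    set M := maximal μ (fun x => ‖f x‖ₑ) w with hM
    by_contra hcon
    have hcon' := not_lt.1 hcon
    refine absurd hwu (not_lt.2 ?_)
    set f₁ := (closedBall y (2 * ρ)).indicator f with hf₁
    set f₂ := (closedBall y L \ closedBall y (2 * ρ)).indicator f with hf₂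
    set f₃ := (closedBall y L)ᶜ.indicator f with hf₃
    have hi₁ : Integrable f₁ μ := hf.indicator measurableSet_closedBall
    have hi₂ : Integrable f₂ μ :=
      hf.indicator (measurableSet_closedBall.diff measurableSet_closedBall)
    have hi₃ : Integrable f₃ μ := hf.indicator measurableSet_closedBall.compl
    have hsplit : f = fun z => f₁ z + (f₂ z + f₃ z) := by
      ext z
      have hss : closedBall y (2 * ρ) ⊆ closedBall y L := closedBall_subset_closedBall (by linarith)
      by_cases h1 : z ∈ closedBall y (2 * ρ)
      · have h2 := hss h1
        simp only [hf₁, hf₂, hf₃]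
        rw [indicator_of_mem h1, indicator_of_notMem
          (show z ∉ closedBall y L \ closedBall y (2 * ρ) from fun h => h.2 h1),
          indicator_of_notMem (show z ∉ (closedBall y L)ᶜ from fun h => h h2)]
        simp
      · by_cases h2 : z ∈ closedBall y L
        · simp only [hf₁, hf₂, hf₃]
          rw [indicator_of_notMem h1, indicator_of_mem
            (show z ∈ closedBall y L \ closedBall y (2 * ρ) from ⟨h2, h1⟩),
            indicator_of_notMem (show z ∉ (closedBall y L)ᶜ from fun h => h h2)]
          simp
        · simp only [hf₁, hf₂, hf₃]
          rw [indicator_of_notMem h1, indicator_of_notMem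
            (show z ∉ closedBall y L \ closedBall y (2 * ρ) from fun h => h2 h.1),
            indicator_of_mem (show z ∈ (closedBall y L)ᶜ from h2)]
          simp
    have hring : coneNorm ω E (integralOp E S μ f₂) w ≤ C₂ * M := by
      refine hC₂ E S μ hE hS hμ ω hω inferInstance f hf y hy w hw.1 L ρ k hL0 hρ.1 hρ.2 hw.2 ?_
      intro i hi hik
      have := Nat.find_min hex (hk ▸ hik)
      simp only [not_and, not_le] at this
      exact (this hi).le
    have hloc : coneNorm ω E (integralOp E S μ f₁) w ≤ ENNReal.ofReal (η / 2 * t) :=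
      -- The local part is measured with the full weight, since the hypothesis on the pieces
      -- concerns the untruncated square function.
      (coneNorm_mono_measure hω _ _).trans hcon'
    have hfar := hLfar w ⟨hw.1, hsub hw.2⟩
    have hCM : (C₁ : ℝ≥0∞) * M + C₂ * M ≤ ENNReal.ofReal (η / 2 * t) := by
      rw [← add_mul, ← ENNReal.coe_add]
      refine (mul_le_mul' le_rfl hwM).trans ?_
      rw [← ENNReal.ofReal_coe_nnreal, ← ENNReal.ofReal_mul (by positivity)]
      apply ENNReal.ofReal_le_ofReal
      calc ((C₁ + C₂ : ℝ≥0) : ℝ) * (γ * t) = ((C₁ + C₂ : ℝ≥0) : ℝ) * γ * t := by ring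
        _ ≤ _ := by gcongr
    calc u w = coneNorm ω E (integralOp E S μ fun z => f₁ z + (f₂ z + f₃ z)) w := by
          rw [hu, ← hsplit]
      _ ≤ coneNorm ω E (integralOp E S μ f₁) w + (coneNorm ω E (integralOp E S μ f₂) w +
            coneNorm ω E (integralOp E S μ f₃) w) := by
          refine (coneNorm_integralOp_add_le hE hS hmα hβ hK hω hi₁ (hi₂.add hi₃) w).trans ?_
          gcongr
          exact coneNorm_integralOp_add_le hE hS hmα hβ hK hω hi₂ hi₃ w
      _ ≤ ENNReal.ofReal (η / 2 * t) + (C₂ * M + (ENNReal.ofReal t + C₁ * M)) := by gcongr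
      _ = ENNReal.ofReal (η / 2 * t) + ENNReal.ofReal t + (C₁ * M + C₂ * M) := by ring
      _ ≤ ENNReal.ofReal (η / 2 * t) + ENNReal.ofReal t + ENNReal.ofReal (η / 2 * t) := by gcongr
      _ = _ := by
          rw [← ENNReal.ofReal_add (by positivity) (by positivity),
            ← ENNReal.ofReal_add (by positivity) (by positivity)]
          congr 1; ring

/-- The good `λ` inequality. -/
theorem exists_goodLambda (n : ℕ) (hm : 0 < m) (hα : α ∈ Ioc (0 : ℝ) 1) (hβ : 0 < β) (hK : 0 < K₁)
    (hC₀ : 0 < C₀) (hmn : m ≤ n) (hb : 100 ^ (n + 1) ≤ b) (hκ : 21 ≤ κ)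
    (hθ : θ ∈ Ioo (0 : ℝ) 1) (hA : 0 < A) {η : ℝ} (hη : 0 < η) :
    ∃ γ : ℝ, 0 < γ ∧ ∀ (E : Set (Rn n)) (S : Rn n → Rn n → ℂ) (μ : Measure (Rn n)), IsClosed E →
      IsKernel E m α β K₁ K₂ S → IsOfOrder E m C₀ μ →
      HasBigPieces E μ b κ θ (IsDiscreteWeakBoundedOn E α S μ A) →
      ∀ ω ≤ coneWeight E α, SFinite ω → ∀ f : Rn n → ℂ, Integrable f μ →
      (∀ t > 0, ∃ R', ∀ w ∈ E, R' < dist w 0 →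
        coneNorm ω E (integralOp E S μ f) w ≤ ENNReal.ofReal t) → ∀ t : ℝ, 0 < t →
      μ {w | ENNReal.ofReal ((1 + η) * t) < coneNorm ω E (integralOp E S μ f) w ∧
          maximal μ (fun x => ‖f x‖ₑ) w ≤ ENNReal.ofReal (γ * t)} +
        ENNReal.ofReal (θ / (2 * b)) *
          μ {w | ENNReal.ofReal t < coneNorm ω E (integralOp E S μ f) w} ≤
        μ {w | ENNReal.ofReal t < coneNorm ω E (integralOp E S μ f) w} := by
  obtain ⟨C, hC⟩ := exists_good_ball (K₂ := K₂) n hm hα hβ hK hC₀ hmn hb hκ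
  have hb1 : 1 ≤ b := le_trans (one_le_pow₀ (by norm_num)) hb
  have hb0 : 0 < b := by linarith
  have hθ0 := hθ.1
  -- The first bound keeps the errors of the far and intermediate parts below `ηt/2`; the second
  -- makes the weak type estimate on the piece at most `θ/2` of the ball.
  set γ := min (η / 2 / (C + 1)) (θ / 2 / (A * b * (2 / η))) with hγdef
  have hγ : 0 < γ := lt_min (by positivity) (by positivity)
  have hγ1 : C * γ ≤ η / 2 := by
    have h1 : γ ≤ η / 2 / (C + 1) := min_le_left _ _
    rw [le_div_iff₀ (by positivity)] at h1
    nlinarith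
  have hγ2 : A * b * γ * (2 / η) ≤ θ / 2 := by
    have h1 : γ ≤ θ / 2 / (A * b * (2 / η)) := min_le_right _ _
    rw [le_div_iff₀ (by positivity)] at h1
    linarith
  refine ⟨γ, hγ, ?_⟩
  intro E S μ hE hS hμ hbig ω hω _ f hf hdec t ht
  have := hμ.isLocallyFiniteMeasure hE
  have hmα : 0 < m + α := by linarith [hα.1]
  obtain ⟨R', hR'⟩ := hdec t ht
  obtain ⟨Rmax, hRmax⟩ := hC E S μ hE hS hμ ω hω inferInstance f hf t η γ R' ht hη hγ hγ1 hR'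
  set u := coneNorm ω E (integralOp E S μ f) with hu
  set U := {w | ENNReal.ofReal t < u w} with hU
  set Q := {w | ENNReal.ofReal ((1 + η) * t) < u w ∧
    maximal μ (fun x => ‖f x‖ₑ) w ≤ ENNReal.ofReal (γ * t)} with hQ
  have hQU : Q ⊆ U := fun w hw => lt_of_le_of_lt
    (ENNReal.ofReal_le_ofReal (by nlinarith)) hw.1
  set T := {y | y ∈ E ∧ ∃ ρ : ℝ, 0 < ρ ∧ ρ ≤ Rmax ∧ IsDoublingBall μ 10 b y ρ ∧
    HasSmallBoundary μ κ y ρ ∧ (∀ w ∈ E ∩ closedBall y ρ, ENNReal.ofReal t < u w) ∧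
    ∀ w ∈ E ∩ closedBall y ρ, maximal μ (fun x => ‖f x‖ₑ) w ≤ ENNReal.ofReal (γ * t) →
      ENNReal.ofReal ((1 + η) * t) < u w →
      ENNReal.ofReal (η / 2 * t) < coneNorm (coneWeight E α) E
        (integralOp E S μ ((closedBall y (2 * ρ)).indicator f)) w} with hT
  have hUT : μ (U \ T) = 0 := by
    have hEae : ∀ᵐ y ∂μ, y ∈ E := by rw [ae_iff]; exact hμ.1
    have : ∀ᵐ y ∂μ, ¬ (y ∈ U \ T) := by
      filter_upwards [hRmax, hEae] with y h1 h2 h3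
      exact h3.2 ⟨h2, h1 h2 h3.1⟩
    rw [ae_iff] at this
    simp only [not_not] at this
    exact this
  choose! hTE ρ hρ0 hρR hdb hsb hsubU hloc using fun y (hy : y ∈ T) => hy
  obtain ⟨v, hvT, hdisj, hv⟩ := Vitali.exists_disjoint_subfamily_covering_enlargement_closedBall
    T (fun y => y) ρ Rmax hρR 5 (by norm_num)
  have hcount : v.Countable := by
    refine hdisj.countable_of_nonempty_interior fun y hy => ?_
    exact ⟨y, ball_subset_interior_closedBall (mem_ball_self (hρ0 y (hvT hy)))⟩
  set B := ⋃ y ∈ v, closedBall y (ρ y) with hB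
  have hBm : MeasurableSet B := .biUnion hcount fun y _ => measurableSet_closedBall
  have hBsum : μ B = ∑' y : v, μ (closedBall (y : Rn n) (ρ y)) :=
    measure_biUnion hcount hdisj fun y _ => measurableSet_closedBall
  -- The fivefold balls cover `U` up to a null set, and doubling bounds each of them by `b` times
  -- the original ball.
  have h1 : μ U ≤ ENNReal.ofReal b * μ B := by
    have hsub : U ⊆ (U \ T) ∪ ⋃ y ∈ v, closedBall y (5 * ρ y) := by
      intro y hy
      by_cases hyT : y ∈ T
      · obtain ⟨y', hy', hyy'⟩ := hv y hyT
        refine Or.inr (mem_biUnion hy' (hyy' (mem_closedBall_self (hρ0 y hyT).le)))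
      · exact Or.inl ⟨hy, hyT⟩
    calc μ U ≤ μ (U \ T) + μ (⋃ y ∈ v, closedBall y (5 * ρ y)) :=
          (measure_mono hsub).trans (measure_union_le _ _)
      _ = μ (⋃ y ∈ v, closedBall y (5 * ρ y)) := by rw [hUT, zero_add]
      _ ≤ ∑' y : v, μ (closedBall (y : Rn n) (5 * ρ y)) := measure_biUnion_le _ hcount _
      _ ≤ ∑' y : v, ENNReal.ofReal b * μ (closedBall (y : Rn n) (ρ y)) := by
          refine ENNReal.tsum_le_tsum fun y => ?_
          refine (measure_mono (closedBall_subset_closedBall ?_)).trans (hdb y (hvT y.2))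
          linarith [hρ0 y (hvT y.2)]
      _ = _ := by rw [ENNReal.tsum_mul_left, hBsum]
  -- The balls are disjoint, so the estimates in the single balls add up. Together with `h1` this
  -- gives the proportion `θ / (2b)` of `U`.
  have h2 : μ (Q ∩ B) + ENNReal.ofReal (θ / 2) * μ B ≤ μ B := by
    have hQB : μ (Q ∩ B) ≤ ∑' y : v, μ (Q ∩ closedBall (y : Rn n) (ρ y)) := by
      rw [hB, inter_iUnion₂]
      exact measure_biUnion_le _ hcount _
    calc _ ≤ (∑' y : v, μ (Q ∩ closedBall (y : Rn n) (ρ y))) +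
          ENNReal.ofReal (θ / 2) * μ B := by gcongr
      _ = ∑' y : v, (μ (Q ∩ closedBall (y : Rn n) (ρ y)) +
            ENNReal.ofReal (θ / 2) * μ (closedBall (y : Rn n) (ρ y))) := by
          rw [hBsum, ← ENNReal.tsum_mul_left, ENNReal.tsum_add]
      _ ≤ ∑' y : v, μ (closedBall (y : Rn n) (ρ y)) := by
          refine ENNReal.tsum_le_tsum fun y => ?_
          have hy := hvT y.2
          obtain ⟨G, hGm, hG, hGθ, hGA⟩ := hbig y (hTE y hy) (ρ y) (hρ0 y hy) (hdb y hy) (hsb y hy)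
          exact measure_exceptional_inter_closedBall_le hE hS hμ.1 hmα hβ hK hA hb0 hθ hf ht hη hγ hγ2
            (hρ0 y hy) (fun w hw => hw.2) (fun w hw hwQ => hloc y hy w hw hwQ.2 hwQ.1)
            (hdb y hy) hGm hG hGθ hGA
      _ = μ B := hBsum.symm
  have h3 : μ B ≤ μ (U ∩ B) := by
    rw [← measure_inter_conull (s := B) hμ.1]
    refine measure_mono fun w hw => ⟨?_, hw.1⟩
    obtain ⟨y, hy, hwy⟩ := mem_iUnion₂.1 hw.1
    exact hsubU y (hvT hy) w ⟨hw.2, hwy⟩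
  calc _ ≤ (μ (Q ∩ B) + μ (U \ B)) + ENNReal.ofReal (θ / 2) * μ B := by
        refine add_le_add ?_ ?_
        · refine (measure_mono fun w hw => ?_).trans (measure_union_le (Q ∩ B) (U \ B))
          by_cases hwB : w ∈ B
          · exact Or.inl ⟨hw, hwB⟩
          · exact Or.inr ⟨hQU hw, hwB⟩
        · calc _ ≤ ENNReal.ofReal (θ / (2 * b)) * (ENNReal.ofReal b * μ B) :=
              mul_le_mul' le_rfl h1
            _ = _ := by
              rw [← mul_assoc, ← ENNReal.ofReal_mul (by positivity)]
              congr 2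
              field_simp
    _ = (μ (Q ∩ B) + ENNReal.ofReal (θ / 2) * μ B) + μ (U \ B) := by ring
    _ ≤ μ (U ∩ B) + μ (U \ B) := by
        gcongr
        exact h2.trans h3
    _ = _ := measure_inter_add_sdiff _ hBm

end ConicalSquare

/-! ### From distribution inequalities to `L^p`; finiteness of truncated square functions. -/

namespace ConicalSquare

open Filter Topology

variable {n : ℕ} {E : Set (Rn n)} {m α β K₁ K₂ C₀ b κ θ A : ℝ} {S : Rn n → Rn n → ℂ}
  {μ : Measure (Rn n)}

/-! ### Integrating a good `λ` inequality -/

theorem lintegral_rpow_eq_layercake {X : Type*} [MeasurableSpace X] {μ : Measure X} {F : X → ℝ≥0∞}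
    (hF : Measurable F) (hfin : ∀ x, F x ≠ ∞) {p a : ℝ} (hp : 0 < p) (ha : 0 < a) :
    ENNReal.ofReal (a ^ (-p)) * ∫⁻ x, F x ^ p ∂μ = ENNReal.ofReal p *
      ∫⁻ t in Ioi 0, μ {x | ENNReal.ofReal (a * t) < F x} * ENNReal.ofReal (t ^ (p - 1)) := by
  have h := lintegral_rpow_eq_lintegral_meas_lt_mul μ (f := fun x => a⁻¹ * (F x).toReal)
    (Eventually.of_forall fun x => by positivity) (by fun_prop) hp
  rw [← lintegral_const_mul _ (by fun_prop)]
  convert h using 1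
  · refine lintegral_congr fun x => ?_
    rw [Real.mul_rpow (by positivity) ENNReal.toReal_nonneg, ENNReal.ofReal_mul (by positivity),
      Real.inv_rpow ha.le, ← Real.rpow_neg ha.le,
      ← ENNReal.ofReal_rpow_of_nonneg ENNReal.toReal_nonneg hp.le, ENNReal.ofReal_toReal (hfin x)]
  · congr 1
    refine setLIntegral_congr_fun measurableSet_Ioi fun t ht => ?_
    congr 2
    ext x
    simp only [Set.mem_ofPred_eq]
    rw [ENNReal.ofReal_lt_iff_lt_toReal (mul_nonneg ha.le (mem_Ioi.1 ht).le) (hfin x),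
      inv_mul_eq_div, lt_div_iff₀ ha, mul_comm]

/-- Integrating against `p t^(p-1) dt` gives `(1+η)^(-p) I + c I ≤ I + γ^(-p) ∫ M^p`. Since
`(1+η)^(-p) ≥ 1 - c/2`, a term `(c/2) I` survives after cancelling `I`, which is legitimate only
because `I` is finite. -/
theorem lintegral_rpow_le_of_goodLambda {X : Type*} [MeasurableSpace X] {μ : Measure X}
    {u M : X → ℝ≥0∞} (hu : Measurable u) (hufin : ∀ x, u x ≠ ∞) (hM : Measurable M)
    (hMfin : ∀ x, M x ≠ ∞) {p η γ c : ℝ} (hp : 0 < p) (hη : 0 < η) (hγ : 0 < γ) (hc : 0 < c)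
    (hηc : 1 - c / 2 ≤ (1 + η) ^ (-p)) (hc2 : c ≤ 2)
    (h : ∀ t : ℝ, 0 < t → μ {x | ENNReal.ofReal ((1 + η) * t) < u x ∧
        M x ≤ ENNReal.ofReal (γ * t)} + ENNReal.ofReal c * μ {x | ENNReal.ofReal t < u x} ≤
      μ {x | ENNReal.ofReal t < u x})
    (hI : ∫⁻ x, u x ^ p ∂μ ≠ ∞) :
    ∫⁻ x, u x ^ p ∂μ ≤ ENNReal.ofReal (2 / c * γ ^ (-p)) * ∫⁻ x, M x ^ p ∂μ := by
  set I := ∫⁻ x, u x ^ p ∂μ with hIdef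
  have hanti : ∀ (F : X → ℝ≥0∞) (a : ℝ), 0 < a →
      Measurable fun t : ℝ => μ {x | ENNReal.ofReal (a * t) < F x} * ENNReal.ofReal (t ^ (p - 1)) := by
    intro F a ha
    refine Measurable.mul (Antitone.measurable fun s t hst => measure_mono fun x hx => ?_)
      (by fun_prop)
    exact lt_of_le_of_lt (ENNReal.ofReal_le_ofReal (by gcongr)) hx
  have h1 := lintegral_rpow_eq_layercake (μ := μ) hu hufin hp (show 0 < 1 + η by linarith)
  have h2 := lintegral_rpow_eq_layercake (μ := μ) hu hufin hp one_pos
  have h3 := lintegral_rpow_eq_layercake (μ := μ) hM hMfin hp hγ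
  rw [Real.one_rpow, ENNReal.ofReal_one, one_mul] at h2
  have key : ENNReal.ofReal ((1 + η) ^ (-p)) * I + ENNReal.ofReal c * I ≤
      I + ENNReal.ofReal (γ ^ (-p)) * ∫⁻ x, M x ^ p ∂μ := by
    rw [← hIdef] at h2
    rw [h1, h3, h2, mul_left_comm (ENNReal.ofReal c), ← mul_add, ← mul_add, ← lintegral_const_mul _ (hanti _ _ one_pos),
      ← lintegral_add_left (hanti _ _ (by linarith)), ← lintegral_add_left (hanti _ _ one_pos)]
    refine mul_le_mul' le_rfl (setLIntegral_mono' measurableSet_Ioi fun t ht => ?_)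
    rw [← mul_assoc, ← add_mul, ← add_mul, one_mul]
    refine mul_le_mul' ?_ le_rfl
    have ht' := h t ht
    calc _ ≤ (μ {x | ENNReal.ofReal ((1 + η) * t) < u x ∧ M x ≤ ENNReal.ofReal (γ * t)} +
          μ {x | ENNReal.ofReal (γ * t) < M x}) +
          ENNReal.ofReal c * μ {x | ENNReal.ofReal t < u x} := by
          refine add_le_add ((measure_mono fun x hx => ?_).trans (measure_union_le _ _)) le_rfl
          rcases le_or_gt (M x) (ENNReal.ofReal (γ * t)) with hx' | hx'
          · exact Or.inl ⟨hx, hx'⟩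
          · exact Or.inr hx'
      _ = (μ {x | ENNReal.ofReal ((1 + η) * t) < u x ∧ M x ≤ ENNReal.ofReal (γ * t)} +
          ENNReal.ofReal c * μ {x | ENNReal.ofReal t < u x}) +
          μ {x | ENNReal.ofReal (γ * t) < M x} := by ring
      _ ≤ _ := add_le_add ht' le_rfl
  have key2 : I + ENNReal.ofReal (c / 2) * I ≤
      I + ENNReal.ofReal (γ ^ (-p)) * ∫⁻ x, M x ^ p ∂μ := by
    refine le_trans (le_of_eq ?_) ((add_le_add (mul_le_mul' (ENNReal.ofReal_le_ofReal hηc)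
      le_rfl) le_rfl).trans key)
    rw [← add_mul, ← ENNReal.ofReal_add (by linarith) hc.le, ← one_add_mul,
      ← ENNReal.ofReal_one, ← ENNReal.ofReal_add zero_le_one (by linarith)]
    congr 2; ring
  have key3 := (ENNReal.add_le_add_iff_left hI).1 key2
  calc I = ENNReal.ofReal (2 / c) * (ENNReal.ofReal (c / 2) * I) := by
        rw [← mul_assoc, ← ENNReal.ofReal_mul (by positivity)]
        rw [show 2 / c * (c / 2) = 1 by field_simp, ENNReal.ofReal_one, one_mul]
    _ ≤ ENNReal.ofReal (2 / c) * (ENNReal.ofReal (γ ^ (-p)) * ∫⁻ x, M x ^ p ∂μ) :=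
        mul_le_mul' le_rfl key3
    _ = _ := by rw [← mul_assoc, ← ENNReal.ofReal_mul (by positivity)]

/-! ### A priori estimates -/

theorem coneNorm_restrict_eq (hE : IsClosed E) (ω : Measure (Rn n)) {V : Set (Rn n)}
    (hV : MeasurableSet V) (u : Rn n → ℂ) (y : Rn n) :
    coneNorm (ω.restrict V) E u y = coneNorm ω E (V.indicator u) y := by
  rw [coneNorm, coneNorm, Measure.restrict_restrict (isOpen_cone hE y).measurableSet]
  congr 1
  have : ∀ x, ‖V.indicator u x‖ₑ ^ 2 = V.indicator (fun x => ‖u x‖ₑ ^ 2) x := fun x => by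
    by_cases hx : x ∈ V <;> simp [hx]
  simp_rw [this]
  rw [lintegral_indicator hV, Measure.restrict_restrict hV, inter_comm]

theorem absMeasure_univ_eq_of_support {f : Rn n → ℂ} {W : Set (Rn n)}
    (hW : MeasurableSet W) (hf : ∀ x ∉ W, f x = 0) : absMeasure μ f univ = absMeasure μ f W := by
  have : f = W.indicator f := by
    ext x
    by_cases hx : x ∈ W
    · rw [indicator_of_mem hx]
    · rw [indicator_of_notMem hx, hf x hx]
  conv_lhs => rw [this]
  rw [absMeasure_indicator f hW, Measure.restrict_apply_univ]

/-- The square function at distance `ρ` from the support of `f`. -/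
theorem exists_coneNorm_integralOp_le (n : ℕ) (hm : 0 < m) (hα : α ∈ Ioc (0 : ℝ) 1) (hK : 0 < K₁) :
    ∃ C : ℝ≥0, ∀ (E : Set (Rn n)) (S : Rn n → Rn n → ℂ) (μ : Measure (Rn n)), IsClosed E →
      IsKernel E m α β K₁ K₂ S → ∀ ω ≤ coneWeight E α, ∀ f : Rn n → ℂ, AEStronglyMeasurable f μ →
      ∀ (w : Rn n) (ρ : ℝ), 0 < ρ → (∀ z, f z ≠ 0 → ρ ≤ dist z w) →
      coneNorm ω E (integralOp E S μ f) w ≤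
        C * absMeasure μ f univ * ENNReal.ofReal (ρ ^ (-m)) := by
  obtain ⟨C, hC⟩ := exists_coneNorm_le_of_bound n hα hm
  refine ⟨C * (K₁ * 4 ^ (m + α)).toNNReal, ?_⟩
  intro E S μ hE hS ω hω f hf w ρ hρ hfρ
  refine (hC E hE ω hω w ρ hρ (ENNReal.ofReal (K₁ * 4 ^ (m + α)) * absMeasure μ f univ) _
    fun x hx => ?_).trans (le_of_eq ?_)
  · refine (enorm_integralOp_le hE hS (by linarith [hα.1]) hK hf hx).trans ?_
    rw [mul_assoc]
    refine mul_le_mul' le_rfl ?_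
    rw [absMeasure, lintegral_withDensity_eq_lintegral_mul₀ hf.enorm (by fun_prop),
      withDensity_apply _ MeasurableSet.univ, Measure.restrict_univ,
      ← lintegral_mul_const' _ _ ENNReal.ofReal_ne_top]
    refine lintegral_mono fun z => ?_
    rw [Pi.mul_apply]
    by_cases hz : f z = 0
    · simp [hz]
    · refine mul_le_mul' le_rfl (ENNReal.ofReal_le_ofReal ?_)
      have hd := infDist_pos_of_mem_cone hx
      exact Real.rpow_le_rpow_of_nonpos (by linarith) (by linarith [hfρ z hz])
        (by linarith [hα.1])
  · rw [ENNReal.coe_mul, ENNReal.ofReal]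
    ring

/-- The square function truncated at distance `ε` from `E` is bounded. -/
theorem exists_coneNorm_restrict_le (n : ℕ) (hm : 0 < m) (hα : α ∈ Ioc (0 : ℝ) 1) (hK : 0 < K₁) :
    ∃ C : ℝ≥0, ∀ (E : Set (Rn n)) (S : Rn n → Rn n → ℂ) (μ : Measure (Rn n)), IsClosed E →
      IsKernel E m α β K₁ K₂ S → ∀ f : Rn n → ℂ, AEStronglyMeasurable f μ →
      ∀ ε : ℝ, 0 < ε → ∀ w : Rn n,
      coneNorm ((coneWeight E α).restrict {x | ε < infDist x E}) E (integralOp E S μ f) w ≤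
        C * absMeasure μ f univ * ENNReal.ofReal (ε ^ (-m)) := by
  obtain ⟨C, hC⟩ := exists_coneNorm_le_of_bound n hα hm
  refine ⟨C * (K₁ * 4 ^ (m + α) * 2 ^ (m + α)).toNNReal, ?_⟩
  intro E S μ hE hS f hf ε hε w
  have hV : MeasurableSet {x : Rn n | ε < infDist x E} :=
    (isOpen_lt continuous_const (continuous_infDist_pt E)).measurableSet
  rw [coneNorm_restrict_eq hE _ hV]
  refine (hC E hE _ le_rfl w ε hε (ENNReal.ofReal (K₁ * 4 ^ (m + α) * 2 ^ (m + α)) *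
    absMeasure μ f univ) _ fun x hx => ?_).trans (le_of_eq ?_)
  · by_cases hxV : x ∈ {x : Rn n | ε < infDist x E}
    · rw [indicator_of_mem hxV]
      refine (enorm_integralOp_le hE hS (by linarith [hα.1]) hK hf hx).trans ?_
      have hd := infDist_pos_of_mem_cone hx
      have hα0 := hα.1
      have : ∀ z, ENNReal.ofReal ((infDist x E + dist z w) ^ (-(m + α))) ≤
          ENNReal.ofReal (2 ^ (m + α) * (infDist x E + ε) ^ (-(m + α))) := by
        intro z
        apply ENNReal.ofReal_le_ofReal
        have hxV' : ε < infDist x E := hxV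
        calc (infDist x E + dist z w) ^ (-(m + α)) ≤ ((infDist x E + ε) / 2) ^ (-(m + α)) :=
              Real.rpow_le_rpow_of_nonpos (by positivity)
                (by linarith [dist_nonneg (x := z) (y := w)]) (by linarith)
          _ = _ := by
              rw [Real.div_rpow (by positivity) (by norm_num), Real.rpow_neg (x := 2) (by norm_num),
                div_inv_eq_mul, mul_comm]
      calc _ ≤ ENNReal.ofReal (K₁ * 4 ^ (m + α)) * ∫⁻ z,
            ENNReal.ofReal (2 ^ (m + α) * (infDist x E + ε) ^ (-(m + α))) ∂(absMeasure μ f) :=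
            mul_le_mul' le_rfl (lintegral_mono this)
        _ = _ := by
            rw [lintegral_const, ENNReal.ofReal_mul (p := 2 ^ (m + α)) (by positivity),
              ENNReal.ofReal_mul (p := K₁ * 4 ^ (m + α)) (by positivity)]
            ring
    · rw [indicator_of_notMem hxV]
      simp
  · rw [ENNReal.coe_mul, ENNReal.ofReal]
    ring

end ConicalSquare

/-! ### The `L^p` bound for truncated square functions. -/

namespace ConicalSquare

open Filter Topology

variable {n : ℕ} {E : Set (Rn n)} {m α β K₁ K₂ C₀ b κ θ A : ℝ} {S : Rn n → Rn n → ℂ}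
  {μ : Measure (Rn n)}

theorem sFinite_coneWeight (E : Set (Rn n)) (α : ℝ) : SFinite (coneWeight E α) := by
  unfold coneWeight
  infer_instance

theorem maximal_enorm_le [IsLocallyFiniteMeasure μ] {f : Rn n → ℂ} {B : ℝ} (hf : ∀ x, ‖f x‖ ≤ B)
    (w : Rn n) : maximal μ (fun x => ‖f x‖ₑ) w ≤ ENNReal.ofReal B := by
  refine maximal_le_of_le (fun z r => ?_) w
  calc ∫⁻ x in closedBall z r, ‖f x‖ₑ ∂μ ≤ ∫⁻ x in closedBall z r, ENNReal.ofReal B ∂μ :=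
        lintegral_mono fun x => by
          rw [← ofReal_norm]; exact ENNReal.ofReal_le_ofReal (hf x)
    _ = ENNReal.ofReal B * μ (closedBall z r) := by simp
    _ ≤ _ := by
      rcases le_or_gt 0 r with hr | hr
      · exact mul_le_mul' le_rfl (measure_mono (closedBall_subset_closedBall (by linarith)))
      · simp [closedBall_eq_empty.2 hr]

/-- Qualitative estimates for the truncated square function of a bounded function with bounded
support. -/
theorem coneNorm_restrict_apriori (hm : 0 < m) (hα : α ∈ Ioc (0 : ℝ) 1) (hK : 0 < K₁)
    (hE : IsClosed E) (hS : IsKernel E m α β K₁ K₂ S) (hC₀ : 0 < C₀) (hμ : IsOfOrder E m C₀ μ)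
    {f : Rn n → ℂ} (hf : Integrable f μ) {ε R : ℝ} (hε : 0 < ε) (hR : 0 < R)
    (hfR : ∀ x ∉ closedBall 0 R, f x = 0) :
    (∃ D : ℝ≥0, ∀ w, coneNorm ((coneWeight E α).restrict {x | ε < infDist x E}) E
      (integralOp E S μ f) w ≤ D) ∧
    (∀ t > 0, ∃ R', ∀ w ∈ E, R' < dist w 0 → coneNorm ((coneWeight E α).restrict
      {x | ε < infDist x E}) E (integralOp E S μ f) w ≤ ENNReal.ofReal t) ∧
    ∃ D : ℝ≥0, ∀ w ∈ E, w ∉ closedBall 0 (2 * R) → coneNorm ((coneWeight E α).restrict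
      {x | ε < infDist x E}) E (integralOp E S μ f) w ≤ D * maximal μ (fun x => ‖f x‖ₑ) w := by
  obtain ⟨C₁, hC₁⟩ := exists_coneNorm_restrict_le (β := β) (K₂ := K₂) n hm hα hK
  obtain ⟨C₂, hC₂⟩ := exists_coneNorm_integralOp_le (β := β) (K₂ := K₂) n hm hα hK
  have hN : absMeasure μ f univ ≠ ∞ := by
    rw [absMeasure_apply _ MeasurableSet.univ, Measure.restrict_univ]
    exact hf.2.ne
  have hfar : ∀ w ∉ closedBall (0 : Rn n) (2 * R), coneNorm ((coneWeight E α).restrict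
      {x | ε < infDist x E}) E (integralOp E S μ f) w ≤
        C₂ * absMeasure μ f univ * ENNReal.ofReal ((dist w 0 / 2) ^ (-m)) := by
    intro w hw
    rw [mem_closedBall, not_le] at hw
    refine hC₂ E S μ hE hS _ Measure.restrict_le_self f hf.1 w _ (by linarith) fun z hz => ?_
    have hz' : dist z 0 ≤ R := by
      by_contra hcon
      exact hz (hfR z hcon)
    have := dist_triangle_left w 0 z
    linarith
  refine ⟨⟨(C₁ * absMeasure μ f univ * ENNReal.ofReal (ε ^ (-m))).toNNReal, fun w => ?_⟩, ?_, ?_⟩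
  · rw [ENNReal.coe_toNNReal (by finiteness)]
    exact hC₁ E S μ hE hS f hf.1 ε hε w
  · intro t ht
    have hlim : Tendsto (fun r : ℝ => (C₂ * absMeasure μ f univ).toReal * (r / 2) ^ (-m)) atTop
        (𝓝 ((C₂ * absMeasure μ f univ).toReal * 0)) :=
      ((tendsto_rpow_neg_atTop hm).comp (tendsto_id.atTop_div_const two_pos)).const_mul _
    rw [mul_zero] at hlim
    obtain ⟨R', hR'⟩ := eventually_atTop.1 (hlim.eventually_lt_const ht)
    refine ⟨max R' (2 * R), fun w _ hw => (hfar w ?_).trans ?_⟩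
    · rw [mem_closedBall, not_le]
      exact (le_max_right _ _).trans_lt hw
    · have h1 := hR' (dist w 0) ((le_max_left _ _).trans hw.le)
      rw [← ENNReal.ofReal_toReal (a := C₂ * absMeasure μ f univ) (by finiteness),
        ← ENNReal.ofReal_mul ENNReal.toReal_nonneg]
      exact ENNReal.ofReal_le_ofReal h1.le
  · refine ⟨C₂ * (C₀ * 10 ^ m * 4 ^ m).toNNReal, fun w hwE hw => (hfar w hw).trans ?_⟩
    rw [mem_closedBall, not_le] at hw
    have h1 : absMeasure μ f univ ≤ maximal μ (fun x => ‖f x‖ₑ) w *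
        ENNReal.ofReal (C₀ * 10 ^ m * (2 * dist w 0) ^ m) := by
      refine le_trans ?_ (absMeasure_closedBall_le hE hμ f hwE
        (mem_ball_self (show 0 < 2 * dist w 0 by linarith)))
      rw [absMeasure_univ_eq_of_support measurableSet_closedBall hfR]
      refine measure_mono fun z hz => ?_
      rw [mem_closedBall] at hz ⊢
      have := dist_triangle_right z w 0
      linarith
    have h0 : 0 < dist w 0 := by linarith
    calc C₂ * absMeasure μ f univ * ENNReal.ofReal ((dist w 0 / 2) ^ (-m))
        ≤ C₂ * (maximal μ (fun x => ‖f x‖ₑ) w *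
          ENNReal.ofReal (C₀ * 10 ^ m * (2 * dist w 0) ^ m)) *
          ENNReal.ofReal ((dist w 0 / 2) ^ (-m)) := by gcongr
      _ = C₂ * (ENNReal.ofReal (C₀ * 10 ^ m * (2 * dist w 0) ^ m) *
          ENNReal.ofReal ((dist w 0 / 2) ^ (-m))) * maximal μ (fun x => ‖f x‖ₑ) w := by ring
      _ = _ := by
        rw [← ENNReal.ofReal_mul (by positivity), ENNReal.coe_mul, ENNReal.ofReal]
        congr 4
        rw [mul_assoc, Real.rpow_neg (by positivity), ← div_eq_mul_inv,
          ← Real.div_rpow (by positivity) (by positivity)]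
        congr 2
        field_simp
        norm_num

/-- The good `λ` inequality is applied to the truncated square function, whose `L^p` norm is finite
beforehand. The point of the statement is that `K` does not depend on `ε`, `B` or `R`. -/
theorem exists_lintegral_rpow_coneNorm_le (n : ℕ) (hm : 0 < m) (hα : α ∈ Ioc (0 : ℝ) 1)
    (hβ : 0 < β) (hK : 0 < K₁) (hC₀ : 0 < C₀) (hmn : m ≤ n) (hb : 100 ^ (n + 1) ≤ b) (hκ : 21 ≤ κ)
    (hθ : θ ∈ Ioo (0 : ℝ) 1) (hA : 0 < A) {p : ℝ} (hp : 1 < p) :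
    ∃ K : ℝ≥0, ∀ (E : Set (Rn n)) (S : Rn n → Rn n → ℂ) (μ : Measure (Rn n)), IsClosed E →
      IsKernel E m α β K₁ K₂ S → IsOfOrder E m C₀ μ →
      HasBigPieces E μ b κ θ (IsDiscreteWeakBoundedOn E α S μ A) →
      ∀ ε : ℝ, 0 < ε → ∀ f : Rn n → ℂ, Measurable f → ∀ B R : ℝ, 0 < R → (∀ x, ‖f x‖ ≤ B) →
      (∀ x ∉ closedBall 0 R, f x = 0) →
      ∫⁻ w, coneNorm ((coneWeight E α).restrict {x | ε < infDist x E}) E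
        (integralOp E S μ f) w ^ p ∂μ ≤ K * ∫⁻ x, ‖f x‖ₑ ^ p ∂μ := by
  have hb1 : 1 ≤ b := le_trans (one_le_pow₀ (by norm_num)) hb
  have hb0 : 0 < b := by linarith
  have hp0 : 0 < p := by linarith
  set c := θ / (2 * b) with hc
  have hθ0 := hθ.1
  have hθ1 := hθ.2
  have hc0 : 0 < c := by positivity
  have hc1 : c ≤ 1 := by
    rw [hc, div_le_one (by positivity)]
    linarith
  have h1c : 0 < 1 - c / 2 := by linarith
  -- Chosen so that `(1 + η)^(-p) = 1 - c/2`.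
  set η := (1 - c / 2) ^ (-(1 / p)) - 1 with hη
  have hη0 : 0 < η := by
    have := Real.one_lt_rpow_of_pos_of_lt_one_of_neg h1c (by linarith)
      (show -(1 / p) < 0 by rw [neg_lt_zero]; positivity)
    linarith
  have hηc : (1 + η) ^ (-p) = 1 - c / 2 := by
    rw [hη, add_sub_cancel, ← Real.rpow_mul h1c.le, neg_mul_neg, one_div,
      inv_mul_cancel₀ hp0.ne', Real.rpow_one]
  obtain ⟨γ, hγ, hgood⟩ := exists_goodLambda (K₂ := K₂) n hm hα hβ hK hC₀ hmn hb hκ hθ hA hη0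
  obtain ⟨C, hC⟩ := exists_maximal_strong_type hp
  refine ⟨(2 / c * γ ^ (-p)).toNNReal * C, ?_⟩
  intro E S μ hE hS hμ hbig ε hε f hf B R hR hfB hfR
  have := hμ.isLocallyFiniteMeasure hE
  have hfi : Integrable f μ := by
    have h1 : IntegrableOn f (closedBall 0 R) μ := by
      refine Measure.integrableOn_of_bounded (M := B) measure_closedBall_lt_top.ne
        hf.aestronglyMeasurable (Eventually.of_forall hfB)
    exact h1.integrable_of_forall_notMem_eq_zero hfR
  set ω := (coneWeight E α).restrict {x | ε < infDist x E} with hω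
  have hωle : ω ≤ coneWeight E α := Measure.restrict_le_self
  have : SFinite ω := by
    have := sFinite_coneWeight E α
    rw [hω]; infer_instance
  set u := coneNorm ω E (integralOp E S μ f) with hu
  set M := maximal μ (fun x => ‖f x‖ₑ) with hM
  obtain ⟨⟨D, hD⟩, hdec, D', hD'⟩ := coneNorm_restrict_apriori hm hα hK hE hS hC₀ hμ hfi hε hR hfR
  have hum : Measurable u := measurable_coneNorm _ _
  have hMm : Measurable M := measurable_maximal _ _
  have hMp : ∫⁻ w, M w ^ p ∂μ ≤ C * ∫⁻ x, ‖f x‖ₑ ^ p ∂μ := by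
    have := hC n μ inferInstance (fun x => ‖f x‖) B hf.norm (fun x => norm_nonneg _) hfB
    simpa only [ofReal_norm] using this
  have hfp : ∫⁻ x, ‖f x‖ₑ ^ p ∂μ ≠ ∞ := by
    have h1 : ∀ x, ‖f x‖ₑ ^ p ≤ (closedBall 0 R).indicator (fun _ => ENNReal.ofReal B ^ p) x := by
      intro x
      by_cases hx : x ∈ closedBall 0 R
      · rw [indicator_of_mem hx, ← ofReal_norm]
        gcongr
        exact hfB x
      · rw [hfR x hx, enorm_zero, ENNReal.zero_rpow_of_pos hp0]
        exact zero_le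
    refine ne_top_of_le_ne_top ?_ (lintegral_mono h1)
    rw [lintegral_indicator measurableSet_closedBall, setLIntegral_const]
    exact ENNReal.mul_ne_top (ENNReal.rpow_ne_top_of_nonneg hp0.le ENNReal.ofReal_ne_top)
      measure_closedBall_lt_top.ne
  have hMp' : ∫⁻ w, M w ^ p ∂μ ≠ ∞ := ne_top_of_le_ne_top (by finiteness) hMp
  -- Near the support of `f` the truncated square function is bounded on a ball of finite measure;
  -- elsewhere it is dominated by a multiple of the maximal function, which lies in `L^p(μ)`.
  have hI : ∫⁻ w, u w ^ p ∂μ ≠ ∞ := by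
    have h1 : ∀ᵐ w ∂μ, u w ^ p ≤ (closedBall 0 (2 * R)).indicator (fun _ => (D : ℝ≥0∞) ^ p) w +
        (D' : ℝ≥0∞) ^ p * M w ^ p := by
      have hEae : ∀ᵐ y ∂μ, y ∈ E := by rw [ae_iff]; exact hμ.1
      filter_upwards [hEae] with w hw
      by_cases hwR : w ∈ closedBall 0 (2 * R)
      · rw [indicator_of_mem hwR]
        exact le_add_right (ENNReal.rpow_le_rpow (hD w) hp0.le)
      · rw [← ENNReal.mul_rpow_of_nonneg _ _ hp0.le]
        exact le_add_left (ENNReal.rpow_le_rpow (hD' w hw hwR) hp0.le)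
    refine ne_top_of_le_ne_top ?_ (lintegral_mono_ae h1)
    rw [lintegral_add_right _ (by fun_prop), lintegral_indicator measurableSet_closedBall,
      setLIntegral_const, lintegral_const_mul _ (by fun_prop)]
    refine ENNReal.add_ne_top.2 ⟨ENNReal.mul_ne_top (by finiteness)
      measure_closedBall_lt_top.ne, ENNReal.mul_ne_top (by finiteness) hMp'⟩
  have key := lintegral_rpow_le_of_goodLambda (μ := μ) hum
    (fun w => ne_top_of_le_ne_top ENNReal.coe_ne_top (hD w)) hMm
    (fun w => ne_top_of_le_ne_top ENNReal.ofReal_ne_top (maximal_enorm_le hfB w)) hp0 hη0 hγ hc0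
    hηc.ge (by linarith) (hgood E S μ hE hS hμ hbig ω hωle inferInstance f hfi hdec) hI
  refine key.trans ((mul_le_mul' le_rfl hMp).trans (le_of_eq ?_))
  rw [ENNReal.coe_mul, ENNReal.ofReal, mul_assoc]

/-- The integral defining `T_μ f` converges absolutely for `f ∈ L^p(μ)`. -/
theorem integrableOn_kernel_mul (hm : 0 < m) (hα : 0 < α) (hβ : 0 < β) (hK : 0 < K₁)
    (hE : IsClosed E) (hS : IsKernel E m α β K₁ K₂ S) (hC₀ : 0 < C₀)
    (hμ : IsOfOrder E m C₀ μ) {p : ℝ} (hp : 1 < p) {f : Rn n → ℂ}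
    (hf : MemLp f (ENNReal.ofReal p) μ) {x : Rn n} (hx : x ∉ E) :
    IntegrableOn (fun z => S x z * f z) E μ := by
  rcases E.eq_empty_or_nonempty with rfl | hne
  · simp
  have hd := infDist_pos_of_notMem hE hne hx
  obtain ⟨w, hwE, hw⟩ := (infDist_lt_iff hne).1 (show infDist x E < 2 * infDist x E by linarith)
  have hxw : x ∈ cone E w := ⟨hx, hw⟩
  set q := p / (p - 1) with hq
  have hpq : p.HolderConjugate q := Real.HolderConjugate.conjExponent hp
  have hq1 : 1 < q := hpq.symm.lt
  have hq0 : 0 < q := by linarith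
  -- Raised to the conjugate exponent `q > 1`, the kernel still decays faster than the order `m` of
  -- `μ`.
  have hmq : 0 < (m + α) * q - m := by nlinarith
  obtain ⟨C, hC⟩ := exists_lintegral_growth_le hm hmq
  have hSq : MemLp (fun z => S x z) (ENNReal.ofReal q) (μ.restrict E) := by
    refine ⟨(hS.continuousOn hβ hx).aestronglyMeasurable hE.measurableSet, ?_⟩
    rw [eLpNorm_lt_top_iff_lintegral_rpow_enorm_lt_top (by simpa using hq0) ENNReal.ofReal_ne_top,
      ENNReal.toReal_ofReal hq0.le]
    have hb := hC n μ w (infDist x E) (ENNReal.ofReal (C₀ * 2 ^ m)) hd fun r hr => by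
      refine (hμ.measure_closedBall_le hwE (by linarith)).trans (le_of_eq ?_)
      rw [ENNReal.ofReal_mul (by positivity)]
    have h1 : ∀ z ∈ E, ‖S x z‖ₑ ^ q ≤ ENNReal.ofReal (K₁ * 4 ^ (m + α)) ^ q *
        ENNReal.ofReal ((infDist x E + dist z w) ^ (-(m + ((m + α) * q - m)))) := by
      intro z hz
      refine (ENNReal.rpow_le_rpow (hS.enorm_le (by linarith) hK hxw hz) hq0.le).trans
        (le_of_eq ?_)
      rw [ENNReal.mul_rpow_of_nonneg _ _ hq0.le,
        ENNReal.ofReal_rpow_of_nonneg (x := (infDist x E + dist z w) ^ (-(m + α)))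
          (by positivity) hq0.le, ← Real.rpow_mul (by positivity)]
      congr 3; ring
    refine (setLIntegral_mono' hE.measurableSet h1).trans_lt ?_
    refine (setLIntegral_le_lintegral _ _).trans_lt ?_
    rw [lintegral_const_mul' _ _ (by finiteness)]
    exact ENNReal.mul_lt_top (by finiteness) (hb.trans_lt (by finiteness))
  have : ENNReal.HolderConjugate (ENNReal.ofReal q) (ENNReal.ofReal p) := hpq.symm.ennrealOfReal
  exact MemLp.integrable_mul hSq (hf.restrict E)

end ConicalSquare

/-! ### Removal of the truncations. -/

namespace ConicalSquare

open Filter Topology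

variable {n : ℕ} {E : Set (Rn n)} {m α β K₁ K₂ C₀ b κ θ A : ℝ} {S : Rn n → Rn n → ℂ}
  {μ : Measure (Rn n)}

/-- Bounded truncation of a function at height `N` and to the ball of radius `N + 1`. -/
noncomputable def truncate (f : Rn n → ℂ) (N : ℕ) : Rn n → ℂ :=
  (closedBall 0 (N + 1) ∩ {x | ‖f x‖ ≤ N}).indicator f

theorem enorm_truncate_le (f : Rn n → ℂ) (N : ℕ) (x : Rn n) : ‖truncate f N x‖ₑ ≤ ‖f x‖ₑ :=
  enorm_indicator_le_enorm_self _ _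

theorem measurable_truncate {f : Rn n → ℂ} (hf : Measurable f) (N : ℕ) :
    Measurable (truncate f N) :=
  hf.indicator (measurableSet_closedBall.inter (measurableSet_le hf.norm measurable_const))

theorem norm_truncate_le_nat (f : Rn n → ℂ) (N : ℕ) (x : Rn n) : ‖truncate f N x‖ ≤ N := by
  by_cases hx : x ∈ closedBall 0 ((N : ℝ) + 1) ∩ {x | ‖f x‖ ≤ N}
  · rw [truncate, indicator_of_mem hx]
    exact hx.2
  · rw [truncate, indicator_of_notMem hx, norm_zero]
    positivity

theorem truncate_eq_zero (f : Rn n → ℂ) (N : ℕ) {x : Rn n} (hx : x ∉ closedBall 0 ((N : ℝ) + 1)) :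
    truncate f N x = 0 :=
  indicator_of_notMem (fun h => hx h.1) _

theorem eventually_truncate_eq (f : Rn n → ℂ) (x : Rn n) :
    ∀ᶠ N in atTop, truncate f N x = f x := by
  obtain ⟨N₀, hN₀⟩ := exists_nat_ge (max (dist x 0) ‖f x‖)
  filter_upwards [eventually_ge_atTop N₀] with N hN
  have hN' : (N₀ : ℝ) ≤ N := by exact_mod_cast hN
  refine indicator_of_mem
    (show x ∈ closedBall 0 ((N : ℝ) + 1) ∩ {x | ‖f x‖ ≤ N} from ⟨?_, ?_⟩) _
  · rw [mem_closedBall]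
    linarith [le_max_left (dist x 0) ‖f x‖]
  · exact (le_max_right _ _).trans (hN₀.trans hN')

/-- Truncating `f` at height `N` and the cones at distance `1 / (N + 1)` from `E`, the uniform bound
passes to the limit by Fatou's lemma, once inside the cone and once in `L^p(μ)`. -/
theorem exists_isLpBounded (n : ℕ) (hm : 0 < m) (hα : α ∈ Ioc (0 : ℝ) 1)
    (hβ : 0 < β) (hK : 0 < K₁) (hC₀ : 0 < C₀) (hmn : m ≤ n) (hb : 100 ^ (n + 1) ≤ b) (hκ : 21 ≤ κ)
    (hθ : θ ∈ Ioo (0 : ℝ) 1) (hA : 0 < A) {p : ℝ} (hp : 1 < p) :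
    ∃ K : ℝ≥0, ∀ (E : Set (Rn n)) (S : Rn n → Rn n → ℂ) (μ : Measure (Rn n)), IsClosed E →
      IsKernel E m α β K₁ K₂ S → IsOfOrder E m C₀ μ →
      HasBigPieces E μ b κ θ (IsDiscreteWeakBoundedOn E α S μ A) →
      IsLpBounded E α S μ (ENNReal.ofReal p) K := by
  obtain ⟨K, hKb⟩ := exists_lintegral_rpow_coneNorm_le (K₂ := K₂) n hm hα hβ hK hC₀ hmn hb hκ hθ hA
    hp
  have hp0 : 0 < p := by linarith
  refine ⟨K ^ (1 / p), ?_⟩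
  intro E S μ hE hS hμ hbig f₀ hf₀
  have hsq : ∀ f, squareFun E α S μ f = coneNorm (coneWeight E α) E (integralOp E S μ f) :=
    fun f => funext fun y => coneIntegral_eq_coneNorm hE _ y
  suffices h : eLpNorm (squareFun E α S μ f₀) (ENNReal.ofReal p) μ ≤
      (K ^ (1 / p) : ℝ≥0) * eLpNorm f₀ (ENNReal.ofReal p) μ by
    refine ⟨⟨?_, h.trans_lt (ENNReal.mul_lt_top ENNReal.coe_lt_top hf₀.2)⟩, h⟩
    rw [hsq]
    exact (measurable_coneNorm _ _).aestronglyMeasurable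
  rcases E.eq_empty_or_nonempty with rfl | hne
  · have : μ = 0 := by simpa using hμ.1
    simp [this]
  have := hμ.isLocallyFiniteMeasure hE
  have hmα : 0 < m + α := by linarith [hα.1]
  set f := hf₀.1.mk f₀ with hf
  have hff₀ : f₀ =ᵐ[μ] f := hf₀.1.ae_eq_mk
  have hfm : Measurable f := hf₀.1.stronglyMeasurable_mk.measurable
  have hfp : MemLp f (ENNReal.ofReal p) μ := hf₀.ae_eq hff₀
  have hop : integralOp E S μ f₀ = integralOp E S μ f := by
    ext x
    refine setIntegral_congr_ae hE.measurableSet ?_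
    filter_upwards [hff₀] with z hz _
    rw [hz]
  have hsqf : squareFun E α S μ f₀ = squareFun E α S μ f := by rw [hsq, hsq, hop]
  rw [hsqf, eLpNorm_congr_ae hff₀]
  -- the truncated square functions of the truncations of `f`
  set V : ℕ → Set (Rn n) := fun N => {x | 1 / ((N : ℝ) + 1) < infDist x E} with hVdef
  have hV : ∀ N, MeasurableSet (V N) := fun N =>
    (isOpen_lt continuous_const (continuous_infDist_pt E)).measurableSet
  set u : ℕ → Rn n → ℂ := fun N => (V N).indicator (integralOp E S μ (truncate f N)) with hu
  have hfi : ∀ N, Integrable (truncate f N) μ := fun N => by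
    have h1 : IntegrableOn (truncate f N) (closedBall 0 (N + 1)) μ :=
      Measure.integrableOn_of_bounded (M := N) measure_closedBall_lt_top.ne
        (measurable_truncate hfm N).aestronglyMeasurable
        (Eventually.of_forall (norm_truncate_le_nat f N))
    exact h1.integrable_of_forall_notMem_eq_zero fun x hx => truncate_eq_zero f N hx
  have hum : ∀ N, AEStronglyMeasurable (u N) (coneWeight E α) := fun N =>
    (aestronglyMeasurable_integralOp hE hS hmα hβ hK (hfi N)
      coneWeight_absolutelyContinuous).indicator (hV N)
  have hlim : ∀ᵐ x ∂(coneWeight E α), Tendsto (fun N => u N x) atTop (𝓝 (integralOp E S μ f x)) := by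
    filter_upwards [ae_notMem_of_ac hE coneWeight_absolutelyContinuous] with x hx
    have hd := infDist_pos_of_notMem hE hne hx
    have h1 : Tendsto (fun N => integralOp E S μ (truncate f N) x) atTop
        (𝓝 (integralOp E S μ f x)) := by
      have hint := integrableOn_kernel_mul hm hα.1 hβ hK hE hS hC₀ hμ hp hfp hx
      refine tendsto_integral_of_dominated_convergence (fun z => ‖S x z * f z‖) (fun N => ?_)
        hint.norm (fun N => ?_) ?_
      · exact ((hS.continuousOn hβ hx).aestronglyMeasurable hE.measurableSet).mul
          (measurable_truncate hfm N).aestronglyMeasurable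
      · refine Eventually.of_forall fun z => ?_
        rw [norm_mul, norm_mul]
        exact mul_le_mul_of_nonneg_left (enorm_le_iff_norm_le.1 (enorm_truncate_le f N z))
          (norm_nonneg _)
      · refine Eventually.of_forall fun z => ?_
        refine tendsto_const_nhds.congr' ?_
        filter_upwards [eventually_truncate_eq f z] with N hN
        rw [hN]
    refine h1.congr' ?_
    obtain ⟨N₀, hN₀⟩ := exists_nat_one_div_lt hd
    filter_upwards [eventually_ge_atTop N₀] with N hN
    refine (indicator_of_mem (show x ∈ V N from lt_of_le_of_lt ?_ hN₀) _).symm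
    have : (N₀ : ℝ) ≤ N := by exact_mod_cast hN
    gcongr
  have hbound : ∀ N, ∫⁻ w, coneNorm (coneWeight E α) E (u N) w ^ p ∂μ ≤
      K * ∫⁻ x, ‖f x‖ₑ ^ p ∂μ := fun N => by
    have h1 := hKb E S μ hE hS hμ hbig (1 / ((N : ℝ) + 1)) (by positivity) (truncate f N)
      (measurable_truncate hfm N) N (N + 1) (by positivity) (norm_truncate_le_nat f N)
      (fun x hx => truncate_eq_zero f N hx)
    have e : ∀ w, coneNorm (coneWeight E α) E (u N) w =
        coneNorm ((coneWeight E α).restrict (V N)) E (integralOp E S μ (truncate f N)) w :=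
      fun w => (coneNorm_restrict_eq hE _ (hV N) _ w).symm
    simp_rw [e]
    refine h1.trans (mul_le_mul' le_rfl (lintegral_mono fun x => ?_))
    exact ENNReal.rpow_le_rpow (enorm_truncate_le f N x) hp0.le
  have hfatou : ∫⁻ w, squareFun E α S μ f w ^ p ∂μ ≤ K * ∫⁻ x, ‖f x‖ₑ ^ p ∂μ := by
    calc ∫⁻ w, squareFun E α S μ f w ^ p ∂μ
        ≤ ∫⁻ w, liminf (fun N => coneNorm (coneWeight E α) E (u N) w ^ p) atTop ∂μ := by
          refine lintegral_mono fun w => ?_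
          rw [hsq]
          refine (ENNReal.rpow_le_rpow (coneNorm_le_liminf hum hlim w) hp0.le).trans (le_of_eq ?_)
          exact (ENNReal.monotone_rpow_of_nonneg hp0.le).map_liminf_of_continuousAt
            (F := atTop) _ ENNReal.continuous_rpow_const.continuousAt
      _ ≤ liminf (fun N => ∫⁻ w, coneNorm (coneWeight E α) E (u N) w ^ p ∂μ) atTop :=
          lintegral_liminf_le fun N => (measurable_coneNorm _ _).pow_const p
      _ ≤ _ := liminf_le_of_frequently_le' (Frequently.of_forall hbound)
  rw [eLpNorm_eq_lintegral_rpow_enorm_toReal (by simpa using hp0) ENNReal.ofReal_ne_top,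
    eLpNorm_eq_lintegral_rpow_enorm_toReal (by simpa using hp0) ENNReal.ofReal_ne_top,
    ENNReal.toReal_ofReal hp0.le, ENNReal.coe_rpow_of_nonneg _ (by positivity),
    ← ENNReal.mul_rpow_of_nonneg _ _ (by positivity)]
  exact ENNReal.rpow_le_rpow hfatou (by positivity)

end ConicalSquare

/-! ### From `L²` bounds to weak type: spreading masses and estimates of clusters. -/

namespace ConicalSquare

open Filter Topology

variable {n : ℕ} {E : Set (Rn n)} {m α β K₁ K₂ C₀ A : ℝ} {S : Rn n → Rn n → ℂ}
  {μ : Measure (Rn n)}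

/-! ### Spreading masses over sets with controlled overlap -/

/-- The sets are treated in order of increasing `R`. When `Q j` is reached, the density `Φ` already
placed has integral at most `Λ τ(Q j)` over `Q j`, because only smaller sets meeting `Q j`
contribute. By Chebyshev `Φ ≤ 2Λ` on at least half of `Q j`; spreading `N j` over that half adds a
density of at most `2Λ`. -/
theorem exists_spreading {X ι : Type*} [MeasurableSpace X] [DecidableEq ι] (τ : Measure X)
    (v : Finset ι) (Q : ι → Set X) (R : ι → ℝ) (N : ι → ℝ≥0∞) {Λ : ℝ≥0∞} (hΛ : Λ ≠ 0)
    (hΛ' : Λ ≠ ∞) (hQ : ∀ i ∈ v, MeasurableSet (Q i)) (hQ0 : ∀ i ∈ v, τ (Q i) ≠ 0)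
    (hQ' : ∀ i ∈ v, τ (Q i) ≠ ∞)
    (hN : ∀ j ∈ v, ∀ s ⊆ v, (∀ i ∈ s, R i ≤ R j ∧ (Q i ∩ Q j).Nonempty) →
      ∑ i ∈ s, N i ≤ Λ * τ (Q j)) :
    ∃ B : ι → Set X, (∀ j ∈ v, B j ⊆ Q j ∧ MeasurableSet (B j) ∧ τ (Q j) ≤ 2 * τ (B j)) ∧
      ∀ x, ∑ j ∈ v, (B j).indicator (fun _ => N j / τ (B j)) x ≤ 4 * Λ := by
  induction v using Finset.induction_on_max_value R with
  | empty => exact ⟨fun _ => ∅, by simp, by simp⟩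
  | insert j v hj hmax ih =>
    obtain ⟨B, hB, hBsum⟩ := ih (fun i hi => hQ i (Finset.mem_insert_of_mem hi))
      (fun i hi => hQ0 i (Finset.mem_insert_of_mem hi))
      (fun i hi => hQ' i (Finset.mem_insert_of_mem hi))
      (fun i hi s hs => hN i (Finset.mem_insert_of_mem hi) s (hs.trans (Finset.subset_insert _ _)))
    have hjv := Finset.mem_insert_self j v
    set Φ : X → ℝ≥0∞ := fun x => ∑ i ∈ v, (B i).indicator (fun _ => N i / τ (B i)) x with hΦ
    have hΦm : Measurable Φ := Finset.measurable_fun_sum v fun i hi =>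
      measurable_const.indicator (hB i hi).2.1
    have hQj := hQ j hjv
    have hint : ∫⁻ x in Q j, Φ x ∂τ ≤ Λ * τ (Q j) := by
      rw [hΦ, lintegral_finsetSum _ fun i hi => measurable_const.indicator (hB i hi).2.1]
      classical
      rw [← Finset.sum_filter_add_sum_filter_not v (fun i => (Q i ∩ Q j).Nonempty)]
      have h0 : ∑ i ∈ v with ¬ (Q i ∩ Q j).Nonempty,
          ∫⁻ x in Q j, (B i).indicator (fun _ => N i / τ (B i)) x ∂τ = 0 := by
        refine Finset.sum_eq_zero fun i hi => ?_
        obtain ⟨hiv, hne⟩ := Finset.mem_filter.1 hi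
        rw [setLIntegral_indicator (hB i hiv).2.1, not_nonempty_iff_eq_empty] at *
        rw [show B i ∩ Q j = ∅ from subset_empty_iff.1
          (hne ▸ inter_subset_inter_left _ (hB i hiv).1)]
        simp
      rw [h0, add_zero]
      refine le_trans (Finset.sum_le_sum fun i hi => ?_) (hN j hjv
        (v.filter fun i => (Q i ∩ Q j).Nonempty)
        ((Finset.filter_subset _ _).trans (Finset.subset_insert _ _)) fun i hi => ?_)
      · have hiv := (Finset.mem_filter.1 hi).1
        rw [setLIntegral_indicator (hB i hiv).2.1, setLIntegral_const]
        exact (mul_le_mul' le_rfl (measure_mono inter_subset_left)).trans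
          (by rw [mul_comm]; exact ENNReal.mul_div_le)
      · obtain ⟨hiv, hne⟩ := Finset.mem_filter.1 hi
        exact ⟨hmax i hiv, hne⟩
    set B' := Q j ∩ {x | Φ x ≤ 2 * Λ} with hB'
    have hB'm : MeasurableSet B' := hQj.inter (measurableSet_le hΦm measurable_const)
    have hbad : 2 * τ (Q j ∩ {x | 2 * Λ < Φ x}) ≤ τ (Q j) := by
      have h1 : 2 * Λ * τ (Q j ∩ {x | 2 * Λ < Φ x}) ≤ Λ * τ (Q j) := by
        refine le_trans ?_ hint
        rw [inter_comm, ← Measure.restrict_apply (measurableSet_lt measurable_const hΦm)]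
        refine le_trans (mul_le_mul' le_rfl (measure_mono fun x hx => ?_))
          (mul_meas_ge_le_lintegral hΦm (2 * Λ))
        have hx' : 2 * Λ < Φ x := hx
        exact hx'.le
      refine (ENNReal.mul_le_mul_iff_right hΛ hΛ').1 (le_trans (le_of_eq ?_) h1)
      ring
    have hhalf : τ (Q j) ≤ 2 * τ B' := by
      have h1 : τ (Q j) ≤ τ B' + τ (Q j ∩ {x | 2 * Λ < Φ x}) := by
        refine (measure_mono fun x hx => ?_).trans (measure_union_le _ _)
        rcases le_or_gt (Φ x) (2 * Λ) with h | h
        · exact Or.inl ⟨hx, h⟩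
        · exact Or.inr ⟨hx, h⟩
      have h2 : τ (Q j) + τ (Q j) ≤ 2 * τ B' + τ (Q j) := by
        calc τ (Q j) + τ (Q j) = 2 * τ (Q j) := (two_mul _).symm
          _ ≤ 2 * (τ B' + τ (Q j ∩ {x | 2 * Λ < Φ x})) := mul_le_mul' le_rfl h1
          _ = 2 * τ B' + 2 * τ (Q j ∩ {x | 2 * Λ < Φ x}) := mul_add _ _ _
          _ ≤ _ := add_le_add le_rfl hbad
      exact (ENNReal.add_le_add_iff_right (hQ' j hjv)).1 h2
    have hB'0 : τ B' ≠ 0 := fun h => hQ0 j hjv (by simpa [h] using hhalf)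
    have hB'top : τ B' ≠ ∞ := ne_top_of_le_ne_top (hQ' j hjv) (measure_mono inter_subset_left)
    have hNj : N j / τ B' ≤ 2 * Λ := by
      refine ENNReal.div_le_of_le_mul ?_
      have h1 : N j ≤ Λ * τ (Q j) := by
        have := hN j hjv {j} (by simp) fun i hi => by
          rw [Finset.mem_singleton] at hi
          subst hi
          rw [inter_self]
          exact ⟨le_rfl, nonempty_of_measure_ne_zero (hQ0 i hjv)⟩
        simpa using this
      calc N j ≤ Λ * τ (Q j) := h1
        _ ≤ Λ * (2 * τ B') := mul_le_mul' le_rfl hhalf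
        _ = _ := by ring
    have hupd : ∀ i ∈ v, Function.update B j B' i = B i := fun i hi =>
      Function.update_of_ne (ne_of_mem_of_not_mem hi hj) _ _
    refine ⟨Function.update B j B', fun i hi => ?_, fun x => ?_⟩
    · rcases Finset.mem_insert.1 hi with rfl | hi
      · rw [Function.update_self]
        exact ⟨inter_subset_left, hB'm, hhalf⟩
      · rw [hupd i hi]
        exact hB i hi
    · rw [Finset.sum_insert hj, Function.update_self, Finset.sum_congr rfl fun i hi => by
        rw [hupd i hi]]
      by_cases hx : x ∈ B'
      · rw [indicator_of_mem hx]
        calc N j / τ B' + Φ x ≤ 2 * Λ + 2 * Λ := add_le_add hNj hx.2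
          _ = _ := by ring
      · rw [indicator_of_notMem hx, zero_add]
        exact hBsum x

/-! ### Estimates for a cluster of point masses -/

theorem coneNorm_sum_kernel_le (n : ℕ) (hm : 0 < m) (hα : α ∈ Ioc (0 : ℝ) 1) (hK : 0 < K₁) :
    ∃ C : ℝ≥0, ∀ (E : Set (Rn n)) (S : Rn n → Rn n → ℂ), IsClosed E →
      IsKernel E m α β K₁ K₂ S → ∀ (P : Finset (Rn n)) (a : Rn n → ℂ) (j : Rn n) (r : ℝ),
      0 < r → ↑P ⊆ E → ↑P ⊆ closedBall j (5 * r) → ∀ y : Rn n, 10 * r < dist y j →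
      coneNorm (coneWeight E α) E (fun x => ∑ z ∈ P, a z * S x z) y ≤
        C * (∑ z ∈ P, ‖a z‖ₑ) * ENNReal.ofReal (dist y j ^ (-m)) := by
  obtain ⟨C, hC⟩ := exists_coneNorm_le_of_bound n hα hm
  refine ⟨C * (K₁ * 4 ^ (m + α)).toNNReal * (2 ^ m : ℝ).toNNReal, ?_⟩
  intro E S hE hS P a j r hr hPE hPj y hy
  have hα0 := hα.1
  refine (hC E hE _ le_rfl y (dist y j / 2) (by linarith)
    (ENNReal.ofReal (K₁ * 4 ^ (m + α)) * ∑ z ∈ P, ‖a z‖ₑ) _ fun x hx => ?_).trans (le_of_eq ?_)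
  · have hd := infDist_pos_of_mem_cone hx
    refine (enorm_sum_le _ _).trans ?_
    rw [mul_assoc, Finset.sum_mul, Finset.mul_sum]
    refine Finset.sum_le_sum fun z hz => ?_
    rw [enorm_mul, mul_left_comm]
    refine mul_le_mul' le_rfl ((hS.enorm_le (by linarith) hK hx (hPE hz)).trans ?_)
    refine mul_le_mul' le_rfl (ENNReal.ofReal_le_ofReal ?_)
    have h1 := mem_closedBall.1 (hPj hz)
    have h2 := dist_triangle_left y j z
    exact Real.rpow_le_rpow_of_nonpos (by linarith) (by linarith) (by linarith)
  · rw [Real.div_rpow (by linarith) (by norm_num), Real.rpow_neg (x := 2) (by norm_num),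
      div_inv_eq_mul, ENNReal.ofReal_mul (p := dist y j ^ (-m)) (by positivity),
      ENNReal.coe_mul, ENNReal.coe_mul]
    simp only [ENNReal.ofReal]
    ring

/-- Each non-doubling step inward reduces the measure by `100^(-(m+1))` against a loss of `100^m` in
the kernel, so the bound is independent of `k`. The two end annuli, from `10r` to `20r` and from `L`
to `6L`, need only the growth of `τ`. -/
theorem exists_lintegral_dist_rpow_le {m : ℝ} (hm : 0 < m) (C₀ : ℝ) :
    ∃ C : ℝ≥0, ∀ (n : ℕ) (τ : Measure (Rn n)) (j : Rn n) (r : ℝ) (k : ℕ), 0 < r →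
      (∀ ρ > 0, τ (closedBall j ρ) ≤ ENNReal.ofReal (C₀ * 2 ^ m * ρ ^ m)) →
      (∀ i < k, ENNReal.ofReal (100 ^ (m + 1)) * τ (closedBall j (100 ^ i * (20 * r))) ≤
        τ (closedBall j (100 ^ (i + 1) * (20 * r)))) →
      ∫⁻ y in {y | 10 * r < dist y j ∧ dist y j ≤ 6 * (100 ^ k * (20 * r))},
        ENNReal.ofReal (dist y j ^ (-m)) ∂τ ≤ C := by
  set q : ℝ := 100 ^ (-(m + 1)) with hq
  have hq0 : 0 < q := by positivity
  refine ⟨(ENNReal.ofReal (2 * 100 ^ m) * ENNReal.ofReal (C₀ * 2 ^ m) +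
    ENNReal.ofReal (C₀ * 2 ^ m * 2 ^ m) + ENNReal.ofReal (C₀ * 2 ^ m * 6 ^ m)).toNNReal, ?_⟩
  intro n τ j r k hr hτ hk
  rw [ENNReal.coe_toNNReal (by finiteness)]
  set L := 100 ^ k * (20 * r) with hL
  have hL0 : 0 < L := by positivity
  have hring : ∀ ρ c : ℝ, 0 < ρ → 0 < c → ∫⁻ y in {y | ρ < dist y j ∧ dist y j ≤ c * ρ},
      ENNReal.ofReal (dist y j ^ (-m)) ∂τ ≤ ENNReal.ofReal (C₀ * 2 ^ m * c ^ m) := by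
    intro ρ c hρ hc
    have hmeas : MeasurableSet {y : Rn n | ρ < dist y j ∧ dist y j ≤ c * ρ} :=
      (measurableSet_lt (g := fun z => dist z j) measurable_const (by fun_prop)).inter
        (measurableSet_le (f := fun z => dist z j) (by fun_prop) measurable_const)
    calc _ ≤ ∫⁻ y in {y | ρ < dist y j ∧ dist y j ≤ c * ρ}, ENNReal.ofReal (ρ ^ (-m)) ∂τ := by
          refine setLIntegral_mono' hmeas fun y hy => ENNReal.ofReal_le_ofReal ?_
          exact Real.rpow_le_rpow_of_nonpos hρ hy.1.le (by linarith)
      _ ≤ ENNReal.ofReal (ρ ^ (-m)) * τ (closedBall j (c * ρ)) := by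
          rw [setLIntegral_const]
          exact mul_le_mul' le_rfl (measure_mono fun y hy => hy.2)
      _ ≤ ENNReal.ofReal (ρ ^ (-m)) * ENNReal.ofReal (C₀ * 2 ^ m * (c * ρ) ^ m) :=
          mul_le_mul' le_rfl (hτ _ (by positivity))
      _ = _ := by
          rw [← ENNReal.ofReal_mul (by positivity), Real.mul_rpow hc.le hρ.le, Real.rpow_neg hρ.le]
          congr 1
          field_simp
  have hchain : ∀ i ≤ k, τ (closedBall j (L / 100 ^ i)) ≤
      ENNReal.ofReal (C₀ * 2 ^ m) * ENNReal.ofReal (L ^ m * q ^ i) := by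
    intro i
    induction i with
    | zero =>
      intro _
      refine (hτ _ (by positivity)).trans (le_of_eq ?_)
      rw [← ENNReal.ofReal_mul' (by positivity)]
      simp
    | succ i ih =>
      intro hi
      have e : ∀ l ≤ k, L / 100 ^ l = 100 ^ (k - l) * (20 * r) := fun l hl => by
        rw [hL, div_eq_iff (by positivity), mul_right_comm, ← pow_add, Nat.sub_add_cancel hl]
      have h1 := hk (k - (i + 1)) (by omega)
      rw [show k - (i + 1) + 1 = k - i by omega, ← e _ hi, ← e i (by omega)] at h1
      have h2 := h1.trans (ih (by omega))
      have h3 : ENNReal.ofReal q * ENNReal.ofReal (100 ^ (m + 1)) = 1 := by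
        rw [← ENNReal.ofReal_mul hq0.le, hq, ← Real.rpow_add (by norm_num)]
        simp
      calc _ = ENNReal.ofReal q * (ENNReal.ofReal (100 ^ (m + 1)) *
            τ (closedBall j (L / 100 ^ (i + 1)))) := by rw [← mul_assoc, h3, one_mul]
        _ ≤ ENNReal.ofReal q * (ENNReal.ofReal (C₀ * 2 ^ m) * ENNReal.ofReal (L ^ m * q ^ i)) :=
            mul_le_mul' le_rfl h2
        _ = _ := by
            rw [mul_left_comm, ← ENNReal.ofReal_mul hq0.le]
            congr 2
            ring
  have hmid := lintegral_annuli_le hm hq0 (by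
    rw [hq, ← Real.rpow_add (by norm_num), show m + -(m + 1) = -1 by ring,
      Real.rpow_neg_one]
    norm_num) τ j hL0 k _ fun i hi => hchain i hi.le
  have hL20 : L / 100 ^ k = 20 * r := by rw [hL]; field_simp
  rw [hL20] at hmid
  have hcov : {y : Rn n | 10 * r < dist y j ∧ dist y j ≤ 6 * L} ⊆
      ({y | 20 * r < dist y j ∧ dist y j ≤ L} ∪ {y | 10 * r < dist y j ∧ dist y j ≤ 2 * (10 * r)}) ∪
        {y | L < dist y j ∧ dist y j ≤ 6 * L} := by
    rintro y ⟨h1, h2⟩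
    rcases le_or_gt (dist y j) (2 * (10 * r)) with h3 | h3
    · exact Or.inl (Or.inr ⟨h1, h3⟩)
    · rcases le_or_gt (dist y j) L with h4 | h4
      · exact Or.inl (Or.inl ⟨by linarith, h4⟩)
      · exact Or.inr ⟨h4, h2⟩
  refine (lintegral_mono_set hcov).trans ((lintegral_union_le _ _ _).trans
    (add_le_add ((lintegral_union_le _ _ _).trans (add_le_add hmid ?_)) ?_))
  · exact hring _ _ (by positivity) (by norm_num)
  · exact hring _ _ hL0 (by norm_num)

end ConicalSquare

/-! ### A cluster of point masses minus its compensating density. -/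

namespace ConicalSquare

open Filter Topology

variable {n : ℕ} {E : Set (Rn n)} {m α β K₁ K₂ C₀ A : ℝ} {S : Rn n → Rn n → ℂ}
  {μ : Measure (Rn n)}

/-- Cauchy–Schwarz on `W` and the `L²` bound: since `W` has measure comparable to that of `B`, the
two square roots of `μ B` combine to the total mass `|c| μ(B)`. -/
theorem lintegral_coneNorm_indicator_le (hE : IsClosed E) {G B W : Set (Rn n)}
    (hL2 : IsL2BoundedOn E α S μ A G) (hB : MeasurableSet B)
    (hBG : B ⊆ G) (hBfin : μ B ≠ ∞) {b : ℝ≥0∞} (hW : μ.restrict G W ≤ b * μ B) (c : ℂ) :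
    ∫⁻ y in W, coneNorm (coneWeight E α) E (integralOp E S μ (B.indicator fun _ => c)) y
      ∂(μ.restrict G) ≤ ENNReal.ofReal A * b ^ (1 / 2 : ℝ) * (‖c‖ₑ * μ B) := by
  set F := coneNorm (coneWeight E α) E (integralOp E S μ (B.indicator fun _ => c)) with hF
  have hsq : squareFun E α S μ (B.indicator fun _ => c) = F :=
    funext fun y => coneIntegral_eq_coneNorm hE _ y
  have h1 := hL2 (B.indicator fun _ => c) (memLp_indicator_const 2 hB c (Or.inr hBfin))
    fun y hy => indicator_of_notMem (fun h => hy (hBG h)) _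
  rw [hsq, eLpNorm_indicator_const hB (by norm_num) (by norm_num)] at h1
  have h2 := eLpNorm_le_eLpNorm_mul_rpow_measure_univ (p := 1) (q := 2)
    (μ := (μ.restrict G).restrict W) (f := F) (by norm_num)
    (measurable_coneNorm _ _).aestronglyMeasurable
  rw [eLpNorm_one_eq_lintegral_enorm] at h2
  simp only [enorm_eq_self, Measure.restrict_apply_univ] at h2
  refine h2.trans ?_
  calc _ ≤ (ENNReal.ofReal A * (‖c‖ₑ * μ B ^ (1 / (2 : ℝ≥0∞).toReal))) *
        (b * μ B) ^ (1 / (1 : ℝ≥0∞).toReal - 1 / (2 : ℝ≥0∞).toReal) := by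
        refine mul_le_mul' ((eLpNorm_mono_measure _ Measure.restrict_le_self).trans h1)
          (ENNReal.rpow_le_rpow hW (by norm_num))
    _ = ENNReal.ofReal A * b ^ (1 / 2 : ℝ) *
        (‖c‖ₑ * (μ B ^ (1 / 2 : ℝ) * μ B ^ (1 / 2 : ℝ))) := by
        rw [show 1 / (1 : ℝ≥0∞).toReal - 1 / (2 : ℝ≥0∞).toReal = 1 / 2 by norm_num,
          show 1 / (2 : ℝ≥0∞).toReal = 1 / 2 by norm_num,
          ENNReal.mul_rpow_of_nonneg _ _ (by norm_num)]
        ring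
    _ = _ := by
        rw [← ENNReal.rpow_add_of_nonneg _ _ (by norm_num) (by norm_num)]
        norm_num

/-- Away from a cluster, the square function of the difference between point masses and a spread
out mass with the same total mass has additional decay. -/
theorem exists_coneNorm_sub_le (n : ℕ) (hm : 0 < m) (hα : α ∈ Ioc (0 : ℝ) 1) (hβ : 0 < β)
    (hK : 0 < K₁) (hK₂ : 0 < K₂) :
    ∃ C : ℝ≥0, ∀ (E : Set (Rn n)) (S : Rn n → Rn n → ℂ) (μ : Measure (Rn n)), IsClosed E →
      IsKernel E m α β K₁ K₂ S → ∀ (P : Finset (Rn n)) (a : Rn n → ℂ) (j : Rn n) (L : ℝ)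
      (B : Set (Rn n)) (c : ℂ), 0 < L → j ∈ E → ↑P ⊆ E → ↑P ⊆ closedBall j L → MeasurableSet B →
      B ⊆ E → B ⊆ closedBall j L → μ B ≠ ∞ → c * (μ B).toReal = ∑ z ∈ P, a z →
      ‖c‖ₑ * μ B ≤ ∑ z ∈ P, ‖a z‖ₑ → ∀ y : Rn n, 6 * L < dist y j →
      coneNorm (coneWeight E α) E (fun x => ∑ z ∈ P, a z * S x z -
        integralOp E S μ (B.indicator fun _ => c) x) y ≤
          C * (∑ z ∈ P, ‖a z‖ₑ) * ENNReal.ofReal (L ^ β * dist y j ^ (-(m + β))) := by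
  obtain ⟨C, hC⟩ := exists_coneNorm_le_of_bound n hα (show 0 < m + β by linarith)
  refine ⟨C * (2 * (K₂ * 4 ^ (m + α + β)).toNNReal), ?_⟩
  intro E S μ hE hS P a j L B c hL hj hPE hPj hB hBE hBj hBfin hc hcN y hy
  have hα0 := hα.1
  set N := ∑ z ∈ P, ‖a z‖ₑ with hN
  refine (hC E hE _ le_rfl y (dist y j) (by linarith)
    (2 * ENNReal.ofReal (K₂ * 4 ^ (m + α + β)) * N * ENNReal.ofReal (L ^ β)) _
    fun x hx => ?_).trans (le_of_eq ?_)
  · have hd := infDist_pos_of_mem_cone hx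
    set D : ℝ := K₂ * 4 ^ (m + α + β) * L ^ β *
      (infDist x E + dist y j) ^ (-(m + β + α)) with hD
    -- For `x` in the cone at `y`, `|y - j| ≤ |x - j| + 2d(x) ≤ 3|x - j|`. The distance `6L` is thus
    -- exactly what the Hölder condition needs on `B(j, L)`.
    have hxj : 2 * L < dist x j := by
      have h1 := hx.2
      have h2 := infDist_le_dist_of_mem (x := x) hj
      have h3 := dist_triangle_left y j x
      linarith
    have hdiff : ∀ z ∈ E, z ∈ closedBall j L → ‖S x z - S x j‖ₑ ≤ ENNReal.ofReal D := by
      intro z hzE hz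
      rw [mem_closedBall, dist_comm] at hz
      rw [← ofReal_norm, norm_sub_rev]
      apply ENNReal.ofReal_le_ofReal
      refine (hS.holder x hx.1 j hj z hzE (by linarith)).trans ?_
      have h4 := infDist_add_dist_le hx hj
      rw [dist_comm j y] at h4
      have hxj0 : 0 < dist x j := by linarith
      have hp : 0 < infDist x E + dist y j := by positivity
      have h5 : (dist x j ^ (m + α + β))⁻¹ ≤
          4 ^ (m + α + β) * (infDist x E + dist y j) ^ (-(m + β + α)) := by
        rw [← Real.rpow_neg hxj0.le]
        calc dist x j ^ (-(m + α + β)) ≤ ((infDist x E + dist y j) / 4) ^ (-(m + α + β)) :=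
              Real.rpow_le_rpow_of_nonpos (by positivity) (by linarith) (by linarith)
          _ = _ := by
              rw [Real.div_rpow hp.le (by norm_num), Real.rpow_neg (x := 4) (by norm_num),
                div_inv_eq_mul, mul_comm, add_right_comm m α β]
      calc K₂ * (dist j z ^ β / dist x j ^ (m + α + β))
          = K₂ * (dist j z ^ β * (dist x j ^ (m + α + β))⁻¹) := by rw [div_eq_mul_inv]
        _ ≤ K₂ * (L ^ β * (4 ^ (m + α + β) * (infDist x E + dist y j) ^ (-(m + β + α)))) := by
            gcongr
        _ = D := by rw [hD]; ring
    set φ : Rn n → ℂ := B.indicator fun _ => c with hφ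
    have hφi : Integrable φ μ :=
      (integrable_indicator_iff hB).2 (integrableOn_const hBfin)
    have hSi : Integrable (fun z => S x z * φ z) (μ.restrict E) := by
      refine (hφi.restrict).bdd_mul
        ((hS.continuousOn hβ hx.1).aestronglyMeasurable hE.measurableSet)
        (c := K₁ * infDist x E ^ (-(m + α))) ?_
      filter_upwards [ae_restrict_mem hE.measurableSet] with z hz
      exact hS.norm_le hE (by linarith) hK hx.1 hz
    have hφint : ∫ z in E, φ z ∂μ = ∑ z ∈ P, a z := by
      rw [hφ, setIntegral_indicator hB, inter_eq_right.2 hBE, setIntegral_const, ← hc,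
        Measure.real, Complex.real_smul, mul_comm]
    have hφN : ∫⁻ z in E, ‖φ z‖ₑ ∂μ ≤ N := by
      have : ∀ z, ‖φ z‖ₑ = B.indicator (fun _ => ‖c‖ₑ) z := fun z =>
        enorm_indicator_eq_indicator_enorm _ _
      simp_rw [this]
      rw [setLIntegral_indicator hB, inter_eq_left.2 hBE, setLIntegral_const]
      exact hcN
    -- The masses and the density have the same total, so `S x j` can be subtracted from the kernel
    -- in both.
    have hrepr : ∑ z ∈ P, a z * S x z - integralOp E S μ φ x =
        ∑ z ∈ P, a z * (S x z - S x j) - ∫ z in E, (S x z - S x j) * φ z ∂μ := by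
      simp_rw [mul_sub, sub_mul]
      rw [integral_sub hSi (hφi.restrict.const_mul _), integral_const_mul, hφint,
        Finset.sum_sub_distrib, ← Finset.sum_mul, integralOp]
      ring
    rw [hrepr]
    have hsum : ‖∑ z ∈ P, a z * (S x z - S x j)‖ₑ ≤ N * ENNReal.ofReal D := by
      refine (enorm_sum_le _ _).trans ?_
      rw [hN, Finset.sum_mul]
      refine Finset.sum_le_sum fun z hz => ?_
      rw [enorm_mul]
      exact mul_le_mul' le_rfl (hdiff z (hPE hz) (hPj hz))
    have hint : ‖∫ z in E, (S x z - S x j) * φ z ∂μ‖ₑ ≤ N * ENNReal.ofReal D := by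
      refine (enorm_integral_le_lintegral_enorm _).trans ?_
      refine le_trans (setLIntegral_mono' hE.measurableSet
        (g := fun z => ‖φ z‖ₑ * ENNReal.ofReal D) fun z hz => ?_) ?_
      · rw [enorm_mul, mul_comm]
        by_cases hzB : z ∈ B
        · exact mul_le_mul' le_rfl (hdiff z hz (hBj hzB))
        · rw [hφ, indicator_of_notMem hzB]
          simp
      · rw [lintegral_mul_const' _ _ ENNReal.ofReal_ne_top]
        exact mul_le_mul' hφN le_rfl
    calc _ ≤ N * ENNReal.ofReal D + N * ENNReal.ofReal D :=
          (enorm_sub_le).trans (add_le_add hsum hint)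
      _ = _ := by
          rw [hD, ENNReal.ofReal_mul (by positivity),
            ENNReal.ofReal_mul (q := L ^ β) (by positivity)]
          ring
  · rw [ENNReal.ofReal_mul (p := L ^ β) (by positivity), ENNReal.coe_mul, ENNReal.coe_mul]
    simp only [ENNReal.ofReal]
    push_cast
    ring

/-- The estimate for a cluster of point masses, corrected by a spread out mass. -/
theorem exists_lintegral_cluster_le (n : ℕ) (hm : 0 < m) (hα : α ∈ Ioc (0 : ℝ) 1) (hβ : 0 < β)
    (hK : 0 < K₁) (hK₂ : 0 < K₂) (hC₀ : 0 < C₀) (A : ℝ) :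
    ∃ C : ℝ≥0, ∀ (E : Set (Rn n)) (S : Rn n → Rn n → ℂ) (μ : Measure (Rn n)), IsClosed E →
      IsKernel E m α β K₁ K₂ S → IsOfOrder E m C₀ μ → ∀ G : Set (Rn n),
      IsL2BoundedOn E α S μ A G → ∀ (P : Finset (Rn n)) (a : Rn n → ℂ) (j : Rn n) (r : ℝ)
      (k : ℕ) (B : Set (Rn n)) (c : ℂ), 0 < r → j ∈ E → ↑P ⊆ E → ↑P ⊆ closedBall j (5 * r) →
      MeasurableSet B → B ⊆ E → B ⊆ G → B ⊆ closedBall j (100 ^ k * (20 * r)) → μ B ≠ ∞ →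
      c * (μ B).toReal = ∑ z ∈ P, a z → ‖c‖ₑ * μ B ≤ ∑ z ∈ P, ‖a z‖ₑ →
      (∀ i < k, ENNReal.ofReal (100 ^ (m + 1)) *
        μ.restrict G (closedBall j (100 ^ i * (20 * r))) ≤
        μ.restrict G (closedBall j (100 ^ (i + 1) * (20 * r)))) →
      μ.restrict G (closedBall j (100 ^ (k + 1) * (20 * r))) ≤
        ENNReal.ofReal (100 ^ (m + 1)) * (2 * μ B) →
      ∫⁻ y in (closedBall j (10 * r))ᶜ, coneNorm (coneWeight E α) E (fun x => ∑ z ∈ P, a z * S x z -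
        integralOp E S μ (B.indicator fun _ => c) x) y ∂(μ.restrict G) ≤ C * ∑ z ∈ P, ‖a z‖ₑ := by
  obtain ⟨C₁, hC₁⟩ := coneNorm_sum_kernel_le (β := β) (K₂ := K₂) n hm hα hK
  obtain ⟨C₂, hC₂⟩ := exists_lintegral_dist_rpow_le hm C₀
  obtain ⟨C₃, hC₃⟩ := exists_coneNorm_sub_le n hm hα hβ hK hK₂
  obtain ⟨C₄, hC₄⟩ := exists_lintegral_growth_le hm hβ
  refine ⟨C₁ * C₂ + (ENNReal.ofReal A *
    (ENNReal.ofReal (100 ^ (m + 1)) * 2) ^ (1 / 2 : ℝ)).toNNReal +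
    C₃ * ((2 ^ (m + β) : ℝ).toNNReal * (C₄ * (C₀ * 2 ^ m).toNNReal)), ?_⟩
  intro E S μ hE hS hμ G hL2 P a j r k B c hr hj hPE hPj hB hBE hBG hBL hBfin hc hcN hnd hdb
  have := hμ.isLocallyFiniteMeasure hE
  have hmα : 0 < m + α := by linarith [hα.1]
  set τ := μ.restrict G with hτ
  set L := 100 ^ k * (20 * r) with hL
  have hL0 : 0 < L := by positivity
  set N := ∑ z ∈ P, ‖a z‖ₑ with hN
  set φ : Rn n → ℂ := B.indicator fun _ => c with hφ
  have hφi : Integrable φ μ := (integrable_indicator_iff hB).2 (integrableOn_const hBfin)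
  set w := coneNorm (coneWeight E α) E (fun x => ∑ z ∈ P, a z * S x z - integralOp E S μ φ x)
    with hw
  have hτball : ∀ ρ > 0, τ (closedBall j ρ) ≤ ENNReal.ofReal (C₀ * 2 ^ m * ρ ^ m) := fun ρ hρ =>
    (Measure.restrict_apply_le _ _).trans (hμ.measure_closedBall_le hj hρ)
  -- the annulus where there is no cancellation
  set U := {y : Rn n | 10 * r < dist y j ∧ dist y j ≤ 6 * L} with hU
  have hUm : MeasurableSet U :=
    (measurableSet_lt (g := fun z => dist z j) measurable_const (by fun_prop)).inter
      (measurableSet_le (f := fun z => dist z j) (by fun_prop) measurable_const)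
  have hnear : ∫⁻ y in U, w y ∂τ ≤ C₁ * C₂ * N + (ENNReal.ofReal A *
      (ENNReal.ofReal (100 ^ (m + 1)) * 2) ^ (1 / 2 : ℝ)) * N := by
    have h1 : ∀ y ∈ U, w y ≤ C₁ * N * ENNReal.ofReal (dist y j ^ (-m)) +
        coneNorm (coneWeight E α) E (integralOp E S μ φ) y := by
      intro y hy
      have h2 : w y ≤ coneNorm (coneWeight E α) E (fun x => ∑ z ∈ P, a z * S x z) y +
          coneNorm (coneWeight E α) E (fun x => (-1) * integralOp E S μ φ x) y := by
        refine le_trans (le_of_eq ?_) (coneNorm_add_le _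
          (hS.aestronglyMeasurable_sum P hPE a coneWeight_absolutelyContinuous)
          ((aestronglyMeasurable_integralOp hE hS hmα hβ hK hφi
            coneWeight_absolutelyContinuous).const_mul (-1)) y)
        rw [hw]
        congr 1
        ext x
        ring
      rw [coneNorm_const_mul] at h2
      refine h2.trans (add_le_add (hC₁ E S hE hS P a j r hr hPE hPj y hy.1) (le_of_eq ?_))
      simp
    refine (setLIntegral_mono' hUm h1).trans ?_
    rw [lintegral_add_right _ (measurable_coneNorm _ _), lintegral_const_mul _ (by fun_prop)]
    refine add_le_add ?_ ?_
    · refine (mul_le_mul' le_rfl (hC₂ n τ j r k hr hτball hnd)).trans (le_of_eq ?_)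
      ring
    -- The annulus `U` lies in `B(j, 100L)`, whose measure is controlled by that of `B` through the
    -- doubling hypothesis at scale `k`.
    · refine (lintegral_coneNorm_indicator_le hE hL2 hB hBG hBfin
        (b := ENNReal.ofReal (100 ^ (m + 1)) * 2) (W := U) ?_ c).trans (mul_le_mul' le_rfl hcN)
      rw [mul_assoc]
      refine (measure_mono fun y hy => ?_).trans hdb
      rw [mem_closedBall]
      have := hy.2
      rw [pow_succ, mul_right_comm]
      linarith
  -- The cancellation provides a factor `L^β |y - j|^(-(m+β))`, whose integral against a measure of
  -- order `m` is bounded independently of `L`.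
  have hfar : ∫⁻ y in {y | 6 * L < dist y j}, w y ∂τ ≤
      C₃ * ((2 ^ (m + β) : ℝ).toNNReal * (C₄ * (C₀ * 2 ^ m).toNNReal)) * N := by
    have hVm : MeasurableSet {y : Rn n | 6 * L < dist y j} :=
      measurableSet_lt (g := fun z => dist z j) measurable_const (by fun_prop)
    have hPL : ↑P ⊆ closedBall j L := hPj.trans (closedBall_subset_closedBall (by
      have : (1 : ℝ) ≤ 100 ^ k := one_le_pow₀ (by norm_num)
      rw [hL]
      nlinarith))
    have h1 : ∀ y ∈ {y | 6 * L < dist y j}, w y ≤ C₃ * N * (ENNReal.ofReal (2 ^ (m + β)) *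
        ENNReal.ofReal (L ^ β)) * ENNReal.ofReal ((L + dist y j) ^ (-(m + β))) := by
      intro y hy
      have hy' : 6 * L < dist y j := hy
      refine (hC₃ E S μ hE hS P a j L B c hL0 hj hPE hPL hB hBE hBL hBfin hc hcN y hy).trans ?_
      rw [mul_assoc _ _ (ENNReal.ofReal ((L + dist y j) ^ (-(m + β))))]
      refine mul_le_mul' le_rfl ?_
      rw [← ENNReal.ofReal_mul (by positivity), ← ENNReal.ofReal_mul (by positivity)]
      apply ENNReal.ofReal_le_ofReal
      have h2 : dist y j ^ (-(m + β)) ≤ 2 ^ (m + β) * (L + dist y j) ^ (-(m + β)) := by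
        calc dist y j ^ (-(m + β)) ≤ ((L + dist y j) / 2) ^ (-(m + β)) :=
              Real.rpow_le_rpow_of_nonpos (by positivity) (by linarith) (by linarith)
          _ = _ := by
              rw [Real.div_rpow (by positivity) (by norm_num), Real.rpow_neg (x := 2) (by norm_num),
                div_inv_eq_mul, mul_comm]
      calc L ^ β * dist y j ^ (-(m + β)) ≤
            L ^ β * (2 ^ (m + β) * (L + dist y j) ^ (-(m + β))) := by gcongr
        _ = _ := by ring
    refine (setLIntegral_mono' hVm h1).trans ((setLIntegral_le_lintegral _ _).trans ?_)
    rw [lintegral_const_mul _ (by fun_prop)]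
    have h3 := hC₄ n τ j L (ENNReal.ofReal (C₀ * 2 ^ m)) hL0 fun ρ hρ => by
      refine (hτball ρ (by linarith)).trans (le_of_eq ?_)
      rw [ENNReal.ofReal_mul (by positivity)]
    refine (mul_le_mul' le_rfl h3).trans (le_of_eq ?_)
    have h4 : ENNReal.ofReal (L ^ β) * ENNReal.ofReal (L ^ (-β)) = 1 := by
      rw [← ENNReal.ofReal_mul (by positivity), ← Real.rpow_add hL0]
      simp
    calc _ = C₃ * (ENNReal.ofReal (2 ^ (m + β)) * (C₄ * ENNReal.ofReal (C₀ * 2 ^ m))) * N *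
          (ENNReal.ofReal (L ^ β) * ENNReal.ofReal (L ^ (-β))) := by ring
      _ = _ := by rw [h4, mul_one]; rfl
  have hcov : (closedBall j (10 * r))ᶜ ⊆ U ∪ {y | 6 * L < dist y j} := by
    intro y hy
    rw [mem_compl_iff, mem_closedBall, not_le] at hy
    rcases le_or_gt (dist y j) (6 * L) with h | h
    · exact Or.inl ⟨hy, h⟩
    · exact Or.inr h
  refine (lintegral_mono_set hcov).trans ((lintegral_union_le _ _ _).trans
    ((add_le_add hnear hfar).trans (le_of_eq ?_)))
  push_cast
  rw [ENNReal.coe_toNNReal]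
  · ring
  · exact ENNReal.mul_ne_top ENNReal.ofReal_ne_top
      (ENNReal.rpow_ne_top_of_nonneg (by norm_num) (by finiteness))

end ConicalSquare

/-! ### Stopping radii and doubling scales for point masses. -/

namespace ConicalSquare

open Filter Topology

variable {n : ℕ} {E : Set (Rn n)} {m α β K₁ K₂ C₀ A : ℝ} {S : Rn n → Rn n → ℂ}
  {μ : Measure (Rn n)}

/-- The mass of the point masses `a` on `s` in a closed ball. -/
noncomputable def ballMass (s : Finset (Rn n)) (a : Rn n → ℂ) (z : Rn n) (ρ : ℝ) : ℝ≥0∞ :=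
  ∑ z' ∈ s, (closedBall z ρ).indicator (fun z' => ‖a z'‖ₑ) z'

theorem ballMass_le (s : Finset (Rn n)) (a : Rn n → ℂ) (z : Rn n) (ρ : ℝ) :
    ballMass s a z ρ ≤ ∑ z ∈ s, ‖a z‖ₑ :=
  Finset.sum_le_sum fun z' _ => indicator_le_self' (fun _ _ => zero_le) z'

theorem sum_le_ballMass {s s' : Finset (Rn n)} (hs' : s' ⊆ s) (a : Rn n → ℂ) {z : Rn n} {ρ : ℝ}
    (h : ∀ z' ∈ s', z' ∈ closedBall z ρ) : ∑ z' ∈ s', ‖a z'‖ₑ ≤ ballMass s a z ρ := by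
  refine le_trans (Finset.sum_le_sum fun z' hz' => ?_)
    (Finset.sum_le_sum_of_subset (f := (closedBall z ρ).indicator fun z' => ‖a z'‖ₑ) hs')
  rw [indicator_of_mem (h z' hz')]

/-- At small radii the single mass at `z` beats `t τ(B(z, 10r))`, by the growth of `τ`; at large
radii the total mass is too small. Choosing `r` above half the supremum of the admissible radii
makes the reverse inequality hold from `2r` on. -/
theorem exists_stopping_radius (hm : 0 < m) {τ : Measure (Rn n)} (s : Finset (Rn n))
    (a : Rn n → ℂ) {t : ℝ} (ht : 0 < t) {z : Rn n} (hz : z ∈ s) (haz : a z ≠ 0)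
    (hτ : ∀ ρ > 0, τ (closedBall z ρ) ≤ ENNReal.ofReal (C₀ * ρ ^ m))
    (hN : ∑ z ∈ s, ‖a z‖ₑ < ENNReal.ofReal t * τ univ) :
    ∃ r : ℝ, 0 < r ∧ ENNReal.ofReal t * τ (closedBall z (10 * r)) < ballMass s a z r ∧
      ∀ ρ, 2 * r ≤ ρ → ballMass s a z ρ ≤ ENNReal.ofReal t * τ (closedBall z (10 * ρ)) := by
  set T := {r : ℝ | 0 < r ∧ ENNReal.ofReal t * τ (closedBall z (10 * r)) < ballMass s a z r} with hT
  have hne : T.Nonempty := by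
    have h1 : Tendsto (fun r : ℝ => t * (C₀ * (10 * r) ^ m)) (𝓝[>] 0)
        (𝓝 (t * (C₀ * (10 * 0) ^ m))) := by
      refine (ContinuousAt.tendsto ?_).mono_left nhdsWithin_le_nhds
      exact continuousAt_const.mul (continuousAt_const.mul
        ((continuousAt_const.mul continuousAt_id).rpow_const (Or.inr hm.le)))
    rw [mul_zero, Real.zero_rpow hm.ne', mul_zero, mul_zero] at h1
    obtain ⟨r, hr1, hr0⟩ := ((h1.eventually_lt_const (norm_pos_iff.2 haz)).and
      self_mem_nhdsWithin).exists
    refine ⟨r, hr0, ?_⟩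
    calc ENNReal.ofReal t * τ (closedBall z (10 * r))
        ≤ ENNReal.ofReal t * ENNReal.ofReal (C₀ * (10 * r) ^ m) :=
          mul_le_mul' le_rfl (hτ _ (by positivity))
      _ = ENNReal.ofReal (t * (C₀ * (10 * r) ^ m)) := (ENNReal.ofReal_mul ht.le).symm
      _ < ENNReal.ofReal ‖a z‖ := (ENNReal.ofReal_lt_ofReal_iff (norm_pos_iff.2 haz)).2 hr1
      _ = ∑ z' ∈ {z}, ‖a z'‖ₑ := by rw [Finset.sum_singleton, ofReal_norm]
      _ ≤ _ := sum_le_ballMass (Finset.singleton_subset_iff.2 hz) a fun z' hz' => by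
          rw [Finset.mem_singleton.1 hz']
          exact mem_closedBall_self hr0.le
  obtain ⟨R, hR⟩ : ∃ R : ℕ, ∑ z ∈ s, ‖a z‖ₑ < ENNReal.ofReal t * τ (closedBall z R) := by
    have hmono : Monotone fun k : ℕ => closedBall z (k : ℝ) := fun i j hij =>
      closedBall_subset_closedBall (by exact_mod_cast hij)
    rw [← iUnion_closedBall_nat z, hmono.measure_iUnion, ENNReal.mul_iSup] at hN
    exact lt_iSup_iff.1 hN
  have hbdd : BddAbove T := ⟨R, fun r hr => by
    by_contra hcon
    rw [not_le] at hcon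
    refine absurd hr.2 (not_lt.2 ((ballMass_le s a z r).trans (hR.le.trans ?_)))
    refine mul_le_mul' le_rfl (measure_mono (closedBall_subset_closedBall ?_))
    linarith [hr.1]⟩
  obtain ⟨r₀, hr₀⟩ := hne
  have hsup : 0 < sSup T := hr₀.1.trans_le (le_csSup hbdd hr₀)
  obtain ⟨r, hr, hr2⟩ := exists_lt_of_lt_csSup ⟨r₀, hr₀⟩ (show sSup T / 2 < sSup T by linarith)
  refine ⟨r, hr.1, hr.2, fun ρ hρ => ?_⟩
  by_contra hcon
  have hρT : ρ ∈ T := ⟨by linarith [hr.1], not_le.1 hcon⟩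
  linarith [le_csSup hbdd hρT]

/-- A finite measure cannot grow by a factor `b ≥ 2` at every scale; the first scale that stops
growing is taken. -/
theorem exists_doubling_scale {τ : Measure (Rn n)} [IsFiniteMeasure τ] {b : ℝ≥0∞} (hb : 2 ≤ b)
    (z : Rn n) {r : ℝ} (hτ : τ (closedBall z r) ≠ 0) :
    ∃ k : ℕ, τ (closedBall z (100 ^ (k + 1) * r)) ≤ b * τ (closedBall z (100 ^ k * r)) ∧
      ∀ i < k, b * τ (closedBall z (100 ^ i * r)) ≤ τ (closedBall z (100 ^ (i + 1) * r)) := by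
  have hex : ∃ k : ℕ, τ (closedBall z (100 ^ (k + 1) * r)) ≤
      b * τ (closedBall z (100 ^ k * r)) := by
    by_contra! hcon
    have h1 : ∀ k : ℕ, 2 ^ k * τ (closedBall z r) ≤ τ (closedBall z (100 ^ k * r)) := by
      intro k
      induction k with
      | zero => simp
      | succ k ih =>
        calc 2 ^ (k + 1) * τ (closedBall z r) = 2 * (2 ^ k * τ (closedBall z r)) := by ring
          _ ≤ b * τ (closedBall z (100 ^ k * r)) := mul_le_mul' hb ih
          _ ≤ _ := (hcon k).le
    obtain ⟨k, hk⟩ := ENNReal.exists_nat_mul_gt hτ (measure_ne_top τ univ)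
    refine absurd hk (not_lt.2 (le_trans (mul_le_mul' ?_ le_rfl)
      ((h1 k).trans (measure_mono (subset_univ _)))))
    exact_mod_cast k.lt_two_pow_self.le
  classical
  exact ⟨Nat.find hex, Nat.find_spec hex, fun i hi => (not_le.1 (Nat.find_min hex hi)).le⟩

theorem integralOp_sum (hE : IsClosed E) (hS : IsKernel E m α β K₁ K₂ S)
    (hmα : 0 < m + α) (hβ : 0 < β) (hK : 0 < K₁) {ι : Type*} (v : Finset ι) {f : ι → Rn n → ℂ}
    (hf : ∀ i, Integrable (f i) μ) {x : Rn n} (hx : x ∉ E) :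
    integralOp E S μ (fun z => ∑ i ∈ v, f i z) x = ∑ i ∈ v, integralOp E S μ (f i) x := by
  classical
  induction v using Finset.induction_on with
  | empty => simp [integralOp]
  | insert i v hi ih =>
    simp_rw [Finset.sum_insert hi]
    rw [integralOp_add hE hS hmα hβ hK (hf i) (integrable_finsetSum v fun i _ => hf i) hx, ih]

end ConicalSquare

/-! ### The Calderón–Zygmund decomposition. -/

namespace ConicalSquare

open Filter Topology

variable {n : ℕ} {E : Set (Rn n)} {m α β K₁ K₂ C₀ A : ℝ} {S : Rn n → Rn n → ℂ}
  {μ : Measure (Rn n)}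

/-- Chebyshev's inequality in `L²` combined with `‖g‖₂² ≤ ‖g‖_∞ ‖g‖₁`; it is meant for the bounded
part of the decomposition. -/
theorem IsL2BoundedOn.measure_le (hE : IsClosed E) {G : Set (Rn n)}
    (hL2 : IsL2BoundedOn E α S μ A G) {g : Rn n → ℂ} (hg : MemLp g 2 μ) (hgG : ∀ y ∉ G, g y = 0)
    {H N : ℝ≥0∞} (hH : H ≠ ∞) (hgH : ∀ y, ‖g y‖ₑ ≤ H) (hgN : ∫⁻ y, ‖g y‖ₑ ∂μ ≤ N) (t : ℝ≥0∞) :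
    t ^ 2 * μ.restrict G {y | t < coneNorm (coneWeight E α) E (integralOp E S μ g) y} ≤
      ENNReal.ofReal A ^ 2 * (H * N) := by
  set F := coneNorm (coneWeight E α) E (integralOp E S μ g) with hF
  have hsq : squareFun E α S μ g = F := funext fun y => coneIntegral_eq_coneNorm hE _ y
  have h1 := hL2 g hg hgG
  rw [hsq] at h1
  have h2 := mul_meas_ge_le_pow_eLpNorm' (μ.restrict G) (p := 2) (f := F) (by norm_num)
    (by norm_num) (measurable_coneNorm _ _).aestronglyMeasurable t
  simp only [enorm_eq_self, ENNReal.toReal_ofNat, ENNReal.rpow_ofNat] at h2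
  have h3 : eLpNorm g 2 μ ^ 2 ≤ H * N := by
    have e := eLpNorm_nnreal_pow_eq_lintegral (μ := μ) (f := g) (p := 2) (by norm_num)
    simp only [NNReal.coe_ofNat, ENNReal.coe_ofNat, ENNReal.rpow_ofNat] at e
    rw [e]
    calc ∫⁻ x, ‖g x‖ₑ ^ 2 ∂μ ≤ ∫⁻ x, H * ‖g x‖ₑ ∂μ := by
          refine lintegral_mono fun x => ?_
          rw [sq]
          exact mul_le_mul' (hgH x) le_rfl
      _ = H * ∫⁻ x, ‖g x‖ₑ ∂μ := lintegral_const_mul' _ _ hH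
      _ ≤ _ := mul_le_mul' le_rfl hgN
  calc _ ≤ t ^ 2 * μ.restrict G {y | t ≤ F y} :=
        mul_le_mul' le_rfl (measure_mono fun y hy => le_of_lt (show t < F y from hy))
    _ ≤ eLpNorm F 2 (μ.restrict G) ^ 2 := h2
    _ ≤ (ENNReal.ofReal A * eLpNorm g 2 μ) ^ 2 := by gcongr
    _ = ENNReal.ofReal A ^ 2 * eLpNorm g 2 μ ^ 2 := mul_pow _ _ _
    _ ≤ _ := mul_le_mul' le_rfl h3

/-- The Calderón–Zygmund decomposition of a finite sum of point masses `a` on `s` relative to a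
finite measure, at height `t`. -/
theorem exists_calderonZygmund (hm : 0 < m) {τ : Measure (Rn n)} [IsFiniteMeasure τ]
    (s : Finset (Rn n)) (a : Rn n → ℂ) (ha : ∀ z ∈ s, a z ≠ 0) {t : ℝ} (ht : 0 < t)
    (hτ : ∀ z ∈ s, ∀ ρ > 0, τ (closedBall z ρ) ≤ ENNReal.ofReal (C₀ * ρ ^ m))
    (hN : ∑ z ∈ s, ‖a z‖ₑ < ENNReal.ofReal t * τ univ) {b : ℝ} (hb : 2 ≤ b) :
    ∃ (v : Finset (Rn n)) (r : Rn n → ℝ) (P : Rn n → Finset (Rn n)) (k : Rn n → ℕ)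
      (B : Rn n → Set (Rn n)), v ⊆ s ∧ (∀ j ∈ v, 0 < r j) ∧ (∀ j ∈ v, P j ⊆ s) ∧
      (∀ j ∈ v, ↑(P j) ⊆ closedBall j (5 * r j)) ∧
      (∀ {M : Type} [AddCommMonoid M] (f : Rn n → M), ∑ j ∈ v, ∑ z ∈ P j, f z = ∑ z ∈ s, f z) ∧
      ENNReal.ofReal t * τ (⋃ j ∈ v, closedBall j (10 * r j)) ≤ ∑ z ∈ s, ‖a z‖ₑ ∧
      (∀ j ∈ v, B j ⊆ closedBall j (100 ^ k j * (20 * r j)) ∧ MeasurableSet (B j) ∧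
        τ (B j) ≠ 0 ∧
        τ (closedBall j (100 ^ (k j + 1) * (20 * r j))) ≤ ENNReal.ofReal b * (2 * τ (B j)) ∧
        ∀ i < k j, ENNReal.ofReal b * τ (closedBall j (100 ^ i * (20 * r j))) ≤
          τ (closedBall j (100 ^ (i + 1) * (20 * r j)))) ∧
      ∀ x, ∑ j ∈ v, (B j).indicator (fun _ => (∑ z ∈ P j, ‖a z‖ₑ) / τ (B j)) x ≤
        4 * (ENNReal.ofReal t * ENNReal.ofReal b) := by
  classical
  have hb0 : 0 < b := by linarith
  have hb2 : 2 ≤ ENNReal.ofReal b := by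
    rw [show (2 : ℝ≥0∞) = ENNReal.ofReal 2 by simp]
    exact ENNReal.ofReal_le_ofReal hb
  choose! r hr0 hr1 hr2 using fun z (hz : z ∈ s) =>
    exists_stopping_radius hm s a ht hz (ha z hz) (hτ z hz) hN
  obtain ⟨u, hus, hdisj, hcov⟩ := Vitali.exists_disjoint_subfamily_covering_enlargement_closedBall
    (↑s : Set (Rn n)) (fun z => z) r (∑ z ∈ s, r z)
    (fun z hz => Finset.single_le_sum (fun i hi => (hr0 i hi).le) hz) 5 (by norm_num)
  choose! J hJu hJ using hcov
  set v := s.filter (· ∈ u) with hv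
  have hvs : v ⊆ s := Finset.filter_subset _ _
  have hvu : ∀ j ∈ v, j ∈ u := fun j hj => (Finset.mem_filter.1 hj).2
  have hJv : ∀ z ∈ s, J z ∈ v := fun z hz => Finset.mem_filter.2 ⟨hus (hJu z hz), hJu z hz⟩
  -- Each point mass is assigned to one selected ball whose fivefold enlargement contains it, so the
  -- clusters partition `s`.
  set P : Rn n → Finset (Rn n) := fun j => s.filter (J · = j) with hP
  have hPj : ∀ j ∈ v, ↑(P j) ⊆ closedBall j (5 * r j) := by
    intro j _ z hz
    obtain ⟨hzs, rfl⟩ := Finset.mem_filter.1 (Finset.mem_coe.1 hz)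
    exact hJ z hzs (mem_closedBall_self (hr0 z hzs).le)
  -- The stopping inequality at radius `2r` bounds the nonzero mass at `j` by `t τ(B(j, 20r))`; this
  -- is why doubling scales start at `20r`.
  have hτ20 : ∀ j ∈ v, τ (closedBall j (20 * r j)) ≠ 0 := by
    intro j hj h0
    have hjs := hvs hj
    have h1 := hr2 j hjs (2 * r j) le_rfl
    rw [show 10 * (2 * r j) = 20 * r j by ring, h0, mul_zero] at h1
    have h2 : ∑ z ∈ {j}, ‖a z‖ₑ ≤ ballMass s a j (2 * r j) :=
      sum_le_ballMass (Finset.singleton_subset_iff.2 hjs) a fun z' hz' => by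
        rw [Finset.mem_singleton.1 hz']
        exact mem_closedBall_self (by linarith [hr0 j hjs])
    rw [Finset.sum_singleton] at h2
    exact ha j hjs (enorm_eq_zero.1 (le_antisymm (h2.trans h1) zero_le))
  choose! k hk1 hk2 using fun j (hj : j ∈ v) => exists_doubling_scale hb2 j (hτ20 j hj)
  set R : Rn n → ℝ := fun j => 100 ^ k j * (20 * r j) with hR
  have hR20 : ∀ j ∈ v, 20 * r j ≤ R j := by
    intro j hj
    have h1 : (1 : ℝ) ≤ 100 ^ k j := one_le_pow₀ (by norm_num)
    have h2 := hr0 j (hvs hj)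
    rw [hR]
    nlinarith
  have hQ0 : ∀ j ∈ v, τ (closedBall j (R j)) ≠ 0 := fun j hj h0 =>
    hτ20 j hj (measure_mono_null (closedBall_subset_closedBall (hR20 j hj)) h0)
  obtain ⟨B, hB, hBsum⟩ := exists_spreading τ v (fun j => closedBall j (R j)) R
    (fun j => ∑ z ∈ P j, ‖a z‖ₑ) (Λ := ENNReal.ofReal t * ENNReal.ofReal b)
    (mul_ne_zero (by simpa using ht) (by simpa using hb0)) (by finiteness)
    (fun _ _ => measurableSet_closedBall) hQ0 (fun _ _ => measure_ne_top _ _) (by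
      intro j hj s' hs' hRj
      have hrj := hr0 j (hvs hj)
      rw [Finset.sum_fiberwise_eq_sum_filter]
      -- A mass in the cluster of `i` is within `5 r i ≤ R i / 4` of `i`, and `|i - j| ≤ R i + R j ≤
      -- 2 R j`. The stopping inequality at radius `3 R j` gives a ball of radius `30 R j`, still
      -- inside the hundredfold ball controlled by doubling.
      calc ∑ z ∈ s with J z ∈ s', ‖a z‖ₑ ≤ ballMass s a j (3 * R j) := by
            refine sum_le_ballMass (Finset.filter_subset _ _) a fun z hz => ?_
            obtain ⟨hzs, hzJ⟩ := Finset.mem_filter.1 hz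
            obtain ⟨h1, x, hx1, hx2⟩ := hRj _ hzJ
            have h2 := hJ z hzs (mem_closedBall_self (hr0 z hzs).le)
            have h3 := hR20 _ (hs' hzJ)
            have h4 := hr0 _ (hvs (hs' hzJ))
            rw [mem_closedBall] at hx1 hx2 h2 ⊢
            have h5 := dist_triangle z (J z) j
            have h6 := dist_triangle_left (J z) j x
            linarith
        _ ≤ ENNReal.ofReal t * τ (closedBall j (10 * (3 * R j))) :=
            hr2 j (hvs hj) _ (by linarith [hR20 j hj])
        _ ≤ ENNReal.ofReal t * τ (closedBall j (100 ^ (k j + 1) * (20 * r j))) := by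
            refine mul_le_mul' le_rfl (measure_mono (closedBall_subset_closedBall ?_))
            rw [pow_succ, mul_right_comm]
            change _ ≤ R j * 100
            linarith [hR20 j hj]
        _ ≤ _ := by
            rw [mul_assoc]
            exact mul_le_mul' le_rfl (hk1 j hj))
  refine ⟨v, r, P, k, B, hvs, fun j hj => hr0 j (hvs hj), fun j _ => Finset.filter_subset _ _, hPj,
    fun f => Finset.sum_fiberwise_of_maps_to hJv f, ?_, fun j hj => ?_, hBsum⟩
  · calc ENNReal.ofReal t * τ (⋃ j ∈ v, closedBall j (10 * r j))
        ≤ ENNReal.ofReal t * ∑ j ∈ v, τ (closedBall j (10 * r j)) :=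
          mul_le_mul' le_rfl (measure_biUnion_finset_le _ _)
      _ = ∑ j ∈ v, ENNReal.ofReal t * τ (closedBall j (10 * r j)) := Finset.mul_sum _ _ _
      -- The selected balls of radius `r j` are disjoint, so each point mass is counted at most
      -- once.
      _ ≤ ∑ j ∈ v, ballMass s a j (r j) := Finset.sum_le_sum fun j hj => (hr1 j (hvs hj)).le
      _ = ∑ z ∈ s, ∑ j ∈ v, (closedBall j (r j)).indicator (fun z => ‖a z‖ₑ) z := by
          simp only [ballMass]
          exact Finset.sum_comm
      _ ≤ ∑ z ∈ s, ‖a z‖ₑ := by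
          refine Finset.sum_le_sum fun z _ => ?_
          by_cases hz : ∃ j ∈ v, z ∈ closedBall j (r j)
          · obtain ⟨j, hj, hzj⟩ := hz
            rw [Finset.sum_eq_single_of_mem j hj fun i hi hij => ?_]
            · exact indicator_le_self' (fun _ _ => zero_le) z
            · refine indicator_of_notMem (fun hzi => ?_) _
              exact (hdisj (hvu i hi) (hvu j hj) hij).le_bot ⟨hzi, hzj⟩
          · rw [Finset.sum_eq_zero fun j hj => indicator_of_notMem (fun h => hz ⟨j, hj, h⟩) _]
            exact zero_le
  · obtain ⟨h1, h2, h3⟩ := hB j hj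
    refine ⟨h1, h2, fun h0 => hQ0 j hj ?_, ?_, hk2 j hj⟩
    · rw [h0, mul_zero] at h3
      exact le_antisymm h3 zero_le
    · exact (hk1 j hj).trans (mul_le_mul' le_rfl h3)

end ConicalSquare

/-! ### `L²` boundedness implies the discrete weak type bound. -/

namespace ConicalSquare

open Filter Topology

variable {n : ℕ} {E : Set (Rn n)} {m α β K₁ K₂ C₀ b κ θ A : ℝ} {S : Rn n → Rn n → ℂ}
  {μ : Measure (Rn n)}

/-- `L²` bounds on a set imply weak type bounds for sums of point masses. -/
theorem exists_isDiscreteWeakBoundedOn (n : ℕ) (hm : 0 < m) (hα : α ∈ Ioc (0 : ℝ) 1) (hβ : 0 < β)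
    (hK : 0 < K₁) (hK₂ : 0 < K₂) (hC₀ : 0 < C₀) (A : ℝ) :
    ∃ A' : ℝ, 0 < A' ∧ ∀ (E : Set (Rn n)) (S : Rn n → Rn n → ℂ) (μ : Measure (Rn n)), IsClosed E →
      IsKernel E m α β K₁ K₂ S → IsOfOrder E m C₀ μ → ∀ G : Set (Rn n), MeasurableSet G → G ⊆ E →
      μ G ≠ ∞ → IsL2BoundedOn E α S μ A G → IsDiscreteWeakBoundedOn E α S μ A' G := by
  obtain ⟨C, hC⟩ := exists_lintegral_cluster_le n hm hα hβ hK hK₂ hC₀ A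
  set b : ℝ := 100 ^ (m + 1) with hb
  have hb2 : 2 ≤ b := by
    calc (2 : ℝ) ≤ 100 ^ (1 : ℝ) := by norm_num
      _ ≤ b := Real.rpow_le_rpow_of_exponent_le (by norm_num) (by linarith)
  have hb0 : 0 < b := by linarith
  -- The three terms come from the union of the balls `B(j, 10 r j)`, from the compensated clusters
  -- outside it at height `t / 2`, and from the good part at height `t / 2`.
  set c₀ : ℝ := 1 + 2 * C + 16 * (ENNReal.ofReal A).toReal ^ 2 * b with hc₀
  have hc₀1 : 1 ≤ c₀ := by
    have : 0 ≤ 2 * (C : ℝ) + 16 * (ENNReal.ofReal A).toReal ^ 2 * b := by positivity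
    linarith
  refine ⟨c₀, by linarith, ?_⟩
  intro E S μ hE hS hμ G hG hGE hGfin hL2
  have := hμ.isLocallyFiniteMeasure hE
  have hmα : 0 < m + α := by linarith [hα.1]
  -- it suffices to consider nonzero point masses
  suffices h : ∀ (s : Finset (Rn n)) (a : Rn n → ℂ), ↑s ⊆ E → (∀ z ∈ s, a z ≠ 0) → ∀ t : ℝ, 0 < t →
      ENNReal.ofReal t * μ.restrict G {y | ENNReal.ofReal t < coneNorm (coneWeight E α) E
        (fun x => ∑ z ∈ s, a z * S x z) y} ≤ ENNReal.ofReal c₀ * ∑ z ∈ s, ‖a z‖ₑ by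
    intro s a hs t ht
    classical
    have h1 := h (s.filter (a · ≠ 0)) a (fun z hz => hs (Finset.mem_filter.1 hz).1)
      (fun z hz => (Finset.mem_filter.1 hz).2) t ht
    have e1 : ∀ x, ∑ z ∈ s with a z ≠ 0, a z * S x z = ∑ z ∈ s, a z * S x z := fun x =>
      Finset.sum_filter_of_ne fun z _ hz h0 => hz (by rw [h0, zero_mul])
    have e2 : ∑ z ∈ s with a z ≠ 0, ‖a z‖ₑ = ∑ z ∈ s, ‖a z‖ₑ :=
      Finset.sum_filter_of_ne fun z _ hz h0 => hz (by rw [h0, enorm_zero])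
    simp_rw [e1, e2] at h1
    rw [Measure.restrict_apply (measurableSet_lt measurable_const (measurable_coneNorm _ _)),
      inter_comm] at h1
    rw [ENNReal.ofReal_div_of_pos ht, ENNReal.div_eq_inv_mul, mul_assoc,
      ← ENNReal.mul_le_iff_le_inv (by simpa using ht) ENNReal.ofReal_ne_top]
    exact h1
  intro s a hs ha t ht
  set τ := μ.restrict G with hτ
  have : IsFiniteMeasure τ := ⟨by
    rw [hτ, Measure.restrict_apply_univ]
    exact hGfin.lt_top⟩
  set N := ∑ z ∈ s, ‖a z‖ₑ with hN
  -- When the height is too low for stopping radii to exist, the trivial bound by the full measure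
  -- of `G` suffices.
  rcases le_or_gt (ENNReal.ofReal t * τ univ) N with hbig | hsmall
  · calc _ ≤ ENNReal.ofReal t * τ univ := mul_le_mul' le_rfl (measure_mono (subset_univ _))
      _ ≤ 1 * N := by rwa [one_mul]
      _ ≤ _ := mul_le_mul' (by rwa [ENNReal.one_le_ofReal]) le_rfl
  obtain ⟨v, r, P, k, B', hvs, hr, hPs, hPj, hPsum, hEx, hB', hBsum⟩ :=
    exists_calderonZygmund hm s a ha ht (τ := τ) (C₀ := C₀ * 2 ^ m) (fun z hz ρ hρ =>
      (Measure.restrict_apply_le _ _).trans (hμ.measure_closedBall_le (hs hz) hρ)) hsmall hb2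
  -- Intersecting with `G` keeps the measure `τ = μ⌊G` and makes the compensating functions vanish
  -- outside `G`, as the `L²` hypothesis requires. The empty value outside `v` makes measurability
  -- and integrability hold for every index.
  set B : Rn n → Set (Rn n) := fun j => if j ∈ v then B' j ∩ G else ∅ with hB
  have hBv : ∀ j ∈ v, B j = B' j ∩ G := fun j hj => if_pos hj
  have hBm : ∀ j, MeasurableSet (B j) := fun j => by
    by_cases hj : j ∈ v
    · rw [hBv j hj]; exact (hB' j hj).2.1.inter hG
    · simp only [hB, if_neg hj]; exact MeasurableSet.empty
  have hBG : ∀ j, B j ⊆ G := fun j => by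
    by_cases hj : j ∈ v
    · rw [hBv j hj]; exact inter_subset_right
    · simp only [hB, if_neg hj]; exact empty_subset _
  have hμB : ∀ j ∈ v, τ (B' j) = μ (B j) := fun j hj => by
    rw [hBv j hj, hτ, Measure.restrict_apply (hB' j hj).2.1]
  have hBfin : ∀ j, μ (B j) ≠ ∞ := fun j => ne_top_of_le_ne_top hGfin (measure_mono (hBG j))
  have hB0 : ∀ j ∈ v, μ (B j) ≠ 0 := fun j hj => hμB j hj ▸ (hB' j hj).2.2.1
  set c : Rn n → ℂ := fun j => (∑ z ∈ P j, a z) / ((μ (B j)).toReal : ℂ) with hc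
  have hcB : ∀ j ∈ v, c j * (μ (B j)).toReal = ∑ z ∈ P j, a z := fun j hj =>
    div_mul_cancel₀ _ (by exact_mod_cast (ENNReal.toReal_pos (hB0 j hj) (hBfin j)).ne')
  have hcN : ∀ j ∈ v, ‖c j‖ₑ * μ (B j) ≤ ∑ z ∈ P j, ‖a z‖ₑ := fun j hj => by
    have h1 : ‖c j‖ₑ * μ (B j) = ‖∑ z ∈ P j, a z‖ₑ := by
      rw [← hcB j hj, enorm_mul]
      congr 1
      rw [← ofReal_norm, Complex.norm_real, Real.norm_of_nonneg ENNReal.toReal_nonneg,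
        ENNReal.ofReal_toReal (hBfin j)]
    rw [h1]
    exact enorm_sum_le _ _
  set φ : Rn n → Rn n → ℂ := fun j => (B j).indicator fun _ => c j with hφ
  have hφi : ∀ j, Integrable (φ j) μ := fun j =>
    (integrable_indicator_iff (hBm j)).2 (integrableOn_const (hBfin j))
  set g : Rn n → ℂ := fun y => ∑ j ∈ v, φ j y with hg
  have hφe : ∀ j y, ‖φ j y‖ₑ = (B j).indicator (fun _ => ‖c j‖ₑ) y := fun j y =>
    enorm_indicator_eq_indicator_enorm _ _
  have hg2 : MemLp g 2 μ := memLp_finsetSum _ fun j _ =>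
    memLp_indicator_const 2 (hBm j) (c j) (Or.inr (hBfin j))
  have hgG : ∀ y ∉ G, g y = 0 := fun y hy =>
    Finset.sum_eq_zero fun j _ => indicator_of_notMem (fun h => hy (hBG j h)) _
  have hgH : ∀ y, ‖g y‖ₑ ≤ 4 * (ENNReal.ofReal t * ENNReal.ofReal b) := fun y => by
    refine (enorm_sum_le _ _).trans (le_trans (Finset.sum_le_sum fun j hj => ?_) (hBsum y))
    rw [hφe]
    by_cases hy : y ∈ B j
    · have hy' : y ∈ B' j := by rw [hBv j hj] at hy; exact hy.1
      rw [indicator_of_mem hy, indicator_of_mem hy', hμB j hj,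
        ENNReal.le_div_iff_mul_le (Or.inl (hB0 j hj)) (Or.inl (hBfin j))]
      exact hcN j hj
    · rw [indicator_of_notMem hy]
      exact zero_le
  have hgN : ∫⁻ y, ‖g y‖ₑ ∂μ ≤ N := by
    calc ∫⁻ y, ‖g y‖ₑ ∂μ ≤ ∫⁻ y, ∑ j ∈ v, (B j).indicator (fun _ => ‖c j‖ₑ) y ∂μ := by
          refine lintegral_mono fun y => (enorm_sum_le _ _).trans (le_of_eq ?_)
          exact Finset.sum_congr rfl fun j _ => hφe j y
      _ = ∑ j ∈ v, ‖c j‖ₑ * μ (B j) := by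
          rw [lintegral_finsetSum _ fun j _ => measurable_const.indicator (hBm j)]
          exact Finset.sum_congr rfl fun j _ => by
            rw [lintegral_indicator (hBm j), setLIntegral_const]
      _ ≤ ∑ j ∈ v, ∑ z ∈ P j, ‖a z‖ₑ := Finset.sum_le_sum hcN
      _ = N := hPsum _
  -- the good part
  have hgood := hL2.measure_le hE hg2 hgG (by finiteness) hgH hgN (ENNReal.ofReal (t / 2))
  -- the bad part
  set w : Rn n → Rn n → ℂ := fun j x => ∑ z ∈ P j, a z * S x z - integralOp E S μ (φ j) x with hw
  set F := coneNorm (coneWeight E α) E (fun x => ∑ z ∈ s, a z * S x z) with hF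
  set W : Rn n → ℝ≥0∞ := fun y => ∑ j ∈ v, coneNorm (coneWeight E α) E (w j) y with hW
  have hWm : Measurable W := Finset.measurable_fun_sum v fun j _ => measurable_coneNorm _ _
  have hPE : ∀ j ∈ v, ↑(P j) ⊆ E := fun j hj z hz => hs (hPs j hj hz)
  have hTm : ∀ f : Rn n → ℂ, Integrable f μ →
      AEStronglyMeasurable (integralOp E S μ f) (coneWeight E α) := fun f hf =>
    aestronglyMeasurable_integralOp hE hS hmα hβ hK hf coneWeight_absolutelyContinuous
  have hwm : ∀ j ∈ v, AEStronglyMeasurable (w j) (coneWeight E α) := fun j hj =>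
    (hS.aestronglyMeasurable_sum (P j) (hPE j hj) a coneWeight_absolutelyContinuous).sub
      (hTm _ (hφi j))
  have hgi : Integrable g μ := integrable_finsetSum v fun j _ => hφi j
  have hdec : ∀ y, F y ≤ W y + coneNorm (coneWeight E α) E (integralOp E S μ g) y := by
    intro y
    have h1 : F y = coneNorm (coneWeight E α) E
        (fun x => (∑ j ∈ v, w j x) + integralOp E S μ g x) y := by
      rw [hF, coneNorm, coneNorm]
      congr 1
      refine setLIntegral_congr_fun (isOpen_cone hE y).measurableSet fun x hx => ?_
      have h2 := integralOp_sum hE hS hmα hβ hK v hφi hx.1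
      simp only [hw, Finset.sum_sub_distrib, hg, h2, sub_add_cancel, hPsum fun z => a z * S x z]
    rw [h1]
    refine (coneNorm_add_le _ (Finset.aestronglyMeasurable_fun_sum v hwm) (hTm g hgi) y).trans ?_
    exact add_le_add (coneNorm_sum_le _ v hwm y) le_rfl
  set X := ⋃ j ∈ v, closedBall j (10 * r j) with hX
  have hXm : MeasurableSet X := Finset.measurableSet_biUnion _ fun j _ => measurableSet_closedBall
  have hWint : ∫⁻ y in Xᶜ, W y ∂τ ≤ C * N := by
    rw [hW, lintegral_finsetSum _ fun j _ => measurable_coneNorm _ _]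
    calc _ ≤ ∑ j ∈ v, C * ∑ z ∈ P j, ‖a z‖ₑ := by
          refine Finset.sum_le_sum fun j hj => ?_
          obtain ⟨h1, h2, h3, h4, h5⟩ := hB' j hj
          refine le_trans (lintegral_mono_set (compl_subset_compl.2
            (subset_biUnion_of_mem (u := fun j => closedBall j (10 * r j)) hj))) ?_
          refine hC E S μ hE hS hμ G hL2 (P j) a j (r j) (k j) (B j) (c j) (hr j hj)
            (hs (hvs hj)) (hPE j hj) (hPj j hj) (hBm j) ((hBG j).trans hGE) (hBG j) ?_ (hBfin j)
            (hcB j hj) (hcN j hj) h5 ?_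
          · rw [hBv j hj]
            exact inter_subset_left.trans h1
          · rw [← hμB j hj]
            exact h4
      _ = C * N := by rw [← Finset.mul_sum, hPsum]
  have hbad : ENNReal.ofReal (t / 2) * τ ({y | ENNReal.ofReal (t / 2) < W y} ∩ Xᶜ) ≤ C * N := by
    refine le_trans ?_ hWint
    rw [← Measure.restrict_apply (measurableSet_lt measurable_const hWm)]
    exact le_trans (mul_le_mul' le_rfl (measure_mono fun y hy =>
      le_of_lt (show ENNReal.ofReal (t / 2) < W y from hy))) (mul_meas_ge_le_lintegral hWm _)
  set V := {y | ENNReal.ofReal (t / 2) < coneNorm (coneWeight E α) E (integralOp E S μ g) y}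
    with hV
  have hcov : {y | ENNReal.ofReal t < F y} ⊆
      (X ∪ ({y | ENNReal.ofReal (t / 2) < W y} ∩ Xᶜ)) ∪ V := by
    intro y hy
    by_cases hyX : y ∈ X
    · exact Or.inl (Or.inl hyX)
    by_cases hyW : ENNReal.ofReal (t / 2) < W y
    · exact Or.inl (Or.inr ⟨hyW, hyX⟩)
    · refine Or.inr ?_
      by_contra hyV
      have hy' : ENNReal.ofReal t < F y := hy
      refine absurd hy' (not_lt.2 ((hdec y).trans ((add_le_add (not_lt.1 hyW) (not_lt.1 hyV)).trans ?_)))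
      rw [← ENNReal.ofReal_add (by positivity) (by positivity), add_halves]
  have htt : ENNReal.ofReal t = 2 * ENNReal.ofReal (t / 2) := by
    rw [show (2 : ℝ≥0∞) = ENNReal.ofReal 2 by simp, ← ENNReal.ofReal_mul (by norm_num)]
    congr 1; ring
  have ht2 : ENNReal.ofReal (t / 2) ≠ 0 := by simpa using ht
  have hgood' : ENNReal.ofReal (t / 2) * τ V ≤ 8 * ENNReal.ofReal A ^ 2 * ENNReal.ofReal b * N := by
    refine (ENNReal.mul_le_mul_iff_right ht2 ENNReal.ofReal_ne_top).1 ?_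
    rw [htt] at hgood
    calc _ = ENNReal.ofReal (t / 2) ^ 2 * τ V := by ring
      _ ≤ _ := hgood
      _ = _ := by ring
  calc ENNReal.ofReal t * τ {y | ENNReal.ofReal t < F y}
      ≤ ENNReal.ofReal t * (τ X + τ ({y | ENNReal.ofReal (t / 2) < W y} ∩ Xᶜ) + τ V) := by
        refine mul_le_mul' le_rfl ((measure_mono hcov).trans ((measure_union_le _ _).trans ?_))
        exact add_le_add (measure_union_le _ _) le_rfl
    _ = ENNReal.ofReal t * τ X + 2 * (ENNReal.ofReal (t / 2) *
          τ ({y | ENNReal.ofReal (t / 2) < W y} ∩ Xᶜ)) + 2 * (ENNReal.ofReal (t / 2) * τ V) := by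
        rw [mul_add, mul_add]
        nth_rewrite 2 3 [htt]
        ring
    _ ≤ N + 2 * (C * N) + 2 * (8 * ENNReal.ofReal A ^ 2 * ENNReal.ofReal b * N) := by
        exact add_le_add (add_le_add hEx (mul_le_mul' le_rfl hbad)) (mul_le_mul' le_rfl hgood')
    _ = ENNReal.ofReal c₀ * N := by
        rw [hc₀, ENNReal.ofReal_add (by positivity) (by positivity),
          ENNReal.ofReal_add (by positivity) (by positivity), ENNReal.ofReal_mul (by positivity),
          ENNReal.ofReal_mul (by positivity), ENNReal.ofReal_mul (by positivity),
          ENNReal.ofReal_pow (by positivity), ENNReal.ofReal_toReal (by finiteness)]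
        simp only [ENNReal.ofReal_one, ENNReal.ofReal_ofNat, ENNReal.ofReal_coe_nnreal]
        ring

theorem HasBigPieces.mono {P P' : Set (Rn n) → Prop} (h : HasBigPieces E μ b κ θ P)
    (hP : ∀ (G : Set (Rn n)) (y : Rn n) (r : ℝ), MeasurableSet G → G ⊆ closedBall y r ∩ E →
      P G → P' G) : HasBigPieces E μ b κ θ P' := by
  intro y hy r hr h1 h2
  obtain ⟨G, hG, hGs, hGθ, hGP⟩ := h y hy r hr h1 h2
  exact ⟨G, hG, hGs, hGθ, hP G y r hG hGs hGP⟩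

end ConicalSquare

/-! ### The theorem. -/

theorem theorem4p3 (n : ℕ) :
    -- `b` and `κ` are large enough, depending only on the dimension
    ∃ b₀ κ₀ : ℝ, ∀ b κ : ℝ, b₀ ≤ b → κ₀ ≤ κ →
      ∀ m α β K₁ K₂ C₀ θ A p : ℝ, 0 < m → α ∈ Ioc (0 : ℝ) 1 → β ∈ Ioc (0 : ℝ) 1 →
        0 < K₁ → 0 < K₂ → 0 < C₀ → θ ∈ Ioo (0 : ℝ) 1 → 0 < A → 1 < p →
      -- the norm bound depends only on `p` and the preceding constants
      ∃ K : ℝ≥0, ∀ (E : Set (Rn n)) (S : Rn n → Rn n → ℂ) (μ : Measure (Rn n)),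
        IsClosed E → IsKernel E m α β K₁ K₂ S → IsOfOrder E m C₀ μ →
          (HasBigPieces E μ b κ θ (IsWeakBoundedOn E α S μ A) →
            IsLpBounded E α S μ (ENNReal.ofReal p) K) ∧
          (HasBigPieces E μ b κ θ (IsL2BoundedOn E α S μ A) →
            IsLpBounded E α S μ (ENNReal.ofReal p) K) := by
  refine ⟨100 ^ (n + 1), 21, ?_⟩
  intro b κ hb hκ m α β K₁ K₂ C₀ θ A p hm hα hβ hK₁ hK₂ hC₀ hθ hA hp
  rcases lt_or_ge (n : ℝ) m with hnm | hmn
  · refine ⟨0, fun E S μ hE hS hμ => ?_⟩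
    have h0 : μ = 0 := hμ.eq_zero_of_lt hE hnm
    have : IsLpBounded E α S μ (ENNReal.ofReal p) 0 := by
      intro f _
      subst h0
      simp
    exact ⟨fun _ => this, fun _ => this⟩
  obtain ⟨A', hA', hweak⟩ := exists_isDiscreteWeakBoundedOn n hm hα hβ.1 hK₁ hK₂ hC₀ A
  -- The maximum of the given and the derived weak type constants lets a single `K` serve both
  -- hypotheses.
  obtain ⟨K, hK⟩ := exists_isLpBounded (K₂ := K₂) n hm hα hβ.1 hK₁ hC₀ hmn hb hκ hθ
    (lt_max_of_lt_left hA : 0 < max A A') hp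
  refine ⟨K, fun E S μ hE hS hμ => ⟨fun h => ?_, fun h => ?_⟩⟩
  · exact hK E S μ hE hS hμ (h.mono fun G y r _ _ hG =>
      (hG.isDiscreteWeakBoundedOn hE).mono (le_max_left _ _))
  · have := hμ.isLocallyFiniteMeasure hE
    refine hK E S μ hE hS hμ (h.mono fun G y r hGm hGs hG => ?_)
    exact (hweak E S μ hE hS hμ G hGm (hGs.trans inter_subset_right)
      (ne_top_of_le_ne_top measure_closedBall_lt_top.ne
        (measure_mono (hGs.trans inter_subset_left))) hG).mono (le_max_right _ _)
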